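/- **Theorem.** Let $\mathcal X,\mathcal Y$ be finite alphabets, $P_{YX}$ a probability distribution on $\mathcal Y\times\mathcal X$ with marginals $P_Y,P_X$, and let $R_c\ge 0$. For each $n$ let $Q_{Y^n}$ and $Q_{X^n}$ be probability distributions on $\mathcal Y^n$ and $\mathcal X^n$. Consider testing $H_0\colon (y^n,x^n)\sim P_{YX}^{\otimes n}$ against $H_1\colon (y^n,x^n)\sim Q_{Y^n}\times Q_{X^n}$ by schemes $(\phi_n,\psi_n)$, where $\phi_n\colon\mathcal X^n\to\mathcal M_n$ is a map into a finite set of size $|\phi_n|=|\mathcal M_n|$ and $\psi_n$ is a (possibly randomized) decision in $\{0,1\}$ based on $(y^n,\phi_n(x^n))$. Let $\alpha_n$ be the probability under $H_0$ that $\psi_n$ outputs $1$, and $\beta_n$ the probability under $H_1$ that $\psi_n$ outputs $0$. For $\epsilon\in[0,1)$, a number $E$ is $\epsilon$-achievable at rate $R_c$ if there is a sequence of schemes with $$\limsup_{n\to\infty}\alpha_n\le\epsilon,\qquad \liminf_{n\to\infty}\tfrac1n\log\tfrac1{\beta_n}\ge E,\qquad \limsup_{n\to\infty}\tfrac1n\log|\phi_n|\le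 R_c,$$ and $E^\star_\epsilon(R_c)$ is the supremum of all $\epsilon$-achievable $E$. Assume one of the following. 1. $Q_{Y^n}=Q_Y^{\otimes n}$ and $Q_{X^n}=Q_X^{\otimes n}$ for all $n$, with $D(P_Y\|Q_Y)<\infty$ and $D(P_X\|Q_X)<\infty$. In this case put $d^\star=D(P_X\|Q_X)+D(P_Y\|Q_Y)$. 2. $(Q_{Y^n})_n$ and $(Q_{X^n})_n$ are the laws of the first $n$ letters of Markov processes of finite order with stationary (time-independent) transition probabilities and arbitrary initial laws, and $P_Y^{\otimes n}\ll Q_{Y^n}$, $P_X^{\otimes n}\ll Q_{X^n}$ for all $n$. In this case the limits $$A_X=\lim_{n\to\infty}\bigl[D(P_X^{\otimes(n+1)}\|Q_{X^{n+1}})-D(P_X^{\otimes n}\|Q_{X^n})\bigr],\quad A_Y=\lim_{n\to\infty}\bigl[D(P_Y^{\otimes(n+1)}\|Q_{Y^{n+1}})-D(P_Y^{\otimes n}\|Q_{Y^n})\bigr]$$ exist and are finite; put $d^\star=A_X+A_Y$. Then for every $\epsilon\in[0,1)$ $$E^\star_\epsilon(R_c)=\max_{P_{U|X}\colon I(U;X)\le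 R_c} I(Y;U)+d^\star ,$$ where the maximum, which is attained, is over all channels $P_{U|X}$ from $\mathcal X$ to finite alphabets, $(Y,X,U)\sim P_{YX}P_{U|X}$. -/

import Mathlib

open MeasureTheory ProbabilityTheory InformationTheory Filter Topology
open scoped ENNReal

namespace OneSidedTesting

noncomputable section

/-- The mutual information `I(A;B) = D(P_{AB} ‖ P_A × P_B)` of a joint law. -/
def mutualInfo {𝒜 ℬ : Type*} [MeasurableSpace 𝒜] [MeasurableSpace ℬ]
    (μ : Measure (𝒜 × ℬ)) : ℝ≥0∞ :=
  klDiv μ (μ.fst.prod μ.snd)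

/-- The law of `(Y, X, U)`, `(Y, X) ∼ P` and `U` drawn from `X` through the channel `W = P_{U|X}`,
so that `U - X - Y` is a Markov chain. -/
def lawYXU {𝒳 𝒴 𝒰 : Type*} [MeasurableSpace 𝒳] [MeasurableSpace 𝒴] [MeasurableSpace 𝒰]
    (P : Measure (𝒴 × 𝒳)) (W : Kernel 𝒳 𝒰) : Measure ((𝒴 × 𝒳) × 𝒰) :=
  P ⊗ₘ (W.prodMkLeft 𝒴)

/-- All values `I(Y;U)` with `U` on a finite alphabet, `P_{U|X}` arbitrary with `I(U;X) ≤ R`. -/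
def infoValues {𝒳 𝒴 : Type*} [MeasurableSpace 𝒳] [MeasurableSpace 𝒴]
    (P : Measure (𝒴 × 𝒳)) (R : ℝ) : Set ℝ≥0∞ :=
  {v | ∃ (k : ℕ) (W : Kernel 𝒳 (Fin k)), IsMarkovKernel W ∧
    mutualInfo ((lawYXU P W).map (fun z => (z.2, z.1.2))) ≤ ENNReal.ofReal R ∧
    v = mutualInfo ((lawYXU P W).map (fun z => (z.1.1, z.2)))}

/-- A testing scheme at block length `n`: a compression map `φ` with `M` messages, and a possibly
randomized decision `ψ`; `ψ (y, m) j` is the probability of deciding for hypothesis `H_j`. -/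
structure TestingScheme (𝒳 𝒴 : Type*) (n : ℕ) where
  M : ℕ
  φ : (Fin n → 𝒳) → Fin M
  ψ : (Fin n → 𝒴) × Fin M → PMF (Fin 2)

section Errors

variable {𝒳 𝒴 : Type*} [MeasurableSpace 𝒳] [MeasurableSpace 𝒴]

/-- The law of `(y^n, φ(x^n))` when `(y^n, x^n) ∼ μ`. -/
def TestingScheme.observed {n : ℕ} (s : TestingScheme 𝒳 𝒴 n)
    (μ : Measure ((Fin n → 𝒴) × (Fin n → 𝒳))) : Measure ((Fin n → 𝒴) × Fin s.M) :=
  μ.map (fun z => (z.1, s.φ z.2))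

/-- Type I error: deciding `H_1` when the data has the law `μ` of `H_0`. -/
def TestingScheme.typeI {n : ℕ} (s : TestingScheme 𝒳 𝒴 n)
    (μ : Measure ((Fin n → 𝒴) × (Fin n → 𝒳))) : ℝ≥0∞ :=
  ∫⁻ z, s.ψ z 1 ∂(s.observed μ)

/-- Type II error: deciding `H_0` when the data has the law `ν` of `H_1`. -/
def TestingScheme.typeII {n : ℕ} (s : TestingScheme 𝒳 𝒴 n)
    (ν : Measure ((Fin n → 𝒴) × (Fin n → 𝒳))) : ℝ≥0∞ :=
  ∫⁻ z, s.ψ z 0 ∂(s.observed ν)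

/-- `E` is an `ε`-achievable type II error exponent at compression rate `R` for testing `(H₀ n)`
against `(H₁ n)`. -/
def IsAchievable (H₀ H₁ : (n : ℕ) → Measure ((Fin n → 𝒴) × (Fin n → 𝒳)))
    (R ε E : ℝ) : Prop :=
  ∃ s : (n : ℕ) → TestingScheme 𝒳 𝒴 n,
    limsup (fun n => (s n).typeI (H₀ n)) atTop ≤ ENNReal.ofReal ε ∧
    (E : EReal) ≤ liminf (fun n : ℕ => ENNReal.log ((s n).typeII (H₁ n))⁻¹ / (n : EReal)) atTop ∧
    limsup (fun n : ℕ => ((Real.log (s n).M / n : ℝ) : EReal)) atTop ≤ (R : EReal)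

/-- `E⋆_ε(R)`, the supremum of all `ε`-achievable error exponents. -/
def maxExponent (H₀ H₁ : (n : ℕ) → Measure ((Fin n → 𝒴) × (Fin n → 𝒳)))
    (R ε : ℝ) : EReal :=
  sSup ((fun E : ℝ => (E : EReal)) '' {E | IsAchievable H₀ H₁ R ε E})

/-- The law `P_{YX}^{⊗n}`, arranged as a law of the pair `(y^n, x^n)`. -/
def iidPair (P : Measure (𝒴 × 𝒳)) (n : ℕ) : Measure ((Fin n → 𝒴) × (Fin n → 𝒳)) :=
  (Measure.pi (fun _ : Fin n => P)).map (fun ω => (fun i => (ω i).1, fun i => (ω i).2))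

end Errors

/-- The `n`-fold product `P^{⊗n}`. -/
def iid {𝒳 : Type*} [MeasurableSpace 𝒳] (P : Measure 𝒳) (n : ℕ) : Measure (Fin n → 𝒳) :=
  Measure.pi (fun _ : Fin n => P)

/-- `(Q n)` are the finite-dimensional laws of the first `n` letters of a Markov process of some
finite order `k` with stationary (time-homogeneous) transition probabilities `W`; the law of the
first `k` letters is arbitrary. -/
structure IsFiniteOrderMarkov {𝒳 : Type*} [MeasurableSpace 𝒳]
    (Q : (n : ℕ) → Measure (Fin n → 𝒳)) : Prop where
  prob : ∀ n, IsProbabilityMeasure (Q n)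
  consistent : ∀ n, (Q (n + 1)).map (fun x => Fin.init x) = Q n
  transition : ∃ (k : ℕ) (W : Kernel (Fin k → 𝒳) 𝒳), IsMarkovKernel W ∧
    ∀ (n : ℕ) (x : Fin (n + k + 1) → 𝒳),
      Q (n + k + 1) {x} =
        Q (n + k) {Fin.init x} *
          W (fun i => x (Fin.castSucc (Fin.natAdd n i))) {x (Fin.last (n + k))}

/-- `A = lim_n [D(P^{⊗(n+1)} ‖ Q_{n+1}) - D(P^{⊗n} ‖ Q_n)]`, the limit existing. -/
def HasDivergenceRate {𝒳 : Type*} [MeasurableSpace 𝒳] (P : Measure 𝒳)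
    (Q : (n : ℕ) → Measure (Fin n → 𝒳)) (A : EReal) : Prop :=
  Tendsto (fun n => (klDiv (iid P (n + 1)) (Q (n + 1)) : EReal) - (klDiv (iid P n) (Q n) : EReal))
    atTop (𝓝 A)

end

end OneSidedTesting

/-! Entropies are written through `homEntropy`, homogeneous of degree one, so that a conditional
entropy given U is a plain sum over u of entropies of unnormalized weights. The law of (Y,X)
together with H(X|U), H(Y|U), H(YX|U) is then a point of `profileSet`, the convex hull of a compact
set in finite dimension, hence compact, and the alphabet of U never has to be bounded by hand.
Closed inequalities single out the channel profiles: the Gibbs inequality gives H(Y|X,U) ≤ -E log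
P_{Y|X}, and imposing the reverse inequality forces its equality case, which is the Markov chain U -
X - Y (`exists_channel_of_mem_feasibleSet`). Maximizing I(Y;U) is minimizing the coordinate H(Y|U)
on a compact set, so the maximum is attained.

The strong converse is a change of measure. From any scheme whose acceptance probability under H_0
stays away from 0, averaging over the messages (`exists_good_message`) produces a product set B × S
of words on which φ is constant, whose P^{⊗n}-mass is at least a constant over M and at least a
constant times the mass of S, while the P_Y-mass of B is at most about exp(-n(E - d⋆)). Conditioning
P^{⊗n} on B × S and single-letterizing by the chain rule, with the remaining letters as U, turns
these three mass bounds into the rate constraint, the Markov constraint and the bound on H(Y|U),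
each up to o(1) (`exists_approx_feasible`). A limit point of these profiles is exactly feasible.
Since only the exponential order of the masses matters, the bound is the same for all ε < 1.

For achievability, a greedy covering (`exists_cover`) picks about exp(nr) codewords, I(U;X) < r < R,
and the receiver tests the information density between y and the codeword. The P_Y-mass of each
decision region is at most exp(-nJ) for any J < I(Y;U), and the type I error tends to 0. Rate
exactly R is reached by mixing with the constant channel; at R = 0 the data processing inequality
makes the information term vanish.

The term d⋆ enters both halves only through the law of large numbers for log(P^{⊗n}/Q_n): on typical
words Q_n may be exchanged for P^{⊗n} at the cost of exp(-nA) up to exp(o(n)). For Markov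
alternatives this ratio is a sliding-block sum; memoryless ones are the case of order 0. -/

namespace OneSidedTesting

/-! ### Entropy of unnormalized weights and the Gibbs inequality -/

section Entropy

open Real (negMulLog)

variable {α ι : Type*} [Fintype α]

/-- The entropy of a finite measure given by its weights, normalized to be homogeneous of degree
one: for `r = t • p` with `p` a probability vector it is `t` times the entropy of `p`. -/
noncomputable def homEntropy (r : α → ℝ) : ℝ := ∑ a, negMulLog (r a) - negMulLog (∑ a, r a)

lemma homEntropy_smul (t : ℝ) (r : α → ℝ) : homEntropy (t • r) = t * homEntropy r := by
  simp only [homEntropy, Pi.smul_apply, smul_eq_mul, ← Finset.mul_sum, Real.negMulLog_mul]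
  rw [Finset.sum_add_distrib, ← Finset.sum_mul, ← Finset.mul_sum]
  ring

lemma continuous_homEntropy : Continuous (homEntropy : (α → ℝ) → ℝ) := by
  unfold homEntropy
  have := Real.continuous_negMulLog
  fun_prop

/-- This is log t ≤ t - 1 at t = b / a, with its equality case; summed over letters it becomes the
Gibbs inequality. The assumption on zeros is needed because the logarithm of 0 is 0 by convention.
-/
lemma sub_le_mul_log_sub {a b : ℝ} (ha : 0 ≤ a) (hb : 0 ≤ b) (h : b = 0 → a = 0) :
    0 ≤ a * Real.log a - a * Real.log b - a + b ∧
      (a * Real.log a - a * Real.log b - a + b ≤ 0 → a = b) := by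
  rcases hb.eq_or_lt with rfl | hb
  · simp [h rfl]
  rcases ha.eq_or_lt with rfl | ha
  · simpa [hb.le] using fun h => absurd h (not_le.2 hb)
  have key : a * Real.log a - a * Real.log b - a + b = a * (b / a - 1 - Real.log (b / a)) := by
    rw [Real.log_div hb.ne' ha.ne']; field_simp; ring
  rw [key]
  refine ⟨mul_nonneg ha.le (by linarith [Real.log_le_sub_one_of_pos (div_pos hb ha)]), fun h0 => ?_⟩
  by_contra hne
  have h1 : b / a ≠ 1 := fun h => hne (by field_simp at h; exact h.symm)
  have := Real.log_lt_sub_one_of_pos (div_pos hb ha) h1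
  have : 0 < a * (b / a - 1 - Real.log (b / a)) := mul_pos ha (by linarith)
  linarith

lemma mul_log_mul_eq {a t v : ℝ} (hv : v = 0 → a = 0) (ht : t = 0 → a = 0) :
    a * Real.log (t * v) = a * Real.log t + a * Real.log v := by
  by_cases h : a = 0
  · simp [h]
  · rw [Real.log_mul (fun h' => h (ht h')) (fun h' => h (hv h'))]; ring

/-- The linear terms cancel after summation, since `r` and its total mass times `V` have equal sums.
They are inserted to make every summand nonnegative. -/
lemma gibbs_aux {r V : α → ℝ} (hr : ∀ a, 0 ≤ r a) (hV1 : ∑ a, V a = 1)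
    (hrV : ∀ a, V a = 0 → r a = 0) :
    -∑ a, r a * Real.log (V a) - homEntropy r =
      ∑ a, (r a * Real.log (r a) - r a * Real.log ((∑ a, r a) * V a) - r a + (∑ a, r a) * V a) := by
  have h0 : (∑ a, r a) = 0 → ∀ a, r a = 0 := fun h a =>
    (Finset.sum_eq_zero_iff_of_nonneg (fun a _ => hr a)).1 h a (Finset.mem_univ a)
  have : ∀ a, r a * Real.log ((∑ a, r a) * V a)
      = r a * Real.log (∑ a, r a) + r a * Real.log (V a) :=
    fun a => mul_log_mul_eq (hrV a) (fun h => h0 h a)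
  simp only [this, homEntropy, negMulLog, Finset.sum_add_distrib, Finset.sum_sub_distrib,
    ← Finset.mul_sum, ← Finset.sum_mul, hV1]
  simp only [neg_mul, Finset.sum_neg_distrib]
  ring

/-- The Gibbs inequality. -/
lemma homEntropy_le {r V : α → ℝ} (hr : ∀ a, 0 ≤ r a) (hV : ∀ a, 0 ≤ V a) (hV1 : ∑ a, V a = 1)
    (hrV : ∀ a, V a = 0 → r a = 0) : homEntropy r ≤ -∑ a, r a * Real.log (V a) := by
  have h := gibbs_aux hr hV1 hrV
  have : 0 ≤ -∑ a, r a * Real.log (V a) - homEntropy r := by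
    rw [h]
    refine Finset.sum_nonneg fun a _ => (sub_le_mul_log_sub (hr a)
      (mul_nonneg (Finset.sum_nonneg fun a _ => hr a) (hV a)) fun h => ?_).1
    rcases mul_eq_zero.1 h with h | h
    · exact (Finset.sum_eq_zero_iff_of_nonneg (fun a _ => hr a)).1 h a (Finset.mem_univ a)
    · exact hrV a h
  linarith

/-- The equality case of the Gibbs inequality. -/
lemma eq_of_le_homEntropy {r V : α → ℝ} (hr : ∀ a, 0 ≤ r a) (hV : ∀ a, 0 ≤ V a)
    (hV1 : ∑ a, V a = 1) (hrV : ∀ a, V a = 0 → r a = 0)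
    (h : -∑ a, r a * Real.log (V a) ≤ homEntropy r) (a : α) : r a = (∑ a, r a) * V a := by
  have h' := gibbs_aux hr hV1 hrV
  have hz : ∀ a, ((∑ a, r a) * V a = 0 → r a = 0) := fun a h => by
    rcases mul_eq_zero.1 h with h | h
    · exact (Finset.sum_eq_zero_iff_of_nonneg (fun a _ => hr a)).1 h a (Finset.mem_univ a)
    · exact hrV a h
  have hnn := fun a => sub_le_mul_log_sub (hr a)
      (mul_nonneg (Finset.sum_nonneg fun a _ => hr a) (hV a)) (hz a)
  have hs := (Finset.sum_eq_zero_iff_of_nonneg (fun a (_ : a ∈ Finset.univ) => (hnn a).1)).1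
    (le_antisymm (by linarith) (Finset.sum_nonneg fun a _ => (hnn a).1)) a (Finset.mem_univ a)
  exact (hnn a).2 hs.le

lemma homEntropy_eq_neg_sum_mul_log {r : α → ℝ} (hr : ∀ a, 0 ≤ r a) :
    homEntropy r = -∑ a, r a * Real.log (r a / ∑ b, r b) := by
  have : ∀ a, r a * Real.log (r a / ∑ b, r b)
      = r a * Real.log (r a) - r a * Real.log (∑ b, r b) := fun a => by
    by_cases h : r a = 0
    · simp [h]
    · have : (∑ b, r b) ≠ 0 := fun h0 =>
        h ((Finset.sum_eq_zero_iff_of_nonneg (fun a _ => hr a)).1 h0 a (Finset.mem_univ a))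
      rw [Real.log_div h this]; ring
  simp only [this, homEntropy, negMulLog, Finset.sum_sub_distrib, ← Finset.sum_mul, neg_mul,
    Finset.sum_neg_distrib]
  ring

/-- Concavity in its homogeneous form: apply the Gibbs inequality to `r` and to `s` against the same
`V`, the normalization of `r + s`, and add; for `r + s` itself that inequality is an equality. -/
lemma homEntropy_add_le {r s : α → ℝ} (hr : ∀ a, 0 ≤ r a) (hs : ∀ a, 0 ≤ s a) :
    homEntropy r + homEntropy s ≤ homEntropy (r + s) := by
  have hrs : ∀ a, 0 ≤ (r + s) a := fun a => add_nonneg (hr a) (hs a)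
  rcases (Finset.sum_nonneg fun a (_ : a ∈ Finset.univ) => hrs a).eq_or_lt with h0 | hpos
  · have h := (Finset.sum_eq_zero_iff_of_nonneg (fun a (_ : a ∈ Finset.univ) => hrs a)).1 h0.symm
    have hr0 : r = 0 := funext fun a => by
      have := h a (Finset.mem_univ a); simp only [Pi.add_apply] at this
      exact le_antisymm (by simp only [Pi.zero_apply]; linarith [hs a]) (hr a)
    have hs0 : s = 0 := funext fun a => by
      have := h a (Finset.mem_univ a); simp only [Pi.add_apply] at this
      exact le_antisymm (by simp only [Pi.zero_apply]; linarith [hr a]) (hs a)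
    simp [hr0, hs0, homEntropy]
  set V : α → ℝ := fun a => (r + s) a / ∑ b, (r + s) b with hVdef
  have hV : ∀ a, 0 ≤ V a := fun a => div_nonneg (hrs a) hpos.le
  have hV1 : ∑ a, V a = 1 := by rw [hVdef, ← Finset.sum_div, div_self hpos.ne']
  have hz : ∀ a, V a = 0 → (r + s) a = 0 := fun a h => by
    rcases div_eq_zero_iff.1 h with h | h
    · exact h
    · exact absurd h hpos.ne'
  have h1 := homEntropy_le hr hV hV1 fun a h => by
    have := hz a h; simp only [Pi.add_apply] at this
    exact le_antisymm (by linarith [hs a]) (hr a)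
  have h2 := homEntropy_le hs hV hV1 fun a h => by
    have := hz a h; simp only [Pi.add_apply] at this
    exact le_antisymm (by linarith [hr a]) (hs a)
  rw [homEntropy_eq_neg_sum_mul_log hrs]
  have : ∑ a, (r + s) a * Real.log (V a)
      = ∑ a, r a * Real.log (V a) + ∑ a, s a * Real.log (V a) := by
    simp only [Pi.add_apply, add_mul, Finset.sum_add_distrib]
  linarith

lemma sum_homEntropy_le (s : Finset ι) {r : ι → α → ℝ} (hr : ∀ i a, 0 ≤ r i a) :
    ∑ i ∈ s, homEntropy (r i) ≤ homEntropy (∑ i ∈ s, r i) := by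
  classical
  induction s using Finset.induction_on with
  | empty => simp [homEntropy]
  | insert i s hi ih =>
    rw [Finset.sum_insert hi, Finset.sum_insert hi]
    refine le_trans (by linarith) (homEntropy_add_le (hr i) fun a => ?_)
    rw [Finset.sum_apply]
    exact Finset.sum_nonneg fun j _ => hr j a

/-- The chain rule. -/
lemma homEntropy_prod {β : Type*} [Fintype β] (r : α × β → ℝ) :
    homEntropy r = homEntropy (fun a => ∑ b, r (a, b)) + ∑ a, homEntropy (fun b => r (a, b)) := by
  simp only [homEntropy, Fintype.sum_prod_type, Finset.sum_sub_distrib]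
  ring

lemma homEntropy_comp_equiv {β : Type*} [Fintype β] (e : β ≃ α) (r : α → ℝ) :
    homEntropy (fun b => r (e b)) = homEntropy r := by
  simp only [homEntropy, e.sum_comp (fun a => negMulLog (r a)), e.sum_comp r]

lemma homEntropy_eq_zero_of_unique [Unique α] (r : α → ℝ) : homEntropy r = 0 := by
  simp [homEntropy]

end Entropy

/-! ### Compactness of convex hulls -/

open Classical in
lemma sum_dite_choose_embedding {ι κ A : Type*} [Fintype ι] [Fintype κ] [AddCommMonoid A]
    (f : ι ↪ κ) (g : ι → A) :
    ∑ j, (if h : ∃ i, f i = j then g h.choose else 0) = ∑ i, g i := by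
  rw [← Finset.sum_subset (Finset.subset_univ (Finset.univ.map f))]
  · rw [Finset.sum_map]
    refine Finset.sum_congr rfl fun i _ => ?_
    have h : ∃ i', f i' = f i := ⟨i, rfl⟩
    rw [dif_pos h, f.injective h.choose_spec]
  · intro j _ hj
    rw [dif_neg]
    rintro ⟨i, rfl⟩
    exact hj (by simp)

/-- The convex hull of a compact set in a finite-dimensional space is compact. -/
lemma isCompact_convexHull {E : Type*} [NormedAddCommGroup E] [NormedSpace ℝ E]
    [FiniteDimensional ℝ E] {s : Set E} (hs : IsCompact s) : IsCompact (convexHull ℝ s) := by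
  classical
  rcases s.eq_empty_or_nonempty with rfl | ⟨x₀, hx₀⟩
  · simp
  set N := Module.finrank ℝ E + 1
  have : convexHull ℝ s = (fun q : (Fin N → ℝ) × (Fin N → E) => ∑ i, q.1 i • q.2 i) ''
      (stdSimplex ℝ (Fin N) ×ˢ Set.univ.pi fun _ => s) := by
    apply Set.Subset.antisymm
    · intro x hx
      -- Carathéodory: affinely independent points number at most dim + 1. Unused slots receive
      -- weight 0 and the dummy point `x₀`, so that one compact parameter space serves all points.
      obtain ⟨ι, _, z, w, hz, haff, hw, hw1, rfl⟩ := eq_pos_convex_span_of_mem_convexHull hx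
      have hcard : Fintype.card ι ≤ N := by
        have := haff.card_le_finrank_succ
        exact this.trans (Nat.succ_le_succ (Submodule.finrank_le _))
      obtain ⟨f⟩ : Nonempty (ι ↪ Fin N) :=
        Function.Embedding.nonempty_of_card_le (by simpa using hcard)
      refine ⟨(fun j => if h : ∃ i, f i = j then w h.choose else 0,
        fun j => if h : ∃ i, f i = j then z h.choose else x₀), ⟨⟨?_, ?_⟩, ?_⟩, ?_⟩
      · intro j
        dsimp only
        split_ifs
        · exact (hw _).le
        · exact le_rfl
      · rw [← hw1, ← sum_dite_choose_embedding f w]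
        refine Finset.sum_congr rfl fun j _ => ?_
        dsimp only
        split_ifs <;> rfl
      · intro j _
        dsimp only
        split_ifs
        · exact hz ⟨_, rfl⟩
        · exact hx₀
      · rw [← sum_dite_choose_embedding f]
        refine Finset.sum_congr rfl fun j _ => ?_
        dsimp only
        split_ifs
        · rfl
        · simp
    · rintro _ ⟨⟨w, z⟩, ⟨hw, hz⟩, rfl⟩
      exact mem_convexHull_of_exists_fintype w z hw.1 hw.2 (fun i => hz i trivial) rfl
  rw [this]
  refine ((isCompact_stdSimplex ℝ (Fin N)).prod (isCompact_univ_pi fun _ => hs)).image ?_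
  fun_prop

/-! ### Profiles: a law of (Y,X) with its conditional entropies -/

section Profile

open scoped Pointwise

variable {𝒳 𝒴 : Type*} [Fintype 𝒳] [Fintype 𝒴]

/-- The first marginal of a weight function. -/
def margFst {α β : Type*} [Fintype β] (r : α × β → ℝ) (a : α) : ℝ := ∑ b, r (a, b)

/-- The second marginal of a weight function. -/
def margSnd {α β : Type*} [Fintype α] (r : α × β → ℝ) (b : β) : ℝ := ∑ a, r (a, b)

/-- A law of `(Y, X)` together with values for the entropies of `X`, of `Y` and of `(Y, X)`. -/
abbrev Profile (𝒳 𝒴 : Type*) : Type _ := (𝒴 × 𝒳 → ℝ) × ℝ × ℝ × ℝ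

/-- The profile of a weight function. -/
noncomputable def profile (r : 𝒴 × 𝒳 → ℝ) : Profile 𝒳 𝒴 :=
  (r, homEntropy (margSnd r), homEntropy (margFst r), homEntropy r)

/-- The laws of `(Y, X)` with conditional entropies given an auxiliary variable. -/
def profileSet (𝒳 𝒴 : Type*) [Fintype 𝒳] [Fintype 𝒴] : Set (Profile 𝒳 𝒴) :=
  convexHull ℝ (profile '' stdSimplex ℝ (𝒴 × 𝒳))

/-- The cone spanned by `profileSet`. -/
def profileCone (𝒳 𝒴 : Type*) [Fintype 𝒳] [Fintype 𝒴] : Set (Profile 𝒳 𝒴) :=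
  {c | ∃ t : ℝ, 0 ≤ t ∧ ∃ k ∈ profileSet 𝒳 𝒴, c = t • k}

/-- This takes the place of a cardinality bound on the auxiliary variable: limits of profiles are
again profiles of finite mixtures. -/
lemma isCompact_profileSet : IsCompact (profileSet 𝒳 𝒴) := by
  refine isCompact_convexHull ((isCompact_stdSimplex ℝ (𝒴 × 𝒳)).image ?_)
  unfold profile margFst margSnd
  refine continuous_id.prodMk (Continuous.prodMk ?_ (Continuous.prodMk ?_ continuous_homEntropy)) <;>
  · refine continuous_homEntropy.comp ?_
    fun_prop

lemma profile_smul (t : ℝ) (r : 𝒴 × 𝒳 → ℝ) : profile (t • r) = t • profile r := by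
  have h1 : margFst (t • r) = t • margFst r := by
    ext; simp [margFst, Finset.mul_sum]
  have h2 : margSnd (t • r) = t • margSnd r := by
    ext; simp [margSnd, Finset.mul_sum]
  simp only [profile, h1, h2, homEntropy_smul]
  rfl

lemma profileSet_nonempty [Nonempty 𝒳] [Nonempty 𝒴] : (profileSet 𝒳 𝒴).Nonempty := by
  classical
  obtain ⟨z⟩ : Nonempty (𝒴 × 𝒳) := inferInstance
  exact ⟨_, subset_convexHull ℝ _ ⟨_, single_mem_stdSimplex ℝ z, rfl⟩⟩

lemma mem_profileCone [Nonempty 𝒳] [Nonempty 𝒴] {r : 𝒴 × 𝒳 → ℝ} (hr : ∀ z, 0 ≤ r z) :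
    profile r ∈ profileCone 𝒳 𝒴 := by
  rcases (Finset.sum_nonneg fun z (_ : z ∈ Finset.univ) => hr z).eq_or_lt with h | h
  · obtain ⟨k, hk⟩ := profileSet_nonempty (𝒳 := 𝒳) (𝒴 := 𝒴)
    refine ⟨0, le_rfl, k, hk, ?_⟩
    have : r = (0 : ℝ) • r := by
      ext z
      simpa using (Finset.sum_eq_zero_iff_of_nonneg (fun z _ => hr z)).1 h.symm z (Finset.mem_univ z)
    rw [this, profile_smul, zero_smul, zero_smul]
  · refine ⟨∑ z, r z, h.le, profile ((∑ z, r z)⁻¹ • r), subset_convexHull ℝ _ ⟨_, ⟨?_, ?_⟩, rfl⟩, ?_⟩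
    · intro z
      exact mul_nonneg (inv_nonneg.2 h.le) (hr z)
    · simp only [Pi.smul_apply, smul_eq_mul, ← Finset.mul_sum]
      exact inv_mul_cancel₀ h.ne'
    · rw [profile_smul, smul_smul, mul_inv_cancel₀ h.ne', one_smul]

/-- For convex K one has sK + tK = (s + t)K; in terms of laws, two mixtures are merged into one. -/
lemma add_mem_profileCone {c d : Profile 𝒳 𝒴} (hc : c ∈ profileCone 𝒳 𝒴)
    (hd : d ∈ profileCone 𝒳 𝒴) : c + d ∈ profileCone 𝒳 𝒴 := by
  obtain ⟨s, hs, k, hk, rfl⟩ := hc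
  obtain ⟨t, ht, l, hl, rfl⟩ := hd
  have h := (convex_convexHull ℝ (profile '' stdSimplex ℝ (𝒴 × 𝒳))).add_smul hs ht
  have hm : s • k + t • l ∈ s • profileSet 𝒳 𝒴 + t • profileSet 𝒳 𝒴 :=
    Set.add_mem_add (Set.smul_mem_smul_set hk) (Set.smul_mem_smul_set hl)
  rw [profileSet, ← h] at hm
  obtain ⟨m, hm, hm'⟩ := hm
  exact ⟨s + t, add_nonneg hs ht, m, hm, hm'.symm⟩

lemma sum_mem_profileCone [Nonempty 𝒳] [Nonempty 𝒴] {ι : Type*} (s : Finset ι)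
    {c : ι → Profile 𝒳 𝒴} (hc : ∀ i ∈ s, c i ∈ profileCone 𝒳 𝒴) :
    ∑ i ∈ s, c i ∈ profileCone 𝒳 𝒴 := by
  refine Finset.sum_induction c (· ∈ profileCone 𝒳 𝒴) (fun _ _ => add_mem_profileCone) ?_ hc
  obtain ⟨k, hk⟩ := profileSet_nonempty (𝒳 := 𝒳) (𝒴 := 𝒴)
  exact ⟨0, le_rfl, k, hk, (zero_smul ℝ k).symm⟩

/-- An induction principle for linear relations and inequalities on `profileSet`. -/
lemma profileSet_induction {C : Set (Profile 𝒳 𝒴)} (hC : Convex ℝ C)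
    (h : ∀ q ∈ stdSimplex ℝ (𝒴 × 𝒳), profile q ∈ C) {k : Profile 𝒳 𝒴}
    (hk : k ∈ profileSet 𝒳 𝒴) : k ∈ C := by
  refine convexHull_min ?_ hC hk
  rintro _ ⟨q, hq, rfl⟩
  exact h q hq

lemma fst_mem_stdSimplex {k : Profile 𝒳 𝒴} (hk : k ∈ profileSet 𝒳 𝒴) :
    k.1 ∈ stdSimplex ℝ (𝒴 × 𝒳) :=
  profileSet_induction (C := Prod.fst ⁻¹' stdSimplex ℝ (𝒴 × 𝒳))
    ((convex_stdSimplex ℝ (𝒴 × 𝒳)).linear_preimage (LinearMap.fst ℝ _ _)) (fun _ hq => hq) hk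

/-- Conditioning on more variables reduces the entropy. -/
lemma homEntropy_marginal_le {A B α : Type*} [Fintype A] [Fintype B] [Fintype α]
    {ρ : A → B → α → ℝ} (hρ : ∀ a b c, 0 ≤ ρ a b c) :
    homEntropy (fun a => ∑ b, ∑ c, ρ a b c) + ∑ a, ∑ b, homEntropy (ρ a b) ≤
      homEntropy (fun w : A × α => ∑ b, ρ w.1 b w.2) := by
  rw [homEntropy_prod (fun w : A × α => ∑ b, ρ w.1 b w.2)]
  dsimp only
  refine add_le_add (le_of_eq ?_) (Finset.sum_le_sum fun a _ => ?_)
  · congr 1; ext a; exact Finset.sum_comm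
  · refine (sum_homEntropy_le Finset.univ (hρ a)).trans (le_of_eq ?_)
    congr 1; ext c; simp

/-- Single-letterization of the entropies of a law of a pair of words. -/
lemma exists_profileCone_of_words [Nonempty 𝒳] [Nonempty 𝒴] (n : ℕ)
    (r : (Fin n → 𝒴) × (Fin n → 𝒳) → ℝ) (hr : ∀ w, 0 ≤ r w) :
    ∃ c ∈ profileCone 𝒳 𝒴,
      (∀ f : 𝒴 × 𝒳 → ℝ, ∑ z, c.1 z * f z = ∑ w, r w * ∑ i, f (w.1 i, w.2 i)) ∧
      c.2.2.2 = homEntropy r ∧ c.2.1 ≤ homEntropy (margSnd r) ∧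
      c.2.2.1 ≤ homEntropy (margFst r) := by
  induction n with
  | zero =>
    refine ⟨0, ?_, ?_, ?_, ?_, ?_⟩
    · simpa using sum_mem_profileCone (𝒳 := 𝒳) (𝒴 := 𝒴) (∅ : Finset ℕ) (c := 0) (by simp)
    · simp
    · have : Unique ((Fin 0 → 𝒴) × (Fin 0 → 𝒳)) := Unique.mk' _
      exact (homEntropy_eq_zero_of_unique r).symm
    all_goals simp [homEntropy_eq_zero_of_unique]
  | succ n ih =>
    -- A pair of words is split into its first letters and the pair of remaining words.
    let e : ((Fin n → 𝒴) × (Fin n → 𝒳)) × (𝒴 × 𝒳) ≃ (Fin (n + 1) → 𝒴) × (Fin (n + 1) → 𝒳) :=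
      ((Equiv.prodProdProdComm _ _ _ _).trans (Equiv.prodCongr
        ((Equiv.prodComm _ _).trans (Fin.consEquiv fun _ => 𝒴))
        ((Equiv.prodComm _ _).trans (Fin.consEquiv fun _ => 𝒳))))
    have he : ∀ y x a b, e ((y, x), (a, b)) = (Fin.cons a y, Fin.cons b x) := fun _ _ _ _ => rfl
    let r' : (Fin n → 𝒴) × (Fin n → 𝒳) → ℝ := fun w => ∑ z, r (e (w, z))
    obtain ⟨c, hc, hf, hXY, hX, hY⟩ := ih r' fun w => Finset.sum_nonneg fun z _ => hr _
    -- The first letters are taken conditionally on the remaining pair `w` of words. For the joint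
    -- entropy this is the exact chain rule. For one marginal it conditions on both words where the
    -- chain rule asks for one only, hence the inequalities.
    refine ⟨c + ∑ w, profile (fun z => r (e (w, z))), add_mem_profileCone hc
      (sum_mem_profileCone _ fun w _ => mem_profileCone fun z => hr _), ?_, ?_, ?_, ?_⟩
    · intro f
      have h0 : ∑ w, r w * ∑ i, f (w.1 i, w.2 i)
          = ∑ w, ∑ z, r (e (w, z)) * ∑ i, f ((e (w, z)).1 i, (e (w, z)).2 i) := by
        rw [← e.sum_comp]; exact Fintype.sum_prod_type _
      have h1 : ∑ z, (c + ∑ w, profile (fun z => r (e (w, z)))).1 z * f z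
          = ∑ z, c.1 z * f z + ∑ z, ∑ w, r (e (w, z)) * f z := by
        simp only [Prod.fst_add, Prod.fst_sum, Pi.add_apply, Finset.sum_apply, add_mul,
          Finset.sum_add_distrib, profile, Finset.sum_mul]
      rw [h0, h1, hf, Finset.sum_comm (s := (Finset.univ : Finset (𝒴 × 𝒳))), ← Finset.sum_add_distrib]
      refine Finset.sum_congr rfl fun w _ => ?_
      rw [Finset.sum_mul, ← Finset.sum_add_distrib]
      refine Finset.sum_congr rfl fun z _ => ?_
      obtain ⟨y, x⟩ := w
      obtain ⟨a, b⟩ := z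
      rw [he, Fin.sum_univ_succ]
      simp only [Fin.cons_zero, Fin.cons_succ]
      ring
    · rw [← homEntropy_comp_equiv e r, homEntropy_prod]
      simp [profile, hXY, r', Prod.snd_sum]
    · have := homEntropy_marginal_le (A := Fin n → 𝒳) (B := Fin n → 𝒴) (α := 𝒳)
        (ρ := fun x y b => margSnd (fun z => r (e ((y, x), z))) b)
        fun _ _ _ => Finset.sum_nonneg fun _ _ => hr _
      rw [← homEntropy_comp_equiv ((Equiv.prodComm _ _).trans (Fin.consEquiv fun _ => 𝒳))]
      simp only [Prod.snd_add, Prod.fst_add, Prod.snd_sum, Prod.fst_sum, profile]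
      have h1 : margSnd r' = fun x => ∑ y, ∑ b, margSnd (fun z => r (e ((y, x), z))) b := by
        ext x
        simp only [margSnd, r', Fintype.sum_prod_type_right]
      rw [h1] at hX
      refine le_trans (add_le_add hX (le_of_eq ?_)) (le_trans this (le_of_eq ?_))
      · rw [Fintype.sum_prod_type_right]
      · congr 1
        ext ⟨x, b⟩
        simp only [margSnd, he]
        rw [← (((Equiv.prodComm _ _).trans (Fin.consEquiv fun _ => 𝒴)) :
          (Fin n → 𝒴) × 𝒴 ≃ (Fin (n + 1) → 𝒴)).sum_comp, Fintype.sum_prod_type]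
        rfl
    · have := homEntropy_marginal_le (A := Fin n → 𝒴) (B := Fin n → 𝒳) (α := 𝒴)
        (ρ := fun y x a => margFst (fun z => r (e ((y, x), z))) a)
        fun _ _ _ => Finset.sum_nonneg fun _ _ => hr _
      rw [← homEntropy_comp_equiv ((Equiv.prodComm _ _).trans (Fin.consEquiv fun _ => 𝒴))]
      simp only [Prod.snd_add, Prod.fst_add, Prod.snd_sum, Prod.fst_sum, profile]
      have h1 : margFst r' = fun y => ∑ x, ∑ a, margFst (fun z => r (e ((y, x), z))) a := by
        ext x
        simp only [margFst, r', Fintype.sum_prod_type]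
      rw [h1] at hY
      refine le_trans (add_le_add hY (le_of_eq ?_)) (le_trans this (le_of_eq ?_))
      · rw [Fintype.sum_prod_type]
      · congr 1
        ext ⟨x, b⟩
        simp only [margFst, he]
        rw [← (((Equiv.prodComm _ _).trans (Fin.consEquiv fun _ => 𝒳)) :
          (Fin n → 𝒳) × 𝒳 ≃ (Fin (n + 1) → 𝒳)).sum_comp, Fintype.sum_prod_type]
        rfl

end Profile

/-! ### Conditioning a memoryless law on a product set -/

section SingleShot

/-- Conditioning on `S` divides the weights by a constant, so on `S` the logarithm of the new weight
is that of the old one minus the logarithm of the mass. -/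
lemma homEntropy_eq_of_restrict {A : Type*} [Fintype A] [DecidableEq A] {ω : A → ℝ} (S : Finset A)
    (hG : 0 < ∑ a ∈ S, ω a) {r : A → ℝ} (hr : ∀ a, r a = if a ∈ S then ω a / ∑ a ∈ S, ω a else 0) :
    homEntropy r = -∑ a, r a * Real.log (ω a) + Real.log (∑ a ∈ S, ω a) := by
  have h1 : ∑ a, r a = 1 := by
    simp only [hr, Finset.sum_ite_mem, Finset.univ_inter]
    rw [← Finset.sum_div, div_self hG.ne']
  have h2 : ∀ a, Real.negMulLog (r a)
      = -(r a * Real.log (ω a)) + r a * Real.log (∑ a ∈ S, ω a) := fun a => by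
    by_cases h : r a = 0
    · simp [h]
    · have ha : a ∈ S := by by_contra h'; exact h (by rw [hr, if_neg h'])
      have hra := hr a
      rw [if_pos ha] at hra
      have hω : ω a ≠ 0 := fun h' => h (by rw [hra, h', zero_div])
      rw [Real.negMulLog]
      nth_rw 2 [hra]
      rw [Real.log_div hω hG.ne']; ring
  rw [homEntropy, h1, Real.negMulLog_one, Finset.sum_congr rfl fun a _ => h2 a,
    Finset.sum_add_distrib, ← Finset.sum_mul, h1, Finset.sum_neg_distrib]
  ring

/-- The Gibbs inequality against `ω` conditioned on `S`. It serves for the marginals of a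
conditioned joint law, which live on `S` but need not be conditioned marginals. -/
lemma homEntropy_le_of_support {A : Type*} [Fintype A] {ω r : A → ℝ} (hω : ∀ a, 0 ≤ ω a)
    (hr : ∀ a, 0 ≤ r a) (hr1 : ∑ a, r a = 1) (S : Finset A) (hS : ∀ a, r a ≠ 0 → a ∈ S ∧ ω a ≠ 0) :
    0 < ∑ a ∈ S, ω a ∧
      homEntropy r ≤ -∑ a, r a * Real.log (ω a) + Real.log (∑ a ∈ S, ω a) := by
  classical
  have hG : 0 < ∑ a ∈ S, ω a := by
    obtain ⟨a, -, ha⟩ : ∃ a ∈ Finset.univ, r a ≠ 0 :=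
      Finset.exists_ne_zero_of_sum_ne_zero (by rw [hr1]; exact one_ne_zero)
    exact Finset.sum_pos' (fun a _ => hω a) ⟨a, (hS a ha).1, (hω a).lt_of_ne' (hS a ha).2⟩
  refine ⟨hG, ?_⟩
  have h := homEntropy_le (V := fun a => if a ∈ S then ω a / ∑ a ∈ S, ω a else 0) hr
    (fun a => by split_ifs; exacts [div_nonneg (hω a) hG.le, le_rfl])
    (by simp only [Finset.sum_ite_mem, Finset.univ_inter]
        rw [← Finset.sum_div, div_self hG.ne'])
    (fun a ha => by
      by_contra h
      rw [if_pos (hS a h).1] at ha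
      exact (div_ne_zero (hS a h).2 hG.ne') ha)
  refine h.trans (le_of_eq ?_)
  have : ∀ a, r a * Real.log (if a ∈ S then ω a / ∑ a ∈ S, ω a else 0)
      = r a * Real.log (ω a) - r a * Real.log (∑ a ∈ S, ω a) := fun a => by
    by_cases h : r a = 0
    · simp [h]
    · rw [if_pos (hS a h).1, Real.log_div (hS a h).2 hG.ne']; ring
  rw [Finset.sum_congr rfl fun a _ => this a, Finset.sum_sub_distrib, ← Finset.sum_mul, hr1]
  ring

variable {𝒳 𝒴 : Type*} [Fintype 𝒳] [Fintype 𝒴]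

lemma sum_margSnd_mul {α β : Type*} [Fintype α] [Fintype β] (r : α × β → ℝ) (f : β → ℝ) :
    ∑ b, margSnd r b * f b = ∑ z, r z * f z.2 := by
  simp only [margSnd, Finset.sum_mul, Fintype.sum_prod_type_right]

lemma sum_margFst_mul {α β : Type*} [Fintype α] [Fintype β] (r : α × β → ℝ) (f : α → ℝ) :
    ∑ a, margFst r a * f a = ∑ z, r z * f z.1 := by
  simp only [margFst, Finset.sum_mul, Fintype.sum_prod_type]

lemma margSnd_ne_zero {α β : Type*} [Fintype α] {r : α × β → ℝ} (hr : ∀ z, 0 ≤ r z) {a : α} {b : β}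
    (h : r (a, b) ≠ 0) : margSnd r b ≠ 0 := fun h0 =>
  h ((Finset.sum_eq_zero_iff_of_nonneg fun a _ => hr (a, b)).1 h0 a (Finset.mem_univ a))

lemma margFst_ne_zero {α β : Type*} [Fintype β] {r : α × β → ℝ} (hr : ∀ z, 0 ≤ r z) {a : α} {b : β}
    (h : r (a, b) ≠ 0) : margFst r a ≠ 0 := fun h0 =>
  h ((Finset.sum_eq_zero_iff_of_nonneg fun b _ => hr (a, b)).1 h0 b (Finset.mem_univ b))

/-- The profile of a memoryless law conditioned on a product set of words. -/
lemma exists_profile_of_product_set [Nonempty 𝒳] [Nonempty 𝒴] [DecidableEq 𝒳]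
    {p : 𝒴 × 𝒳 → ℝ} (hp : ∀ z, 0 ≤ p z)
    {n : ℕ} (hn : 0 < n) (B : Finset (Fin n → 𝒴)) (S : Finset (Fin n → 𝒳))
    (hG : 0 < ∑ w ∈ B ×ˢ S, ∏ i, p (w.1 i, w.2 i)) :
    ∃ k ∈ profileSet 𝒳 𝒴, (∀ z, p z = 0 → k.1 z = 0) ∧
      0 < ∑ x ∈ S, ∏ i, margSnd p (x i) ∧ 0 < ∑ y ∈ B, ∏ i, margFst p (y i) ∧
      n * k.2.2.2 = -(n * ∑ z, k.1 z * Real.log (p z))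
        + Real.log (∑ w ∈ B ×ˢ S, ∏ i, p (w.1 i, w.2 i)) ∧
      n * k.2.1 ≤ -(n * ∑ z, k.1 z * Real.log (margSnd p z.2))
        + Real.log (∑ x ∈ S, ∏ i, margSnd p (x i)) ∧
      n * k.2.2.1 ≤ -(n * ∑ z, k.1 z * Real.log (margFst p z.1))
        + Real.log (∑ y ∈ B, ∏ i, margFst p (y i)) ∧
      ∀ (a : 𝒳) (δ : ℝ),
        (∀ x ∈ S, |∑ i, (if x i = a then (1 : ℝ) else 0) - n * margSnd p a| ≤ n * δ) →
          |margSnd k.1 a - margSnd p a| ≤ δ := by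
  classical
  set G := ∑ w ∈ B ×ˢ S, ∏ i, p (w.1 i, w.2 i) with hGdef
  let q : (Fin n → 𝒴) × (Fin n → 𝒳) → ℝ :=
    fun w => if w ∈ B ×ˢ S then (∏ i, p (w.1 i, w.2 i)) / G else 0
  have hq : ∀ w, 0 ≤ q w := fun w => by
    dsimp only [q]; split_ifs
    exacts [div_nonneg (Finset.prod_nonneg fun i _ => hp _) hG.le, le_rfl]
  have hq1 : ∑ w, q w = 1 := by
    simp only [q, Finset.sum_ite_mem, Finset.univ_inter]
    rw [← Finset.sum_div, div_self hG.ne']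
  have hqne : ∀ w, q w ≠ 0 → w ∈ B ×ˢ S ∧ ∀ i, p (w.1 i, w.2 i) ≠ 0 := fun w hw => by
    have hm : w ∈ B ×ˢ S := by by_contra h; exact hw (if_neg h)
    refine ⟨hm, fun i hi => hw ?_⟩
    simp only [q, if_pos hm]
    rw [Finset.prod_eq_zero (Finset.mem_univ i) hi, zero_div]
  obtain ⟨c, ⟨t, ht, k, hk, rfl⟩, hf, hXY, hX, hY⟩ := exists_profileCone_of_words n q hq
  have hk1 := fst_mem_stdSimplex hk
  -- Tested on the constant function 1, the linear relation says that the scale of the cone element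
  -- is the word length.
  have ht' : t = n := by
    have := hf fun _ => 1
    simp only [Prod.smul_fst, Pi.smul_apply, smul_eq_mul, mul_one, ← Finset.mul_sum, hk1.2,
      Finset.sum_const, Finset.card_univ, Fintype.card_fin, nsmul_eq_mul] at this
    rw [this, ← Finset.sum_mul, hq1, one_mul]
  subst ht'
  have hn' : (0 : ℝ) < n := by exact_mod_cast hn
  simp only [Prod.smul_fst, Prod.smul_snd, Pi.smul_apply, smul_eq_mul, mul_assoc,
    ← Finset.mul_sum] at hf hXY hX hY
  -- Cross-entropies against product weights are linear in the law and so pass to single letters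
  -- exactly; on the support of `q` no factor vanishes, as the splitting of the logarithm requires.
  have hlog : ∀ (g : 𝒴 × 𝒳 → ℝ), (∀ z, p z ≠ 0 → g z ≠ 0) →
      (n : ℝ) * ∑ z, k.1 z * Real.log (g z) = ∑ w, q w * Real.log (∏ i, g (w.1 i, w.2 i)) := by
    intro g hg
    rw [hf]
    refine Finset.sum_congr rfl fun w _ => ?_
    by_cases h : q w = 0
    · simp [h]
    · rw [Real.log_prod fun i _ => hg _ ((hqne w h).2 i)]
  have hSne : ∀ x, margSnd q x ≠ 0 → x ∈ S ∧ ∏ i, margSnd p (x i) ≠ 0 := fun x hx => by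
    obtain ⟨y, -, hy⟩ := Finset.exists_ne_zero_of_sum_ne_zero hx
    exact ⟨(Finset.mem_product.1 (hqne _ hy).1).2,
      Finset.prod_ne_zero_iff.2 fun i _ => margSnd_ne_zero hp ((hqne _ hy).2 i)⟩
  have hBne : ∀ y, margFst q y ≠ 0 → y ∈ B ∧ ∏ i, margFst p (y i) ≠ 0 := fun y hy => by
    obtain ⟨x, -, hx⟩ := Finset.exists_ne_zero_of_sum_ne_zero hy
    exact ⟨(Finset.mem_product.1 (hqne _ hx).1).1,
      Finset.prod_ne_zero_iff.2 fun i _ => margFst_ne_zero hp ((hqne _ hx).2 i)⟩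
  obtain ⟨hS, hS'⟩ := homEntropy_le_of_support (ω := fun x => ∏ i, margSnd p (x i))
    (fun x => Finset.prod_nonneg fun i _ => Finset.sum_nonneg fun _ _ => hp _)
    (r := margSnd q) (fun x => Finset.sum_nonneg fun _ _ => hq _)
    (by rw [← hq1, Fintype.sum_prod_type_right]; rfl) S hSne
  obtain ⟨hB, hB'⟩ := homEntropy_le_of_support (ω := fun x => ∏ i, margFst p (x i))
    (fun x => Finset.prod_nonneg fun i _ => Finset.sum_nonneg fun _ _ => hp _)
    (r := margFst q) (fun x => Finset.sum_nonneg fun _ _ => hq _)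
    (by rw [← hq1, Fintype.sum_prod_type]; rfl) B hBne
  refine ⟨k, hk, ?_, hS, hB, ?_, ?_, ?_, ?_⟩
  · intro z hz
    have := hf fun z' => if z' = z then 1 else 0
    simp only [mul_ite, mul_one, mul_zero, Finset.sum_ite_eq', Finset.mem_univ, if_true] at this
    have h0 : ∑ w, q w * ∑ i, (if (w.1 i, w.2 i) = z then (1 : ℝ) else 0) = 0 := by
      refine Finset.sum_eq_zero fun w _ => ?_
      by_cases h : q w = 0
      · simp [h]
      · rw [Finset.sum_eq_zero, mul_zero]
        intro i _
        rw [if_neg]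
        intro hi
        exact (hqne w h).2 i (hi ▸ hz)
    rw [h0] at this
    exact (mul_eq_zero.1 this).resolve_left hn'.ne'
  · rw [hXY, homEntropy_eq_of_restrict (B ×ˢ S) hG (r := q) (fun _ => rfl), hlog p fun _ h => h]
  · refine hX.trans (hS'.trans (le_of_eq ?_))
    rw [sum_margSnd_mul, hlog (fun z => margSnd p z.2) fun z h => margSnd_ne_zero hp h]
  · refine hY.trans (hB'.trans (le_of_eq ?_))
    rw [sum_margFst_mul, hlog (fun z => margFst p z.1) fun z h => margFst_ne_zero hp h]
  · intro a δ h
    -- The X-marginal of `k` is the `q`-average of the empirical frequencies, so a bound valid for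
    -- every word of `S` is inherited.
    have h1 : (n : ℝ) * margSnd k.1 a = ∑ w, q w * ∑ i, (if w.2 i = a then (1 : ℝ) else 0) := by
      rw [← hf fun z => if z.2 = a then 1 else 0, ← sum_margSnd_mul k.1 fun b => if b = a then 1 else 0]
      simp
    have h2 : (n : ℝ) * margSnd k.1 a - n * margSnd p a
        = ∑ w, q w * (∑ i, (if w.2 i = a then (1 : ℝ) else 0) - n * margSnd p a) := by
      simp only [mul_sub, Finset.sum_sub_distrib, ← Finset.sum_mul, hq1, h1]; ring
    have h3 : |(n : ℝ) * margSnd k.1 a - n * margSnd p a| ≤ n * δ := by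
      rw [h2]
      refine (Finset.abs_sum_le_sum_abs _ _).trans ?_
      calc _ ≤ ∑ w, q w * (n * δ) := Finset.sum_le_sum fun w _ => by
            rw [abs_mul, abs_of_nonneg (hq w)]
            by_cases hw : q w = 0
            · simp [hw]
            · exact mul_le_mul_of_nonneg_left (h _ (Finset.mem_product.1 (hqne w hw).1).2) (hq w)
        _ = n * δ := by rw [← Finset.sum_mul, hq1, one_mul]
    rw [← mul_sub, abs_mul, abs_of_pos hn'] at h3
    exact le_of_mul_le_mul_left h3 hn'

end SingleShot

/-! ### Feasible profiles and channels -/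

section Feasible

variable {𝒳 𝒴 : Type*} [Fintype 𝒳] [Fintype 𝒴]

lemma homEntropy_prod_right (r : 𝒴 × 𝒳 → ℝ) :
    homEntropy r = homEntropy (margSnd r) + ∑ x, homEntropy (fun y => r (y, x)) := by
  rw [← homEntropy_comp_equiv (Equiv.prodComm 𝒳 𝒴) r]
  exact homEntropy_prod _

lemma homEntropy_of_sum_eq_one {α : Type*} [Fintype α] {r : α → ℝ} (h : ∑ a, r a = 1) :
    homEntropy r = -∑ a, r a * Real.log (r a) := by
  simp [homEntropy, h, Real.negMulLog]

lemma sum_margSnd (r : 𝒴 × 𝒳 → ℝ) : ∑ x, margSnd r x = ∑ z, r z := by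
  rw [Fintype.sum_prod_type_right]; rfl

lemma sum_margFst (r : 𝒴 × 𝒳 → ℝ) : ∑ y, margFst r y = ∑ z, r z := by
  rw [Fintype.sum_prod_type]; rfl

/-- The profiles of the laws `P_{YX} P_{U|X}` with `I(U;X) ≤ R`, cut out by closed conditions. -/
def feasibleSet (p : 𝒴 × 𝒳 → ℝ) (R : ℝ) : Set (Profile 𝒳 𝒴) :=
  {k | k ∈ profileSet 𝒳 𝒴 ∧ (∀ z, p z = 0 → k.1 z = 0) ∧ (∀ x, margSnd k.1 x = margSnd p x) ∧
    -- This inequality is the reverse of the Gibbs bound on H(Y|X,U) and so encodes the Markov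
    -- chain. The next one says I(U;YX) ≤ R once the law is `p`; only the X-marginal is prescribed,
    -- the rest of the law follows.
    -∑ z, k.1 z * (Real.log (p z) - Real.log (margSnd p z.2)) ≤ k.2.2.2 - k.2.1 ∧
    -∑ z, k.1 z * Real.log (p z) - R ≤ k.2.2.2}

lemma isCompact_feasibleSet (p : 𝒴 × 𝒳 → ℝ) (R : ℝ) : IsCompact (feasibleSet p R) := by
  have h1 : IsClosed {k : Profile 𝒳 𝒴 | ∀ z, p z = 0 → k.1 z = 0} := by
    simp only [Set.ofPred_forall]
    refine isClosed_iInter fun z => isClosed_iInter fun _ => isClosed_eq ?_ continuous_const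
    fun_prop
  have h2 : IsClosed {k : Profile 𝒳 𝒴 | ∀ x, margSnd k.1 x = margSnd p x} := by
    simp only [Set.ofPred_forall]
    refine isClosed_iInter fun x => isClosed_eq ?_ continuous_const
    unfold margSnd
    fun_prop
  have h3 : IsClosed {k : Profile 𝒳 𝒴 |
      -∑ z, k.1 z * (Real.log (p z) - Real.log (margSnd p z.2)) ≤ k.2.2.2 - k.2.1} := by
    refine isClosed_le ?_ ?_ <;> fun_prop
  have h4 : IsClosed {k : Profile 𝒳 𝒴 | -∑ z, k.1 z * Real.log (p z) - R ≤ k.2.2.2} := by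
    refine isClosed_le ?_ ?_ <;> fun_prop
  convert isCompact_profileSet.inter_right (h1.inter (h2.inter (h3.inter h4))) using 1
  ext k
  simp only [feasibleSet, Set.mem_inter_iff, Set.mem_ofPred_eq]

/-- The joint weights of `(Y, X)` and `U = u`, for `U` drawn from `X` through the channel `w`. -/
def channelWeight {κ : Type*} (p : 𝒴 × 𝒳 → ℝ) (w : 𝒳 → κ → ℝ) (u : κ) (z : 𝒴 × 𝒳) : ℝ :=
  p z * w z.2 u

/-- The profile of the law `P_{YX} P_{U|X}`. -/
noncomputable def channelProfile {κ : Type*} [Fintype κ] (p : 𝒴 × 𝒳 → ℝ) (w : 𝒳 → κ → ℝ) :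
    Profile 𝒳 𝒴 :=
  ∑ u, profile (channelWeight p w u)

variable {κ : Type*} [Fintype κ]

lemma channelProfile_fst {p : 𝒴 × 𝒳 → ℝ} {w : 𝒳 → κ → ℝ} (hw : ∀ x, w x ∈ stdSimplex ℝ κ) :
    (channelProfile p w).1 = p := by
  ext z
  simp only [channelProfile, profile, Prod.fst_sum, Finset.sum_apply, channelWeight,
    ← Finset.mul_sum, (hw z.2).2, mul_one]

lemma channelProfile_mem [Nonempty 𝒳] [Nonempty 𝒴] {p : 𝒴 × 𝒳 → ℝ}
    (hp : p ∈ stdSimplex ℝ (𝒴 × 𝒳)) {w : 𝒳 → κ → ℝ} (hw : ∀ x, w x ∈ stdSimplex ℝ κ) :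
    channelProfile p w ∈ profileSet 𝒳 𝒴 := by
  obtain ⟨t, ht, k, hk, h⟩ : channelProfile p w ∈ profileCone 𝒳 𝒴 :=
    sum_mem_profileCone _ fun u _ => mem_profileCone fun z => mul_nonneg (hp.1 z) ((hw z.2).1 u)
  have h1 : (channelProfile p w).1 = t • k.1 := by rw [h]; rfl
  rw [channelProfile_fst hw] at h1
  have h2 : t = 1 := by
    have := congrArg (fun f => ∑ z, f z) h1
    simp only [Pi.smul_apply, smul_eq_mul, ← Finset.mul_sum, (fst_mem_stdSimplex hk).2, mul_one,
      hp.2] at this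
    exact this.symm
  rw [h, h2, one_smul]
  exact hk

/-- U - X - Y gives H(Y|X,U) = H(Y|X): given x, the weights for u are a multiple of those of `p`,
and homogeneity lets the factors `w x u` sum to 1. -/
lemma channelProfile_joint_sub {p : 𝒴 × 𝒳 → ℝ} {w : 𝒳 → κ → ℝ}
    (hw : ∀ x, w x ∈ stdSimplex ℝ κ) :
    (channelProfile p w).2.2.2 - (channelProfile p w).2.1
      = homEntropy p - homEntropy (margSnd p) := by
  simp only [channelProfile, profile, Prod.snd_sum, Prod.fst_sum, ← Finset.sum_sub_distrib]
  have : ∀ u, homEntropy (channelWeight p w u) - homEntropy (margSnd (channelWeight p w u))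
      = ∑ x, w x u * homEntropy (fun y => p (y, x)) := fun u => by
    rw [homEntropy_prod_right (channelWeight p w u), add_sub_cancel_left]
    refine Finset.sum_congr rfl fun x _ => ?_
    rw [← homEntropy_smul]
    congr 1; ext y; exact mul_comm _ _
  simp only [this]
  rw [Finset.sum_comm, homEntropy_prod_right p]
  simp only [← Finset.sum_mul, (hw _).2, one_mul]
  ring

lemma neg_sum_mul_log_sub {p : 𝒴 × 𝒳 → ℝ} (hp : p ∈ stdSimplex ℝ (𝒴 × 𝒳)) :
    -∑ z, p z * (Real.log (p z) - Real.log (margSnd p z.2))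
      = homEntropy p - homEntropy (margSnd p) := by
  rw [homEntropy_of_sum_eq_one hp.2, homEntropy_of_sum_eq_one ((sum_margSnd p).trans hp.2),
    sum_margSnd_mul p fun x => Real.log (margSnd p x)]
  simp only [mul_sub, Finset.sum_sub_distrib]
  ring

/-- For a channel the Markov inequality is an equality, so I(U;YX) = I(U;X) and only the rate
constraint is left. -/
lemma channelProfile_mem_feasibleSet [Nonempty 𝒳] [Nonempty 𝒴] {p : 𝒴 × 𝒳 → ℝ}
    (hp : p ∈ stdSimplex ℝ (𝒴 × 𝒳)) {w : 𝒳 → κ → ℝ} (hw : ∀ x, w x ∈ stdSimplex ℝ κ) {R : ℝ} :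
    channelProfile p w ∈ feasibleSet p R ↔
      homEntropy (margSnd p) - (channelProfile p w).2.1 ≤ R := by
  have h1 := channelProfile_joint_sub (p := p) hw
  simp only [feasibleSet, Set.mem_ofPred_eq, channelProfile_mem hp hw, channelProfile_fst hw,
    imp_self, implies_true, true_and, neg_sum_mul_log_sub hp, h1, le_refl,
    ← homEntropy_of_sum_eq_one hp.2]
  constructor <;> intro h <;> linarith

/-- Homogeneity absorbs the convex weights into the measures. The weights `α` are returned only as a
probability vector available for letters of probability zero. -/
lemma exists_sum_profile {k : Profile 𝒳 𝒴} (hk : k ∈ profileSet 𝒳 𝒴) :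
    ∃ (m : ℕ) (α : Fin m → ℝ) (r : Fin m → 𝒴 × 𝒳 → ℝ), α ∈ stdSimplex ℝ (Fin m) ∧
      (∀ i z, 0 ≤ r i z) ∧ k = ∑ i, profile (r i) := by
  obtain ⟨ι, _, α, K, hα, hα1, hK, rfl⟩ := mem_convexHull_iff_exists_fintype.1 hk
  choose q hq hqK using hK
  let e := (Fintype.equivFin ι).symm
  refine ⟨Fintype.card ι, fun i => α (e i), fun i => α (e i) • q (e i),
    ⟨fun i => hα _, (e.sum_comp α).trans hα1⟩, fun i z => mul_nonneg (hα _) ((hq _).1 z), ?_⟩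
  rw [← e.sum_comp]
  simp only [profile_smul, hqK]

/-- Every feasible profile comes from a channel. -/
lemma exists_channel_of_mem_feasibleSet {p : 𝒴 × 𝒳 → ℝ} (hp : ∀ z, 0 ≤ p z) {R : ℝ}
    {k : Profile 𝒳 𝒴} (hk : k ∈ feasibleSet p R) :
    ∃ (m : ℕ) (w : 𝒳 → Fin m → ℝ), (∀ x, w x ∈ stdSimplex ℝ (Fin m)) ∧ k = channelProfile p w := by
  obtain ⟨hk, hsupp, hmarg, hmarkov, -⟩ := hk
  obtain ⟨m, α, r, hα, hr, rfl⟩ := exists_sum_profile hk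
  have hk1 : ∀ z, (∑ i, profile (r i)).1 z = ∑ i, r i z := fun z => by
    simp [profile, Prod.fst_sum]
  simp only [hk1, margSnd] at hsupp hmarg hmarkov
  have hr0 : ∀ i z, p z = 0 → r i z = 0 := fun i z hz =>
    (Finset.sum_eq_zero_iff_of_nonneg fun i _ => hr i z).1 (hsupp z hz) i (Finset.mem_univ i)
  have hpX : ∀ x, 0 ≤ margSnd p x := fun x => Finset.sum_nonneg fun _ _ => hp _
  let V : 𝒳 → 𝒴 → ℝ := fun x y => p (y, x) / margSnd p x
  have hV1 : ∀ x, margSnd p x ≠ 0 → ∑ y, V x y = 1 := fun x hx => by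
    simp only [V, ← Finset.sum_div]
    exact div_self hx
  have hpz : ∀ x, margSnd p x = 0 → ∀ y, p (y, x) = 0 := fun x hx y => by
    by_contra h
    exact margSnd_ne_zero hp h hx
  have hlog : ∀ i x y, r i (y, x) * (Real.log (p (y, x)) - Real.log (margSnd p x))
      = r i (y, x) * Real.log (V x y) := fun i x y => by
    by_cases h : p (y, x) = 0
    · simp [hr0 i _ h]
    · simp only [V]
      rw [Real.log_div h (margSnd_ne_zero hp h)]
  have hgibbs : ∀ i x, homEntropy (fun y => r i (y, x)) ≤ -∑ y, r i (y, x) * Real.log (V x y) := by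
    intro i x
    by_cases hx : margSnd p x = 0
    · have : ∀ y, r i (y, x) = 0 := fun y => hr0 i _ (hpz x hx y)
      simp [this, homEntropy]
    · refine homEntropy_le (fun y => hr i _) (fun y => div_nonneg (hp _) (hpX x)) (hV1 x hx)
        fun y hy => hr0 i _ ?_
      exact (div_eq_zero_iff.1 hy).resolve_right hx
  -- The Markov condition bounds the sum of all Gibbs defects by 0; each defect is nonnegative, so
  -- each one vanishes.
  have heq : ∀ i x, -∑ y, r i (y, x) * Real.log (V x y) ≤ homEntropy (fun y => r i (y, x)) := by
    have hsum : ∑ i, ∑ x, (-∑ y, r i (y, x) * Real.log (V x y) - homEntropy (fun y => r i (y, x)))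
        ≤ 0 := by
      have h1 : (∑ i, profile (r i)).2.2.2 - (∑ i, profile (r i)).2.1
          = ∑ i, ∑ x, homEntropy (fun y => r i (y, x)) := by
        simp only [profile, Prod.snd_sum, Prod.fst_sum, ← Finset.sum_sub_distrib]
        refine Finset.sum_congr rfl fun i _ => ?_
        rw [homEntropy_prod_right (r i), add_sub_cancel_left]
      have h2 : ∑ z, (∑ i, r i z) * (Real.log (p z) - Real.log (∑ y, p (y, z.2)))
          = ∑ i, ∑ x, ∑ y, r i (y, x) * Real.log (V x y) := by
        simp only [Finset.sum_mul]
        rw [Finset.sum_comm]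
        refine Finset.sum_congr rfl fun i _ => ?_
        rw [Fintype.sum_prod_type_right]
        refine Finset.sum_congr rfl fun x _ => Finset.sum_congr rfl fun y _ => hlog i x y
      rw [h1, h2] at hmarkov
      simp only [Finset.sum_sub_distrib, Finset.sum_neg_distrib]
      linarith
    have hnn : ∀ i x, 0 ≤ -∑ y, r i (y, x) * Real.log (V x y) - homEntropy (fun y => r i (y, x)) :=
      fun i x => sub_nonneg.2 (hgibbs i x)
    intro i x
    have h3 : ∑ x, (-∑ y, r i (y, x) * Real.log (V x y) - homEntropy (fun y => r i (y, x))) ≤ 0 :=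
      (Finset.single_le_sum (f := fun i => ∑ x, (-∑ y, r i (y, x) * Real.log (V x y)
        - homEntropy (fun y => r i (y, x)))) (fun i _ => Finset.sum_nonneg fun x _ => hnn i x)
        (Finset.mem_univ i)).trans hsum
    have h4 := (Finset.single_le_sum (f := fun x => (-∑ y, r i (y, x) * Real.log (V x y)
        - homEntropy (fun y => r i (y, x)))) (fun x _ => hnn i x) (Finset.mem_univ x)).trans h3
    linarith
  have hfac : ∀ i x y, margSnd p x ≠ 0 → r i (y, x) = margSnd (r i) x * V x y := fun i x y hx =>
    eq_of_le_homEntropy (r := fun y => r i (y, x)) (fun y => hr i _)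
      (fun y => div_nonneg (hp _) (hpX x)) (hV1 x hx)
      (fun y hy => hr0 i _ ((div_eq_zero_iff.1 hy).resolve_right hx)) (heq i x) y
  -- The channel comes from Bayes' rule applied to the X-marginals. At letters of probability zero
  -- its value is irrelevant, but it must be a probability vector.
  refine ⟨m, fun x i => if margSnd p x = 0 then α i else margSnd (r i) x / margSnd p x,
    fun x => ?_, ?_⟩
  · by_cases hx : margSnd p x = 0
    · simpa only [hx, if_true] using hα
    · simp only [hx, if_false]
      refine ⟨fun i => div_nonneg (Finset.sum_nonneg fun _ _ => hr _ _) (hpX x), ?_⟩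
      rw [← Finset.sum_div, div_eq_one_iff_eq hx]
      simp only [margSnd]
      rw [Finset.sum_comm, hmarg]
  · refine Finset.sum_congr rfl fun i _ => congrArg profile ?_
    ext ⟨y, x⟩
    simp only [channelWeight]
    by_cases hx : margSnd p x = 0
    · rw [hr0 i _ (hpz x hx y), hpz x hx y, zero_mul]
    · rw [if_neg hx, hfac i x y hx]
      simp only [V]
      ring

end Feasible

/-! ### Divergence and mutual information on finite spaces -/

section FiniteMeasures

variable {α β : Type*} [Fintype α] [MeasurableSpace α] [MeasurableSingletonClass α]
  [Fintype β] [MeasurableSpace β] [MeasurableSingletonClass β]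

lemma absolutelyContinuous_iff_singleton {α : Type*} [Finite α] [MeasurableSpace α] {μ ν : Measure α} :
    μ ≪ ν ↔ ∀ a, ν {a} = 0 → μ {a} = 0 := by
  refine ⟨fun h a ha => h ha, fun h s hs => ?_⟩
  rw [← Set.biUnion_of_singleton s]
  refine (measure_biUnion_null_iff s.to_countable).2 fun a ha => h a ?_
  exact measure_mono_null (Set.singleton_subset_iff.2 ha) hs

lemma ae_real_singleton_ne_zero {α : Type*} [Finite α] [MeasurableSpace α] (μ : Measure α)
    [IsFiniteMeasure μ] : ∀ᵐ a ∂μ, μ.real {a} ≠ 0 := by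
  rw [ae_iff, ← Set.biUnion_of_singleton {a | ¬μ.real {a} ≠ 0}]
  refine (measure_biUnion_null_iff (Set.to_countable _)).2 fun a ha => ?_
  simpa [measureReal_eq_zero_iff] using ha

lemma toReal_klDiv_eq_sum {μ ν : Measure α} [IsProbabilityMeasure μ] [IsProbabilityMeasure ν]
    (h : μ ≪ ν) : (klDiv μ ν).toReal
      = ∑ a, μ.real {a} * (Real.log (μ.real {a}) - Real.log (ν.real {a})) := by
  rw [toReal_klDiv_of_measure_eq h (by simp), integral_fintype .of_finite]
  refine Finset.sum_congr rfl fun a _ => ?_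
  by_cases ha : μ.real {a} = 0
  · simp [ha]
  have hν : ν.real {a} ≠ 0 := fun h0 => ha (by
    rw [measureReal_eq_zero_iff] at h0 ⊢; exact h h0)
  rw [smul_eq_mul, llr_def]
  congr 1
  have h1 : μ {a} = μ.rnDeriv ν a * ν {a} := by
    rw [← Measure.setLIntegral_rnDeriv h, lintegral_singleton]
  have h2 : μ.real {a} = (μ.rnDeriv ν a).toReal * ν.real {a} := by
    simp only [Measure.real, h1, ENNReal.toReal_mul]
  have h3 : (μ.rnDeriv ν a).toReal ≠ 0 := fun h0 => ha (by rw [h2, h0, zero_mul])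
  rw [h2, Real.log_mul h3 hν]
  ring

lemma klDiv_eq_ofReal_sum {μ ν : Measure α} [IsProbabilityMeasure μ] [IsProbabilityMeasure ν]
    (h : μ ≪ ν) :
    klDiv μ ν = ENNReal.ofReal
      (∑ a, μ.real {a} * (Real.log (μ.real {a}) - Real.log (ν.real {a}))) := by
  rw [← toReal_klDiv_eq_sum h, ENNReal.ofReal_toReal (klDiv_ne_top h .of_finite)]

lemma coe_klDiv_eq_sum {μ ν : Measure α} [IsProbabilityMeasure μ] [IsProbabilityMeasure ν]
    (h : μ ≪ ν) : (klDiv μ ν : EReal) =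
      ((∑ a, μ.real {a} * (Real.log (μ.real {a}) - Real.log (ν.real {a})) : ℝ) : EReal) := by
  rw [← toReal_klDiv_eq_sum h, EReal.coe_ennreal_toReal (klDiv_ne_top h .of_finite)]

lemma measureReal_eq_sum (μ : Measure α) [IsFiniteMeasure μ] (s : Set α)
    [DecidablePred (· ∈ s)] : μ.real s = ∑ a, if a ∈ s then μ.real {a} else 0 := by
  rw [← Finset.sum_filter, sum_measureReal_singleton]
  congr 1
  ext a
  simp

lemma margFst_real (μ : Measure (α × β)) [IsFiniteMeasure μ] (a : α) :
    margFst (fun z => μ.real {z}) a = μ.fst.real {a} := by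
  classical
  rw [Measure.real, Measure.fst_apply (measurableSet_singleton a), ← Measure.real,
    measureReal_eq_sum, margFst, Fintype.sum_prod_type]
  simp

lemma margSnd_real (μ : Measure (α × β)) [IsFiniteMeasure μ] (b : β) :
    margSnd (fun z => μ.real {z}) b = μ.snd.real {b} := by
  classical
  rw [Measure.real, Measure.snd_apply (measurableSet_singleton b), ← Measure.real,
    measureReal_eq_sum, margSnd, Fintype.sum_prod_type_right]
  simp

lemma real_mem_stdSimplex (μ : Measure α) [IsProbabilityMeasure μ] :
    (fun a => μ.real {a}) ∈ stdSimplex ℝ α := by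
  refine ⟨fun a => measureReal_nonneg, ?_⟩
  rw [sum_measureReal_singleton]
  simp

lemma mutualInfo_eq (μ : Measure (α × β)) [IsProbabilityMeasure μ] :
    mutualInfo μ = ENNReal.ofReal (homEntropy (margFst fun z => μ.real {z})
      + homEntropy (margSnd fun z => μ.real {z}) - homEntropy fun z => μ.real {z}) := by
  set m : α × β → ℝ := fun z => μ.real {z} with hm
  have hm1 : m ∈ stdSimplex ℝ (α × β) := real_mem_stdSimplex μ
  have hprod : ∀ z : α × β, (μ.fst.prod μ.snd).real {z} = margFst m z.1 * margSnd m z.2 := by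
    rintro ⟨a, b⟩
    rw [margFst_real, margSnd_real, ← Set.singleton_prod_singleton, measureReal_prod_prod]
  have hne : ∀ z, m z ≠ 0 → margFst m z.1 ≠ 0 ∧ margSnd m z.2 ≠ 0 := fun z hz =>
    ⟨margFst_ne_zero hm1.1 hz, margSnd_ne_zero hm1.1 hz⟩
  rw [mutualInfo, klDiv_eq_ofReal_sum]
  · congr 1
    rw [homEntropy_of_sum_eq_one hm1.2, homEntropy_of_sum_eq_one ((sum_margFst m).trans hm1.2),
      homEntropy_of_sum_eq_one ((sum_margSnd m).trans hm1.2),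
      sum_margFst_mul m fun x => Real.log (margFst m x),
      sum_margSnd_mul m fun x => Real.log (margSnd m x)]
    have : ∀ z, m z * (Real.log (m z) - Real.log ((μ.fst.prod μ.snd).real {z}))
        = m z * Real.log (m z) - m z * Real.log (margFst m z.1)
          - m z * Real.log (margSnd m z.2) := fun z => by
      by_cases h : m z = 0
      · simp [h]
      · rw [hprod, Real.log_mul (hne z h).1 (hne z h).2]; ring
    rw [Finset.sum_congr rfl fun z _ => this z]
    simp only [Finset.sum_sub_distrib]
    ring
  · rw [absolutelyContinuous_iff_singleton]
    intro z hz
    by_contra h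
    have h1 : m z ≠ 0 := fun h0 => h ((measureReal_eq_zero_iff).1 h0)
    have h2 := hprod z
    rw [Measure.real, hz, ENNReal.toReal_zero] at h2
    exact mul_ne_zero (hne z h1).1 (hne z h1).2 h2.symm

end FiniteMeasures

/-! ### Mutual information of channels and the attained maximum -/

section InfoValues

variable {𝒳 𝒴 : Type*} [Fintype 𝒳] [MeasurableSpace 𝒳] [MeasurableSingletonClass 𝒳]
  [Fintype 𝒴] [MeasurableSpace 𝒴] [MeasurableSingletonClass 𝒴]

lemma lawYXU_real (P : Measure (𝒴 × 𝒳)) [IsProbabilityMeasure P] {m : ℕ} (W : Kernel 𝒳 (Fin m))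
    [IsMarkovKernel W] (z : (𝒴 × 𝒳) × Fin m) :
    (lawYXU P W).real {z} = P.real {z.1} * (W z.1.2).real {z.2} := by
  obtain ⟨z, u⟩ := z
  rw [lawYXU, Measure.real, ← Set.singleton_prod_singleton,
    Measure.compProd_apply_prod (measurableSet_singleton _) (measurableSet_singleton _),
    lintegral_singleton, ENNReal.toReal_mul, mul_comm]
  rfl

lemma map_real_singleton {α β : Type*} [Fintype α] [MeasurableSpace α] [MeasurableSingletonClass α]
    [DecidableEq β] [MeasurableSpace β] [MeasurableSingletonClass β] (μ : Measure α)
    [IsFiniteMeasure μ] (f : α → β) (b : β) :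
    (μ.map f).real {b} = ∑ a, if f a = b then μ.real {a} else 0 := by
  classical
  rw [map_measureReal_apply (measurable_of_finite f) (measurableSet_singleton b),
    measureReal_eq_sum]
  simp

/-- The channel law of a Markov kernel with finite output alphabet. -/
lemma mutualInfo_lawYXU (P : Measure (𝒴 × 𝒳)) [IsProbabilityMeasure P] {m : ℕ}
    (W : Kernel 𝒳 (Fin m)) [IsMarkovKernel W] :
    mutualInfo ((lawYXU P W).map (fun z => (z.2, z.1.2))) =
      ENNReal.ofReal (homEntropy (margSnd fun z => P.real {z}) -
        (channelProfile (fun z => P.real {z}) fun x u => (W x).real {u}).2.1) ∧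
    mutualInfo ((lawYXU P W).map (fun z => (z.1.1, z.2))) =
      ENNReal.ofReal (homEntropy (margFst fun z => P.real {z}) -
        (channelProfile (fun z => P.real {z}) fun x u => (W x).real {u}).2.2.1) := by
  classical
  set p : 𝒴 × 𝒳 → ℝ := fun z => P.real {z} with hp
  set w : 𝒳 → Fin m → ℝ := fun x u => (W x).real {u} with hw
  have hprob : IsProbabilityMeasure (lawYXU P W) := by unfold lawYXU; infer_instance
  have hw1 : ∀ x, w x ∈ stdSimplex ℝ (Fin m) := fun x => real_mem_stdSimplex (W x)
  constructor
  · have hprob2 : IsProbabilityMeasure ((lawYXU P W).map (fun z => (z.2, z.1.2))) :=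
      Measure.isProbabilityMeasure_map (measurable_of_finite _).aemeasurable
    have hjoint : (fun z => ((lawYXU P W).map (fun z => (z.2, z.1.2))).real {z})
        = fun z : Fin m × 𝒳 => margSnd (channelWeight p w z.1) z.2 := by
      ext ⟨u, x⟩
      rw [map_real_singleton]
      simp only [lawYXU_real, margSnd, channelWeight, Fintype.sum_prod_type, Prod.mk.injEq, p, w]
      refine Finset.sum_congr rfl fun y _ => ?_
      rw [Finset.sum_eq_single x, Finset.sum_eq_single u]
      · simp
      · intro b _ hb; simp [hb]
      · simp
      · intro b _ hb; simp [hb]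
      · simp
    rw [mutualInfo_eq, hjoint, homEntropy_prod fun z : Fin m × 𝒳 => margSnd (channelWeight p w z.1) z.2]
    congr 1
    have h1 : margSnd (fun z : Fin m × 𝒳 => margSnd (channelWeight p w z.1) z.2) = margSnd p := by
      ext x
      simp only [margSnd, channelWeight]
      rw [Finset.sum_comm]
      simp only [← Finset.mul_sum, (hw1 x).2, mul_one]
    rw [h1]
    have h2 : margFst (fun z : Fin m × 𝒳 => margSnd (channelWeight p w z.1) z.2)
        = fun u => ∑ x, margSnd (channelWeight p w u) x := rfl
    simp only [h2, channelProfile, profile, Prod.snd_sum, Prod.fst_sum]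
    ring
  · have hprob2 : IsProbabilityMeasure ((lawYXU P W).map (fun z => (z.1.1, z.2))) :=
      Measure.isProbabilityMeasure_map (measurable_of_finite _).aemeasurable
    have hjoint : (fun z => ((lawYXU P W).map (fun z => (z.1.1, z.2))).real {z})
        = fun z : 𝒴 × Fin m => margFst (channelWeight p w z.2) z.1 := by
      ext ⟨y, u⟩
      rw [map_real_singleton]
      simp only [lawYXU_real, margFst, channelWeight, Fintype.sum_prod_type, Prod.mk.injEq, p, w]
      rw [Finset.sum_eq_single y]
      · refine Finset.sum_congr rfl fun x _ => ?_
        rw [Finset.sum_eq_single u]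
        · simp
        · intro b _ hb; simp [hb]
        · simp
      · intro b _ hb; simp [hb]
      · simp
    rw [mutualInfo_eq, hjoint,
      homEntropy_prod_right fun z : 𝒴 × Fin m => margFst (channelWeight p w z.2) z.1]
    congr 1
    have h1 : margFst (fun z : 𝒴 × Fin m => margFst (channelWeight p w z.2) z.1) = margFst p := by
      ext x
      simp only [margFst, channelWeight]
      rw [Finset.sum_comm]
      simp only [← Finset.mul_sum, (hw1 _).2, mul_one]
    rw [h1]
    simp only [channelProfile, profile, Prod.snd_sum, Prod.fst_sum]
    ring

lemma exists_kernel {m : ℕ} {w : 𝒳 → Fin m → ℝ} (hw : ∀ x, w x ∈ stdSimplex ℝ (Fin m)) :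
    ∃ W : Kernel 𝒳 (Fin m), IsMarkovKernel W ∧ ∀ x u, (W x).real {u} = w x u := by
  let f : 𝒳 → PMF (Fin m) := fun x => PMF.ofFintype (fun u => ENNReal.ofReal (w x u)) (by
    rw [← ENNReal.ofReal_sum_of_nonneg fun u _ => (hw x).1 u, (hw x).2, ENNReal.ofReal_one])
  refine ⟨⟨fun x => (f x).toMeasure, measurable_of_finite _⟩,
    ⟨fun x => inferInstanceAs (IsProbabilityMeasure (f x).toMeasure)⟩, fun x u => ?_⟩
  change ((f x).toMeasure {u}).toReal = _
  rw [PMF.toMeasure_apply_singleton _ _ (measurableSet_singleton u)]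
  exact ENNReal.toReal_ofReal ((hw x).1 u)

/-- The maximum of `I(Y;U)` subject to `I(U;X) ≤ R` is attained. -/
lemma exists_isGreatest_infoValues (P : Measure (𝒴 × 𝒳)) [IsProbabilityMeasure P] {R : ℝ}
    (hR : 0 ≤ R) :
    ∃ k ∈ feasibleSet (fun z => P.real {z}) R,
      (∀ k' ∈ feasibleSet (fun z => P.real {z}) R, k.2.2.1 ≤ k'.2.2.1) ∧
      0 ≤ homEntropy (margFst fun z => P.real {z}) - k.2.2.1 ∧
      IsGreatest (infoValues P R)
        (ENNReal.ofReal (homEntropy (margFst fun z => P.real {z}) - k.2.2.1)) := by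
  set p : 𝒴 × 𝒳 → ℝ := fun z => P.real {z} with hpdef
  have hp : p ∈ stdSimplex ℝ (𝒴 × 𝒳) := real_mem_stdSimplex P
  obtain ⟨z₀⟩ : Nonempty (𝒴 × 𝒳) := nonempty_of_isProbabilityMeasure P
  have : Nonempty 𝒴 := ⟨z₀.1⟩
  have : Nonempty 𝒳 := ⟨z₀.2⟩
  -- The constant channel is feasible because R ≥ 0; it makes the feasible set nonempty, and
  -- comparison with it gives the sign of the optimum.
  have htriv : ∀ x : 𝒳, (fun _ => 1 : Fin 1 → ℝ) ∈ stdSimplex ℝ (Fin 1) := fun x => by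
    simp [stdSimplex]
  have hw0 : channelProfile p (fun _ : 𝒳 => (fun _ => 1 : Fin 1 → ℝ)) = profile p := by
    simp only [channelProfile, Finset.univ_unique, Finset.sum_singleton]
    congr 1; ext z; exact mul_one _
  have hmem0 : profile p ∈ feasibleSet p R := by
    rw [← hw0, channelProfile_mem_feasibleSet hp htriv, hw0]
    simpa [profile] using hR
  obtain ⟨k, hk, hmin⟩ := (isCompact_feasibleSet p R).exists_isMinOn ⟨_, hmem0⟩
    (f := fun k => k.2.2.1) (by fun_prop)
  rw [isMinOn_iff] at hmin
  refine ⟨k, hk, hmin, ?_, ?_, ?_⟩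
  · simpa [profile] using hmin _ hmem0
  · obtain ⟨m, w, hw, rfl⟩ := exists_channel_of_mem_feasibleSet hp.1 hk
    obtain ⟨W, hW, hWw⟩ := exists_kernel hw
    obtain ⟨h1, h2⟩ := mutualInfo_lawYXU P W
    simp only [hWw] at h1 h2
    refine ⟨m, W, hW, ?_, h2.symm⟩
    rw [h1]
    exact ENNReal.ofReal_le_ofReal ((channelProfile_mem_feasibleSet hp hw).1 hk)
  · rintro _ ⟨m, W, hW, h, rfl⟩
    obtain ⟨h1, h2⟩ := mutualInfo_lawYXU P W
    rw [h1, ENNReal.ofReal_le_ofReal_iff hR] at h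
    rw [h2]
    refine ENNReal.ofReal_le_ofReal (sub_le_sub_left (hmin _ ?_) _)
    exact (channelProfile_mem_feasibleSet hp fun x => real_mem_stdSimplex (W x)).2 h

end InfoValues

/-! ### Weak law of large numbers for sliding blocks -/

section LawOfLargeNumbers

variable {𝒳 : Type*}

/-- The block of `k + 1` consecutive letters of a word that starts at position `j`. -/
def block {m k : ℕ} (x : Fin (m + k) → 𝒳) (j : Fin m) : Fin (k + 1) → 𝒳 :=
  fun i => x ⟨j + i, by omega⟩

variable [MeasurableSpace 𝒳] (P : Measure 𝒳) [IsProbabilityMeasure P]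

lemma map_block (m k : ℕ) (j : Fin m) :
    (Measure.pi fun _ : Fin (m + k) => P).map (fun x => block x j)
      = Measure.pi fun _ : Fin (k + 1) => P := by
  have h := iIndepFun_pi (μ := fun _ : Fin (m + k) => P) (X := fun _ x => x)
    fun _ => aemeasurable_id
  have h2 := h.precomp (g := fun i : Fin (k + 1) => (⟨j + i, by omega⟩ : Fin (m + k)))
    fun a b hab => by simpa [Fin.ext_iff] using hab
  have h3 := (iIndepFun_iff_map_fun_eq_pi_map
    fun i => (measurable_pi_apply _).aemeasurable).1 h2
  refine h3.trans ?_
  congr 1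
  ext1 i
  exact (measurePreserving_eval (fun _ : Fin (m + k) => P) _).map_eq

variable [Finite 𝒳] [MeasurableSingletonClass 𝒳]

/-- Blocks whose starting points differ by more than k read disjoint sets of coordinates of a
product measure. -/
lemma indepFun_block {m k : ℕ} (g : (Fin (k + 1) → 𝒳) → ℝ) {i j : Fin m}
    (hij : (i : ℕ) + k < j) :
    IndepFun (fun x : Fin (m + k) → 𝒳 => g (block x i)) (fun x => g (block x j))
      (Measure.pi fun _ : Fin (m + k) => P) := by
  classical
  have h := iIndepFun_pi (μ := fun _ : Fin (m + k) => P) (X := fun _ x => x)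
    fun _ => aemeasurable_id
  let S : Fin m → Finset (Fin (m + k)) := fun j =>
    Finset.univ.image fun l : Fin (k + 1) => ⟨j + l, by omega⟩
  have hS : Disjoint (S i) (S j) := by
    rw [Finset.disjoint_left]
    intro a ha hb
    simp only [S, Finset.mem_image, Finset.mem_univ, true_and] at ha hb
    obtain ⟨l, rfl⟩ := ha
    obtain ⟨l', hl'⟩ := hb
    simp only [Fin.mk.injEq] at hl'
    omega
  have h2 := h.indepFun_finset (S i) (S j) hS fun l => measurable_pi_apply l
  have hmem : ∀ (j : Fin m) (l : Fin (k + 1)), (⟨j + l, by omega⟩ : Fin (m + k)) ∈ S j :=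
    fun j l => Finset.mem_image_of_mem _ (Finset.mem_univ l)
  exact h2.comp (φ := fun y => g fun l => y ⟨⟨i + l, by omega⟩, hmem i l⟩)
    (ψ := fun y => g fun l => y ⟨⟨j + l, by omega⟩, hmem j l⟩)
    (measurable_of_finite _) (measurable_of_finite _)

lemma memLp_of_finite' {Ω : Type*} [Finite Ω] [MeasurableSpace Ω] [MeasurableSingletonClass Ω]
    (μ : Measure Ω) [IsFiniteMeasure μ] (f : Ω → ℝ) : MemLp f 2 μ := by
  obtain ⟨C, hC⟩ := (Set.finite_range fun x => ‖f x‖).bddAbove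
  exact .of_bound (measurable_of_finite f).aestronglyMeasurable C
    (ae_of_all _ fun x => hC ⟨x, rfl⟩)

lemma abs_covariance_le {Ω : Type*} [Finite Ω] [MeasurableSpace Ω] [MeasurableSingletonClass Ω]
    (μ : Measure Ω) [IsProbabilityMeasure μ] {f g : Ω → ℝ} {C : ℝ} (hf : ∀ x, |f x| ≤ C)
    (hg : ∀ x, |g x| ≤ C) : cov[f, g; μ] ≤ (2 * C) ^ 2 := by
  have key : ∀ {f : Ω → ℝ}, (∀ x, |f x| ≤ C) → ∀ x, |f x - ∫ y, f y ∂μ| ≤ 2 * C := by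
    intro f hf x
    have h1 : |∫ y, f y ∂μ| ≤ C := by
      simpa using norm_integral_le_of_norm_le_const (μ := μ) (f := f) (C := C) (ae_of_all _ hf)
    have := abs_sub (f x) (∫ y, f y ∂μ)
    linarith [hf x]
  rw [covariance]
  refine (le_abs_self _).trans ?_
  have := norm_integral_le_of_norm_le_const (μ := μ)
    (f := fun x => (f x - ∫ y, f y ∂μ) * (g x - ∫ y, g y ∂μ)) (C := (2 * C) ^ 2)
    (ae_of_all _ fun x => by
      rw [norm_mul, sq]
      exact mul_le_mul (key hf x) (key hg x) (abs_nonneg _) ((abs_nonneg _).trans (key hf x)))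
  simpa using this

/-- A block is correlated with at most 2k + 1 blocks, itself included, so the variance grows
linearly in the number of blocks; Chebyshev's inequality then suffices. -/
lemma variance_blockSum_le (m k : ℕ) (g : (Fin (k + 1) → 𝒳) → ℝ) {C : ℝ} (hC : ∀ b, |g b| ≤ C) :
    Var[fun x : Fin (m + k) → 𝒳 => ∑ j, g (block x j); Measure.pi fun _ : Fin (m + k) => P]
      ≤ m * ((2 * k + 1) * (2 * C) ^ 2) := by
  rw [variance_fun_sum fun i => memLp_of_finite' _ _]
  calc _ ≤ ∑ i : Fin m, ∑ j : Fin m,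
        (if (j : ℕ) ∈ Finset.Icc ((i : ℕ) - k) (i + k) then (2 * C) ^ 2 else 0) := by
        refine Finset.sum_le_sum fun i _ => Finset.sum_le_sum fun j _ => ?_
        split_ifs with h
        · exact abs_covariance_le _ (fun x => hC _) (fun x => hC _)
        · rw [Finset.mem_Icc, not_and_or, not_le, not_le] at h
          refine le_of_eq ?_
          rcases h with h | h
          · rw [covariance_comm]
            exact (indepFun_block P g (by omega)).covariance_eq_zero (memLp_of_finite' _ _)
              (memLp_of_finite' _ _)
          · exact (indepFun_block P g h).covariance_eq_zero (memLp_of_finite' _ _)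
              (memLp_of_finite' _ _)
    _ ≤ ∑ i : Fin m, (2 * k + 1) * (2 * C) ^ 2 := by
        refine Finset.sum_le_sum fun i _ => ?_
        rw [← Finset.sum_filter, Finset.sum_const, nsmul_eq_mul]
        refine mul_le_mul_of_nonneg_right ?_ (sq_nonneg _)
        have h1 : (Finset.univ.filter fun j : Fin m =>
            (j : ℕ) ∈ Finset.Icc ((i : ℕ) - k) (i + k)).card
            ≤ (Finset.Icc ((i : ℕ) - k) (i + k)).card :=
          Finset.card_le_card_of_injOn (fun j => (j : ℕ)) (fun j hj => by simpa using hj)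
            (Fin.val_injective.injOn)
        rw [Nat.card_Icc] at h1
        exact_mod_cast h1.trans (by omega)
    _ = m * ((2 * k + 1) * (2 * C) ^ 2) := by simp

/-- The weak law of large numbers for sliding-block sums of a memoryless source. -/
lemma tendsto_blockSum (k : ℕ) (g : (Fin (k + 1) → 𝒳) → ℝ) {δ : ℝ} (hδ : 0 < δ) :
    Tendsto (fun m : ℕ => (Measure.pi fun _ : Fin (m + k) => P).real
      {x | δ * m ≤ |∑ j, g (block x j) - m * ∫ b, g b ∂Measure.pi fun _ : Fin (k + 1) => P|})
      atTop (𝓝 0) := by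
  obtain ⟨C, hC⟩ := (Set.finite_range fun b => |g b|).bddAbove
  have hC : ∀ b, |g b| ≤ C := fun b => hC ⟨b, rfl⟩
  set K : ℝ := (2 * k + 1) * (2 * C) ^ 2 with hK
  have hlim : Tendsto (fun m : ℕ => K / δ ^ 2 / (m : ℝ)) atTop (𝓝 0) :=
    tendsto_const_div_atTop_nhds_zero_nat _
  refine squeeze_zero' (Eventually.of_forall fun m => measureReal_nonneg) ?_ hlim
  filter_upwards [eventually_gt_atTop 0] with m hm
  have hm' : (0 : ℝ) < m := by exact_mod_cast hm
  have hmean : ∫ x, ∑ j, g (block x j) ∂(Measure.pi fun _ : Fin (m + k) => P)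
      = m * ∫ b, g b ∂Measure.pi fun _ : Fin (k + 1) => P := by
    rw [integral_finsetSum _ fun i _ => .of_finite]
    have : ∀ j : Fin m, ∫ x, g (block x j) ∂(Measure.pi fun _ : Fin (m + k) => P)
        = ∫ b, g b ∂Measure.pi fun _ : Fin (k + 1) => P := fun j => by
      rw [← map_block P m k j, integral_map (measurable_of_finite _).aemeasurable
        (measurable_of_finite _).aestronglyMeasurable]
    simp [this]
  have h := meas_ge_le_variance_div_sq (memLp_of_finite' (Measure.pi fun _ : Fin (m + k) => P)
    fun x => ∑ j, g (block x j)) (mul_pos hδ hm')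
  rw [hmean] at h
  have h2 := variance_blockSum_le P m k g hC
  have h3 := ENNReal.toReal_mono ENNReal.ofReal_ne_top h
  rw [ENNReal.toReal_ofReal (div_nonneg (variance_nonneg _ _) (sq_nonneg _))] at h3
  refine h3.trans ((div_le_div_of_nonneg_right h2 (sq_nonneg _)).trans (le_of_eq ?_))
  rw [← hK]
  field_simp

lemma integral_pi_eval {ι : Type*} [Fintype ι] (f : 𝒳 → ℝ) (i : ι) :
    ∫ b, f (b i) ∂(Measure.pi fun _ : ι => P) = ∫ a, f a ∂P := by
  have h := integral_map (μ := Measure.pi fun _ : ι => P) (φ := Function.eval i) (f := f)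
    (measurable_pi_apply i).aemeasurable (measurable_of_finite _).aestronglyMeasurable
  rw [(measurePreserving_eval (fun _ : ι => P) i).map_eq] at h
  exact h.symm

/-- The weak law of large numbers for a memoryless source. -/
lemma tendsto_letterSum (f : 𝒳 → ℝ) {δ : ℝ} (hδ : 0 < δ) :
    Tendsto (fun n : ℕ => (Measure.pi fun _ : Fin n => P).real
      {x | δ * n ≤ |∑ i, f (x i) - n * ∫ a, f a ∂P|}) atTop (𝓝 0) := by
  have h := tendsto_blockSum P 0 (fun b => f (b 0)) hδ
  rw [integral_pi_eval] at h
  exact h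

end LawOfLargeNumbers

/-! ### Log-likelihood ratios against finite-order Markov laws -/

section Markov

variable {𝒳 : Type*} [MeasurableSpace 𝒳]

lemma iid_real_singleton (P : Measure 𝒳) [IsProbabilityMeasure P] (n : ℕ) (x : Fin n → 𝒳) :
    (iid P n).real {x} = ∏ i, P.real {x i} := by
  rw [iid, Measure.real, Measure.pi_singleton, ENNReal.toReal_prod]
  rfl

instance (P : Measure 𝒳) [IsProbabilityMeasure P] (n : ℕ) : IsProbabilityMeasure (iid P n) := by
  unfold iid; infer_instance

/-- The log-likelihood ratio of a word. -/
noncomputable def logRatio (P : Measure 𝒳) (Q : (n : ℕ) → Measure (Fin n → 𝒳)) (n : ℕ)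
    (x : Fin n → 𝒳) : ℝ :=
  Real.log ((iid P n).real {x}) - Real.log ((Q n).real {x})

variable {P : Measure 𝒳} [IsProbabilityMeasure P] {Q : (n : ℕ) → Measure (Fin n → 𝒳)} {k : ℕ}
  {W : Kernel (Fin k → 𝒳) 𝒳}

/-- `W` is the transition kernel of order `k` of the laws `Q n`. -/
def HasTransition (Q : (n : ℕ) → Measure (Fin n → 𝒳)) (W : Kernel (Fin k → 𝒳) 𝒳) : Prop :=
  ∀ (n : ℕ) (x : Fin (n + k + 1) → 𝒳), Q (n + k + 1) {x} = Q (n + k) {Fin.init x} *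
    W (fun i => x (Fin.castSucc (Fin.natAdd n i))) {x (Fin.last (n + k))}

lemma markov_real_singleton (hW : HasTransition Q W) (m : ℕ) (x : Fin (m + k) → 𝒳) :
    (Q (m + k)).real {x} = (Q k).real {fun i : Fin k => x ⟨i, by omega⟩} *
      ∏ j : Fin m, (W (Fin.init (block x j))).real {block x j (Fin.last k)} := by
  -- The induction runs over infinite sequences, whose restrictions to different lengths need no
  -- index arithmetic.
  have key : ∀ (x : ℕ → 𝒳) (m : ℕ), (Q (m + k)).real {fun i : Fin (m + k) => x i}
      = (Q k).real {fun i : Fin k => x i} *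
        ∏ j ∈ Finset.range m, (W fun i => x (j + i)).real {x (j + k)} := by
    intro x m
    induction m with
    | zero => rw [Nat.zero_add]; simp
    | succ m ih =>
      have h := hW m fun i => x i
      have h' : (Q (m + k + 1)).real {fun i : Fin (m + k + 1) => x i}
          = (Q (m + k)).real {fun i : Fin (m + k) => x i} *
          (W fun i => x (m + i)).real {x (m + k)} := by
        rw [Measure.real, h, ENNReal.toReal_mul]
        rfl
      rw [show m + 1 + k = m + k + 1 by omega, h', ih, Finset.prod_range_succ, mul_assoc]
  -- A finite word is continued by repeating its first letter, so the empty word is treated apart.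
  rcases Nat.eq_zero_or_pos (m + k) with h0 | h0
  · obtain ⟨rfl, rfl⟩ : m = 0 ∧ k = 0 := by omega
    simp only [Finset.univ_eq_empty, Finset.prod_empty, mul_one]
  · have h := key (fun i => if hi : i < m + k then x ⟨i, hi⟩ else x ⟨0, h0⟩) m
    rw [Finset.prod_range] at h
    have e1 : (fun i : Fin (m + k) => if hi : (i : ℕ) < m + k then x ⟨i, hi⟩ else x ⟨0, h0⟩) = x := by
      ext i; simp
    have e2 : (fun i : Fin k => if hi : (i : ℕ) < m + k then x ⟨i, hi⟩ else x ⟨0, h0⟩)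
        = fun i : Fin k => x ⟨i, by omega⟩ := by
      ext i; rw [dif_pos]
    rw [e1, e2] at h
    rw [h]
    congr 1
    refine Finset.prod_congr rfl fun j _ => ?_
    have e3 : (fun i : Fin k => if hi : (j : ℕ) + i < m + k then x ⟨j + i, hi⟩ else x ⟨0, h0⟩)
        = Fin.init (block x j) := by
      ext i; rw [dif_pos (by omega)]; rfl
    rw [e3, dif_pos (by omega)]
    rfl

/-- The increment of the log-likelihood ratio caused by one letter. -/
noncomputable def logIncrement (P : Measure 𝒳) (W : Kernel (Fin k → 𝒳) 𝒳) (b : Fin (k + 1) → 𝒳) :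
    ℝ :=
  Real.log (P.real {b (Fin.last k)}) - Real.log ((W (Fin.init b)).real {b (Fin.last k)})

/-- After the first k letters both likelihoods multiply letter by letter. Positivity of the word
under P^{⊗n}, and hence under Q, rules out logarithms of 0. -/
lemma logRatio_eq (hW : HasTransition Q W) (hac : ∀ n, iid P n ≪ Q n)
    (hQ : ∀ n, IsProbabilityMeasure (Q n)) (m : ℕ) (x : Fin (m + k) → 𝒳)
    (hx : (iid P (m + k)).real {x} ≠ 0) :
    logRatio P Q (m + k) x = logRatio P Q k (fun i => x ⟨i, by omega⟩)
      + ∑ j, logIncrement P W (block x j) := by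
  have hq : (Q (m + k)).real {x} ≠ 0 := fun h => hx (by
    rw [measureReal_eq_zero_iff] at h ⊢; exact hac _ h)
  rw [markov_real_singleton hW, mul_ne_zero_iff, Finset.prod_ne_zero_iff] at hq
  have hp : ∀ i, P.real {x i} ≠ 0 := by
    rw [iid_real_singleton, Finset.prod_ne_zero_iff] at hx
    exact fun i => hx i (Finset.mem_univ i)
  have hsplit : Real.log ((iid P (m + k)).real {x})
      = Real.log ((iid P k).real {fun i : Fin k => x ⟨i, by omega⟩})
        + ∑ j : Fin m, Real.log (P.real {block x j (Fin.last k)}) := by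
    rw [iid_real_singleton, iid_real_singleton, Real.log_prod fun i _ => hp i,
      Real.log_prod fun i _ => hp _]
    rw [← (finCongr (Nat.add_comm k m)).sum_comp, Fin.sum_univ_add]
    congr 1
    refine Finset.sum_congr rfl fun j _ => ?_
    congr 4
    simp [Fin.ext_iff, Nat.add_comm]
  simp only [logRatio, logIncrement]
  rw [hsplit, markov_real_singleton hW, Real.log_mul hq.1 (Finset.prod_ne_zero_iff.2 hq.2),
    Real.log_prod hq.2, Finset.sum_sub_distrib]
  ring

variable [Fintype 𝒳] [MeasurableSingletonClass 𝒳]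

/-- The divergence rate of a memoryless law relative to a Markov law. -/
lemma hasDivergenceRate_markov (hW : HasTransition Q W) (hac : ∀ n, iid P n ≪ Q n)
    (hQ : ∀ n, IsProbabilityMeasure (Q n)) :
    HasDivergenceRate P Q
      ((∫ b, logIncrement P W b ∂Measure.pi fun _ : Fin (k + 1) => P : ℝ) : EReal) := by
  set A := ∫ b, logIncrement P W b ∂Measure.pi fun _ : Fin (k + 1) => P with hA
  have hD : ∀ n, (klDiv (iid P n) (Q n) : EReal) = ((∫ x, logRatio P Q n x ∂iid P n : ℝ) : EReal) := by
    intro n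
    rw [coe_klDiv_eq_sum (hac n), integral_fintype .of_finite]
    rfl
  -- From length k on the divergence is affine in the length, with slope A, so its increments are
  -- eventually constant.
  have hD2 : ∀ m, ∫ x, logRatio P Q (m + k) x ∂iid P (m + k)
      = ∫ x, logRatio P Q k x ∂iid P k + m * A := by
    intro m
    have h1 : ∫ x, logRatio P Q (m + k) x ∂iid P (m + k)
        = ∫ x, (logRatio P Q k (fun i => x ⟨i, by omega⟩)
          + ∑ j, logIncrement P W (block x j)) ∂iid P (m + k) := by
      rw [integral_fintype .of_finite, integral_fintype .of_finite]
      refine Finset.sum_congr rfl fun x _ => ?_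
      by_cases hx : (iid P (m + k)).real {x} = 0
      · simp [hx]
      · rw [logRatio_eq hW hac hQ m x hx]
    have h2 : ∀ j : Fin m, ∫ x, logIncrement P W (block x j) ∂iid P (m + k) = A := fun j => by
      rw [hA, ← map_block P m k j, integral_map (measurable_of_finite _).aemeasurable
        (measurable_of_finite _).aestronglyMeasurable]
      rfl
    have h3 : (iid P (m + k)).map (fun x (i : Fin k) => x ⟨i, by omega⟩) = iid P k := by
      have h := iIndepFun_pi (μ := fun _ : Fin (m + k) => P) (X := fun _ x => x)
        fun _ => aemeasurable_id
      have h2 := h.precomp (g := fun i : Fin k => (⟨i, by omega⟩ : Fin (m + k)))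
        fun a b hab => by simpa [Fin.ext_iff] using hab
      refine ((iIndepFun_iff_map_fun_eq_pi_map
        fun i => (measurable_pi_apply _).aemeasurable).1 h2).trans ?_
      unfold iid
      congr 1
      ext1 i
      exact (measurePreserving_eval (fun _ : Fin (m + k) => P) _).map_eq
    rw [h1, integral_add .of_finite .of_finite, integral_finsetSum _ fun i _ => .of_finite]
    simp only [h2, Finset.sum_const, Finset.card_univ, Fintype.card_fin, nsmul_eq_mul]
    rw [← h3, integral_map (measurable_of_finite _).aemeasurable
        (measurable_of_finite _).aestronglyMeasurable]
  refine tendsto_const_nhds.congr' ?_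
  filter_upwards [eventually_ge_atTop k] with n hn
  obtain ⟨m, rfl⟩ := Nat.exists_eq_add_of_le' hn
  rw [hD, hD, ← EReal.coe_sub, show m + k + 1 = m + 1 + k by omega, hD2, hD2]
  congr 1
  push_cast
  ring

/-- The log-likelihood ratio per letter converges to the divergence rate in probability. -/
lemma tendsto_logRatio_markov (hW : HasTransition Q W) (hac : ∀ n, iid P n ≪ Q n)
    (hQ : ∀ n, IsProbabilityMeasure (Q n)) {δ : ℝ} (hδ : 0 < δ) :
    Tendsto (fun n : ℕ => (iid P n).real {x | δ * n ≤ |logRatio P Q n x -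
      n * ∫ b, logIncrement P W b ∂Measure.pi fun _ : Fin (k + 1) => P|}) atTop (𝓝 0) := by
  set A := ∫ b, logIncrement P W b ∂Measure.pi fun _ : Fin (k + 1) => P with hA
  rw [← tendsto_add_atTop_iff_nat k]
  obtain ⟨C, hC⟩ := (Set.finite_range fun x => |logRatio P Q k x|).bddAbove
  have hC : ∀ x, |logRatio P Q k x| ≤ C := fun x => hC ⟨x, rfl⟩
  have h := tendsto_blockSum P k (logIncrement P W) (half_pos hδ)
  refine squeeze_zero' (Eventually.of_forall fun m => measureReal_nonneg) ?_ h
  -- Half of the deviation δ absorbs the bounded contribution of the first k letters and of the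
  -- index shift; the other half is left to the block sum.
  have hlarge : ∀ᶠ m : ℕ in atTop, C + k * |A| ≤ δ / 2 * m :=
    (tendsto_natCast_atTop_atTop.const_mul_atTop (half_pos hδ)).eventually_ge_atTop _
  filter_upwards [hlarge] with m hm
  refine ENNReal.toReal_mono (measure_ne_top _ _) (measure_mono_ae ?_)
  filter_upwards [ae_real_singleton_ne_zero (iid P (m + k))] with x hx hmem
  change δ * ((m + k : ℕ) : ℝ) ≤ |logRatio P Q (m + k) x - ((m + k : ℕ) : ℝ) * A| at hmem
  change δ / 2 * m ≤ |∑ j, logIncrement P W (block x j) - m * A|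
  rw [logRatio_eq hW hac hQ m x hx] at hmem
  set a := logRatio P Q k fun i => x ⟨i, by omega⟩ with ha
  set s := ∑ j, logIncrement P W (block x j)
  have h1 : a + s - ((m + k : ℕ) : ℝ) * A = (s - m * A) + (a - k * A) := by push_cast; ring
  have h2 : |a - k * A| ≤ C + k * |A| := by
    refine (abs_sub _ _).trans (add_le_add (hC _) ?_)
    rw [abs_mul, Nat.abs_cast]
  rw [h1] at hmem
  have h3 := abs_add_le (s - m * A) (a - k * A)
  push_cast at hmem
  have h4 : 0 ≤ δ * k := by positivity
  linarith

end Markov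

/-! ### Product laws, error probabilities and exponents in real terms -/

section Interface

variable {𝒳 𝒴 : Type*} [MeasurableSpace 𝒳] [MeasurableSpace 𝒴]

lemma iidPair_real_singleton (P : Measure (𝒴 × 𝒳)) [IsProbabilityMeasure P]
    [Finite 𝒳] [MeasurableSingletonClass 𝒳] [Finite 𝒴] [MeasurableSingletonClass 𝒴] (n : ℕ)
    (w : (Fin n → 𝒴) × (Fin n → 𝒳)) :
    (iidPair P n).real {w} = ∏ i, P.real {(w.1 i, w.2 i)} := by
  rw [iidPair, map_measureReal_apply (measurable_of_finite _) (measurableSet_singleton w)]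
  have : (fun ω : Fin n → 𝒴 × 𝒳 => ((fun i => (ω i).1, fun i => (ω i).2) :
      (Fin n → 𝒴) × (Fin n → 𝒳))) ⁻¹' {w} = {fun i => (w.1 i, w.2 i)} := by
    ext ω
    simp only [Set.mem_preimage, Set.mem_singleton_iff]
    constructor
    · rintro rfl; rfl
    · rintro rfl; rfl
  rw [this]
  exact iid_real_singleton P n _

instance (P : Measure (𝒴 × 𝒳)) [IsProbabilityMeasure P] (n : ℕ) :
    IsProbabilityMeasure (iidPair P n) :=
  Measure.isProbabilityMeasure_map (by fun_prop)

lemma iidPair_snd (P : Measure (𝒴 × 𝒳)) [IsProbabilityMeasure P] (n : ℕ) :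
    (iidPair P n).snd = iid P.snd n := by
  rw [iidPair, Measure.snd, Measure.map_map measurable_snd (by fun_prop), iid, Measure.snd,
    ← Measure.pi_map_pi fun _ => measurable_snd.aemeasurable]
  rfl

lemma iidPair_fst (P : Measure (𝒴 × 𝒳)) [IsProbabilityMeasure P] (n : ℕ) :
    (iidPair P n).fst = iid P.fst n := by
  rw [iidPair, Measure.fst, Measure.map_map measurable_fst (by fun_prop), iid, Measure.fst,
    ← Measure.pi_map_pi fun _ => measurable_fst.aemeasurable]
  rfl

variable [Fintype 𝒳] [MeasurableSingletonClass 𝒳] [Fintype 𝒴] [MeasurableSingletonClass 𝒴]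

lemma lintegral_observed {n : ℕ} (s : TestingScheme 𝒳 𝒴 n)
    (μ : Measure ((Fin n → 𝒴) × (Fin n → 𝒳))) [IsProbabilityMeasure μ] (i : Fin 2) :
    ∫⁻ z, s.ψ z i ∂(s.observed μ) =
      ENNReal.ofReal (∑ w, μ.real {w} * (s.ψ (w.1, s.φ w.2) i).toReal) := by
  rw [TestingScheme.observed, lintegral_map (measurable_of_finite _) (measurable_of_finite _),
    lintegral_fintype, ENNReal.ofReal_sum_of_nonneg
      fun w _ => mul_nonneg measureReal_nonneg ENNReal.toReal_nonneg]
  refine Finset.sum_congr rfl fun w _ => ?_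
  rw [ENNReal.ofReal_mul measureReal_nonneg, ENNReal.ofReal_toReal (PMF.apply_ne_top _ _),
    ofReal_measureReal, mul_comm]

lemma pmf_toReal_add (ψ : PMF (Fin 2)) : (ψ 0).toReal + (ψ 1).toReal = 1 := by
  have h := ψ.tsum_coe
  rw [tsum_fintype, Fin.sum_univ_two] at h
  rw [← ENNReal.toReal_add (PMF.apply_ne_top _ _) (PMF.apply_ne_top _ _), h, ENNReal.toReal_one]

lemma le_log_inv_div_iff {b : ℝ≥0∞} {c : ℝ} {n : ℕ} (hn : 0 < n) :
    (c : EReal) ≤ ENNReal.log b⁻¹ / (n : EReal) ↔ b ≤ ENNReal.ofReal (Real.exp (-(n * c))) := by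
  have h1 : ((n : ℕ) : EReal) > 0 := by exact_mod_cast hn
  rw [EReal.le_div_iff_mul_le h1 (EReal.natCast_ne_top n), ENNReal.log_inv,
    ← ENNReal.log_le_log_iff, ENNReal.log_ofReal_of_pos (Real.exp_pos _), Real.log_exp,
    EReal.coe_neg, EReal.le_neg]
  push_cast
  rw [mul_comm]

end Interface

/-! ### Selecting one message -/

section Pigeonhole

variable {𝔛 𝔜 : Type*} [Fintype 𝔛] [Fintype 𝔜] [DecidableEq 𝔛] [DecidableEq 𝔜]

/-- From a test based on compressed data, a message whose decision region has small probability
under independence but a non-negligible one under the joint law. -/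
lemma exists_good_message {j : 𝔜 × 𝔛 → ℝ} (hj : ∀ w, 0 ≤ j w) (hj1 : ∑ w, j w = 1)
    {qY : 𝔜 → ℝ} {qX : 𝔛 → ℝ} (hqY : ∀ y, 0 ≤ qY y) (hqX : ∀ x, 0 ≤ qX x) {M : ℕ}
    (φ : 𝔛 → Fin M) {ψ : 𝔜 → Fin M → ℝ} (hψ0 : ∀ y m, 0 ≤ ψ y m) (hψ1 : ∀ y m, ψ y m ≤ 1)
    (TX : Finset 𝔛) (TY : Finset 𝔜) {γ : ℝ} (hγ : 0 < γ)
    (hacc : γ ≤ ∑ w, j w * ψ w.1 (φ w.2))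
    (hTX : ∑ x, (if x ∈ TX then 0 else margSnd j x) ≤ γ / 8)
    (hTY : ∑ y, (if y ∈ TY then 0 else margFst j y) ≤ γ / 8)
    {cX cY : ℝ} (hcX : 0 ≤ cX) (hcY : 0 ≤ cY) (hX : ∀ x ∈ TX, margSnd j x ≤ cX * qX x)
    (hY : ∀ y ∈ TY, margFst j y ≤ cY * qY y) :
    ∃ (B : Finset 𝔜) (S : Finset 𝔛), S ⊆ TX ∧ 0 < ∑ w ∈ B ×ˢ S, j w ∧
      γ / (8 * M) ≤ ∑ w ∈ B ×ˢ S, j w ∧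
      γ / 8 * ∑ x ∈ S, margSnd j x ≤ ∑ w ∈ B ×ˢ S, j w ∧
      ∑ y ∈ B, margFst j y ≤ 32 / γ ^ 2 * (cX * cY * ∑ y, ∑ x, qY y * qX x * ψ y (φ x)) := by
  have hmX : ∀ x, 0 ≤ margSnd j x := fun x => Finset.sum_nonneg fun _ _ => hj _
  have hmY : ∀ y, 0 ≤ margFst j y := fun y => Finset.sum_nonneg fun _ _ => hj _
  let B : Fin M → Finset 𝔜 := fun m => Finset.univ.filter fun y => y ∈ TY ∧ γ / 4 ≤ ψ y m
  let S : Fin M → Finset 𝔛 := fun m => Finset.univ.filter fun x => x ∈ TX ∧ φ x = m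
  let g : Fin M → ℝ := fun m => ∑ w ∈ B m ×ˢ S m, j w
  let p : Fin M → ℝ := fun m => ∑ x ∈ S m, margSnd j x
  let a : Fin M → ℝ := fun m => ∑ y ∈ B m, margFst j y
  set β := ∑ y, ∑ x, qY y * qX x * ψ y (φ x) with hβ
  set b := 4 / γ * (cX * cY * β) with hb
  have hβ0 : 0 ≤ β := Finset.sum_nonneg fun y _ => Finset.sum_nonneg fun x _ =>
    mul_nonneg (mul_nonneg (hqY y) (hqX x)) (hψ0 _ _)
  have hb0 : 0 ≤ b := by positivity
  have hp0 : ∀ m, 0 ≤ p m := fun m => Finset.sum_nonneg fun x _ => hmX x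
  have ha0 : ∀ m, 0 ≤ a m := fun m => Finset.sum_nonneg fun x _ => hmY x
  have hgp : ∀ m, g m ≤ p m := fun m => by
    simp only [g, p, Finset.sum_product_right]
    exact Finset.sum_le_sum fun x _ => Finset.sum_le_univ_sum_of_nonneg fun y => hj _
  have hsum : ∀ f : Fin M → 𝔜 × 𝔛 → ℝ, (∑ m, ∑ w ∈ B m ×ˢ S m, f m w)
      = ∑ w : 𝔜 × 𝔛, if w.2 ∈ TX ∧ w.1 ∈ TY ∧ γ / 4 ≤ ψ w.1 (φ w.2) then f (φ w.2) w else 0 := by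
    intro f
    have : ∀ m, ∑ w ∈ B m ×ˢ S m, f m w = ∑ w : 𝔜 × 𝔛, if φ w.2 = m then
        (if w.2 ∈ TX ∧ w.1 ∈ TY ∧ γ / 4 ≤ ψ w.1 (φ w.2) then f (φ w.2) w else 0) else 0 := by
      intro m
      rw [← Finset.sum_filter, ← Finset.sum_filter, Finset.filter_filter]
      have hset : (Finset.univ.filter fun w : 𝔜 × 𝔛 => φ w.2 = m ∧ w.2 ∈ TX ∧ w.1 ∈ TY ∧
          γ / 4 ≤ ψ w.1 (φ w.2)) = B m ×ˢ S m := by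
        ext w
        simp only [B, S, Finset.mem_filter, Finset.mem_univ, true_and, Finset.mem_product]
        constructor
        · rintro ⟨rfl, h1, h2, h3⟩; exact ⟨⟨h2, h3⟩, h1, rfl⟩
        · rintro ⟨⟨h2, h3⟩, h1, rfl⟩; exact ⟨rfl, h1, h2, h3⟩
      rw [hset]
      refine Finset.sum_congr rfl fun w hw => ?_
      simp only [S, Finset.mem_filter, Finset.mem_univ, true_and, Finset.mem_product] at hw
      rw [hw.2.2]
    simp only [this]
    rw [Finset.sum_comm]
    refine Finset.sum_congr rfl fun w _ => ?_
    simp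
  -- Of the acceptance probability γ at most γ/4 comes from pairs accepted with probability below
  -- γ/4, and at most γ/8 is lost outside each typical set.
  have hg : γ / 2 ≤ ∑ m, g m := by
    have h1 : ∑ w, j w * ψ w.1 (φ w.2) ≤ ∑ w : 𝔜 × 𝔛,
        ((if w.2 ∈ TX ∧ w.1 ∈ TY ∧ γ / 4 ≤ ψ w.1 (φ w.2) then j w else 0) + γ / 4 * j w
          + (if w.2 ∈ TX then 0 else j w) + (if w.1 ∈ TY then 0 else j w)) := by
      refine Finset.sum_le_sum fun w _ => ?_
      have h0 := hj w
      have h2 : j w * ψ w.1 (φ w.2) ≤ j w := mul_le_of_le_one_right h0 (hψ1 _ _)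
      have h3 : 0 ≤ γ / 4 * j w := by positivity
      by_cases hx : w.2 ∈ TX <;> by_cases hy : w.1 ∈ TY <;> by_cases hz : γ / 4 ≤ ψ w.1 (φ w.2)
      all_goals simp only [hx, hy, hz, if_true, if_false, and_self, and_false, false_and]
      all_goals try linarith
      have := mul_le_mul_of_nonneg_left (not_le.1 hz).le h0
      linarith
    simp only [Finset.sum_add_distrib, ← Finset.mul_sum, hj1] at h1
    rw [← hsum fun _ w => j w] at h1
    have h2 : ∑ w : 𝔜 × 𝔛, (if w.2 ∈ TX then 0 else j w) ≤ γ / 8 := by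
      refine le_trans (le_of_eq ?_) hTX
      rw [Fintype.sum_prod_type_right]
      refine Finset.sum_congr rfl fun x _ => ?_
      dsimp only
      split_ifs
      · simp
      · rfl
    have h3 : ∑ w : 𝔜 × 𝔛, (if w.1 ∈ TY then 0 else j w) ≤ γ / 8 := by
      refine le_trans (le_of_eq ?_) hTY
      rw [Fintype.sum_prod_type]
      refine Finset.sum_congr rfl fun x _ => ?_
      dsimp only
      split_ifs
      · simp
      · rfl
    have : ∑ m, g m = ∑ m, ∑ w ∈ B m ×ˢ S m, j w := rfl
    linarith
  -- Change of measure: on the typical sets P_Y × P_X is at most cX cY times the alternative, and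
  -- each counted pair is accepted with probability at least γ/4, whence the factor 4/γ on the type
  -- II error.
  have hap : ∑ m, a m * p m ≤ b := by
    have h1 : ∀ m, a m * p m = ∑ w ∈ B m ×ˢ S m, margFst j w.1 * margSnd j w.2 := fun m => by
      simp only [a, p, Finset.sum_mul_sum, Finset.sum_product]
    simp only [h1]
    rw [hsum fun _ w => margFst j w.1 * margSnd j w.2, hb, hβ, ← Fintype.sum_prod_type', ← mul_assoc,
      Finset.mul_sum]
    refine Finset.sum_le_sum fun w _ => ?_
    have hq : 0 ≤ qY w.1 * qX w.2 := mul_nonneg (hqY _) (hqX _)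
    split_ifs with h
    · have h2 := mul_le_mul (hY _ h.2.1) (hX _ h.1) (hmX _) (mul_nonneg hcY (hqY _))
      have h3 : 1 ≤ 4 / γ * ψ w.1 (φ w.2) := by
        have := h.2.2
        rw [div_mul_eq_mul_div, le_div_iff₀ hγ]; linarith
      calc _ ≤ cY * qY w.1 * (cX * qX w.2) := h2
        _ = cX * cY * (qY w.1 * qX w.2) * 1 := by ring
        _ ≤ cX * cY * (qY w.1 * qX w.2) * (4 / γ * ψ w.1 (φ w.2)) :=
            mul_le_mul_of_nonneg_left h3 (by positivity)
        _ = _ := by ring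
    · exact mul_nonneg (by positivity) (mul_nonneg hq (hψ0 _ _))
  have hp1 : ∑ m, p m ≤ 1 := by
    have h1 : ∀ m, p m = ∑ x, if φ x = m then (if x ∈ TX then margSnd j x else 0) else 0 := by
      intro m
      simp only [p, S, Finset.sum_filter]
      refine Finset.sum_congr rfl fun x _ => ?_
      by_cases h1 : x ∈ TX <;> by_cases h2 : φ x = m <;> simp [h1, h2]
    simp only [h1]
    rw [Finset.sum_comm, ← hj1, ← sum_margSnd]
    refine Finset.sum_le_sum fun x _ => ?_
    simp only [Finset.sum_ite_eq, Finset.mem_univ, if_true]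
    split_ifs
    exacts [le_rfl, hmX x]
  have hM : 0 < M := by
    rcases Nat.eq_zero_or_pos M with rfl | h
    · simp at hg; linarith
    · exact h
  have hM' : (0 : ℝ) < M := by exact_mod_cast hM
  -- Each of the three nonnegative penalties sums to at most γ/8 over the messages, and 3γ/8 < γ/2,
  -- so for some message `g m` exceeds all three at once. In the last one, `g m ≤ p m` allows
  -- cancelling `p m`, which leaves a bound on `a m`.
  obtain ⟨m, -, hm⟩ : ∃ m ∈ Finset.univ,
      γ / 8 * p m + γ / (8 * M) + γ / (8 * b) * (a m * p m) < g m := by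
    refine Finset.exists_lt_of_sum_lt (lt_of_lt_of_le ?_ hg)
    simp only [Finset.sum_add_distrib, ← Finset.mul_sum, Finset.sum_const, Finset.card_univ,
      Fintype.card_fin, nsmul_eq_mul]
    have h1 : γ / 8 * ∑ m, p m ≤ γ / 8 := mul_le_of_le_one_right (by positivity) hp1
    have h2 : (M : ℝ) * (γ / (8 * M)) = γ / 8 := by field_simp
    have h3 : γ / (8 * b) * ∑ m, a m * p m ≤ γ / 8 := by
      rcases hb0.eq_or_lt with h | h
      · rw [← h]; simp; positivity
      · refine (mul_le_mul_of_nonneg_left hap (by positivity)).trans (le_of_eq ?_)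
        field_simp
    linarith
  have t1 : 0 ≤ γ / 8 * p m := mul_nonneg (by positivity) (hp0 m)
  have t2 : 0 < γ / (8 * M) := by positivity
  have t3 : 0 ≤ γ / (8 * b) * (a m * p m) :=
    mul_nonneg (by positivity) (mul_nonneg (ha0 m) (hp0 m))
  have hpm : 0 < p m := lt_of_lt_of_le (by linarith) (hgp m)
  refine ⟨B m, S m, fun x hx => (Finset.mem_filter.1 hx).2.1, ?_, ?_, ?_, ?_⟩
  · change 0 < g m; linarith
  · change _ ≤ g m; linarith
  · change γ / 8 * p m ≤ g m; linarith
  · change a m ≤ _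
    have hD : 32 / γ ^ 2 * (cX * cY * β) = 8 * b / γ := by
      rw [hb]; field_simp; ring
    rw [hD]
    -- For b = 0 the last penalty is zero by the convention for division, and `a m` vanishes because
    -- `a m * p m ≤ 0` with `p m > 0`.
    rcases hb0.eq_or_lt with h | h
    · have h1 : a m * p m ≤ 0 := by
        rw [h]
        exact (Finset.single_le_sum (fun m _ => mul_nonneg (ha0 m) (hp0 m))
          (Finset.mem_univ m)).trans hap
      have : a m ≤ 0 := by
        by_contra h2
        exact absurd h1 (not_le.2 (mul_pos (not_le.1 h2) hpm))
      rw [← h]; simpa using this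
    · have h1 : γ / (8 * b) * a m * p m < 1 * p m := by
        have := hgp m
        rw [mul_assoc]; linarith
      have h2 := lt_of_mul_lt_mul_right h1 hpm.le
      rw [div_mul_eq_mul_div, div_lt_one (by positivity)] at h2
      rw [le_div_iff₀ hγ]; linarith

end Pigeonhole

/-- The log-likelihood ratio per letter of `P^{⊗n}` and `Q n` converges to `A` in probability. -/
def Concentrates {𝒳 : Type*} [MeasurableSpace 𝒳] (P : Measure 𝒳)
    (Q : (n : ℕ) → Measure (Fin n → 𝒳)) (A : ℝ) : Prop :=
  ∀ δ : ℝ, 0 < δ → Tendsto (fun n : ℕ => (iid P n).real {x | δ * n ≤ |logRatio P Q n x - n * A|})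
    atTop (𝓝 0)

/-! ### The strong converse -/

section Converse

variable {𝒳 𝒴 : Type*} [MeasurableSpace 𝒳] [MeasurableSpace 𝒴]

lemma real_le_of_logRatio_lt {P : Measure 𝒳} {Q : (n : ℕ) → Measure (Fin n → 𝒳)} {n : ℕ}
    [IsProbabilityMeasure P] (hac : iid P n ≪ Q n) [IsProbabilityMeasure (Q n)] {x : Fin n → 𝒳}
    {c : ℝ} (h : logRatio P Q n x ≤ c) :
    (iid P n).real {x} ≤ Real.exp c * (Q n).real {x} := by
  by_cases hp : (iid P n).real {x} = 0
  · rw [hp]; exact mul_nonneg (Real.exp_pos _).le measureReal_nonneg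
  have hq : (Q n).real {x} ≠ 0 := fun h => hp (by
    rw [measureReal_eq_zero_iff] at h ⊢; exact hac h)
  have hp' := measureReal_nonneg.lt_of_ne' hp
  have hq' := measureReal_nonneg.lt_of_ne' hq
  rw [logRatio, sub_le_iff_le_add, ← Real.log_exp c, ← Real.log_mul (Real.exp_pos _).ne' hq,
    Real.log_le_log_iff hp' (mul_pos (Real.exp_pos _) hq')] at h
  exact h

lemma real_le_of_lt_logRatio {P : Measure 𝒳} {Q : (n : ℕ) → Measure (Fin n → 𝒳)} {n : ℕ}
    [IsProbabilityMeasure P] (hac : iid P n ≪ Q n) [IsProbabilityMeasure (Q n)] {x : Fin n → 𝒳}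
    (hp : (iid P n).real {x} ≠ 0) {c : ℝ} (h : c ≤ logRatio P Q n x) :
    (Q n).real {x} ≤ Real.exp (-c) * (iid P n).real {x} := by
  have hq : (Q n).real {x} ≠ 0 := fun h => hp (by
    rw [measureReal_eq_zero_iff] at h ⊢; exact hac h)
  have hp' := measureReal_nonneg.lt_of_ne' hp
  have hq' := measureReal_nonneg.lt_of_ne' hq
  rw [← Real.log_le_log_iff hq' (mul_pos (Real.exp_pos _) hp'), Real.log_mul (Real.exp_pos _).ne' hp,
    Real.log_exp]
  rw [logRatio] at h
  linarith

variable [Fintype 𝒳] [MeasurableSingletonClass 𝒳] [Fintype 𝒴] [MeasurableSingletonClass 𝒴]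
  {P : Measure (𝒴 × 𝒳)} [IsProbabilityMeasure P] {R ε E AX AY : ℝ}
  {QY : (n : ℕ) → Measure (Fin n → 𝒴)} {QX : (n : ℕ) → Measure (Fin n → 𝒳)}

/-- A good scheme at a large block length yields a nearly feasible profile. -/
lemma exists_approx_feasible (hQY : ∀ n, IsProbabilityMeasure (QY n))
    (hQX : ∀ n, IsProbabilityMeasure (QX n)) (hacY : ∀ n, iid P.fst n ≪ QY n)
    (hacX : ∀ n, iid P.snd n ≪ QX n) (hY : Concentrates P.fst QY AY)
    (hX : Concentrates P.snd QX AX) (hε : ε < 1)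
    (hE : IsAchievable (iidPair P) (fun n => (QY n).prod (QX n)) R ε E) {δ : ℝ} (hδ : 0 < δ) :
    ∃ k ∈ profileSet 𝒳 𝒴, (∀ z, P.real {z} = 0 → k.1 z = 0) ∧
      (∀ x, |margSnd k.1 x - margSnd (fun z => P.real {z}) x| ≤ δ) ∧
      -∑ z, k.1 z * (Real.log (P.real {z}) - Real.log (margSnd (fun z => P.real {z}) z.2)) - δ
        ≤ k.2.2.2 - k.2.1 ∧
      -∑ z, k.1 z * Real.log (P.real {z}) - R - δ ≤ k.2.2.2 ∧
      k.2.2.1 ≤ -∑ z, k.1 z * Real.log (margFst (fun z => P.real {z}) z.1)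
        - (E - (AX + AY)) + δ := by
  classical
  set p : 𝒴 × 𝒳 → ℝ := fun z => P.real {z} with hp
  obtain ⟨z₀⟩ : Nonempty (𝒴 × 𝒳) := nonempty_of_isProbabilityMeasure P
  have : Nonempty 𝒴 := ⟨z₀.1⟩
  have : Nonempty 𝒳 := ⟨z₀.2⟩
  obtain ⟨s, hI, hII, hM⟩ := hE
  set η := δ / 8 with hη
  have hη0 : 0 < η := by positivity
  -- A lower bound for the acceptance probability under H_0. The cap 1/2 keeps 1 - γ positive, as
  -- comparison through `ENNReal.ofReal` requires.
  set γ := min ((1 - ε) / 2) (1 / 2) with hγ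
  have hγ0 : 0 < γ := lt_min (by linarith) one_half_pos
  have hγ1 : γ < 1 - ε := lt_of_le_of_lt (min_le_left _ _) (by linarith)
  have e1 : ∀ᶠ n in atTop, (s n).typeI (iidPair P n) < ENNReal.ofReal (1 - γ) := by
    refine eventually_lt_of_limsup_lt (lt_of_le_of_lt hI ?_)
    have : γ ≤ 1 / 2 := min_le_right _ _
    exact (ENNReal.ofReal_lt_ofReal_iff (by linarith)).2 (by linarith)
  have e2 : ∀ᶠ n : ℕ in atTop, ((E - η : ℝ) : EReal)
      < ENNReal.log ((s n).typeII ((QY n).prod (QX n)))⁻¹ / (n : EReal) := by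
    refine eventually_lt_of_lt_liminf (lt_of_lt_of_le ?_ hII)
    exact_mod_cast (by linarith : E - η < E)
  have e3 : ∀ᶠ n : ℕ in atTop, ((Real.log (s n).M / n : ℝ) : EReal) < ((R + η : ℝ) : EReal) := by
    refine eventually_lt_of_limsup_lt (lt_of_le_of_lt hM ?_)
    exact_mod_cast (by linarith : R < R + η)
  have e4 : ∀ᶠ n : ℕ in atTop, (iid P.fst n).real {x | η * n ≤ |logRatio P.fst QY n x - n * AY|}
      < γ / 8 := (hY η hη0).eventually_lt_const (by positivity)
  -- All atypicality events of x at once: `none` stands for the log-likelihood ratio, `some a` for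
  -- the frequency of the letter a.
  let bad : (n : ℕ) → Option 𝒳 → Set (Fin n → 𝒳) := fun n a => a.elim
    {x | η * n ≤ |logRatio P.snd QX n x - n * AX|} fun a =>
    {x | δ * n ≤ |∑ i, (if x i = a then (1 : ℝ) else 0) - n * ∫ b, (if b = a then (1 : ℝ) else 0) ∂P.snd|}
  have e5 : ∀ᶠ n : ℕ in atTop, ∑ a, (iid P.snd n).real (bad n a) < γ / 8 := by
    have : Tendsto (fun n => ∑ a, (iid P.snd n).real (bad n a)) atTop (𝓝 (∑ _a : Option 𝒳, 0)) := by
      refine tendsto_finsetSum _ fun a _ => ?_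
      cases a with
      | none => exact hX η hη0
      | some a => exact tendsto_letterSum P.snd (fun b => if b = a then (1 : ℝ) else 0) hδ
    rw [Finset.sum_const_zero] at this
    exact this.eventually_lt_const (by positivity)
  have e6 : ∀ᶠ n : ℕ in atTop, |Real.log (γ / 8)| + |Real.log (32 / γ ^ 2)| ≤ η * n :=
    (tendsto_natCast_atTop_atTop.const_mul_atTop hη0).eventually_ge_atTop _
  obtain ⟨n, hn, h1, h2, h3, h4, h5, h6⟩ :=
    ((eventually_gt_atTop 0).and (e1.and (e2.and (e3.and (e4.and (e5.and e6)))))).exists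
  have hn' : (0 : ℝ) < n := by exact_mod_cast hn
  set j : (Fin n → 𝒴) × (Fin n → 𝒳) → ℝ := fun w => (iidPair P n).real {w} with hj
  have hjX : ∀ x, margSnd j x = (iid P.snd n).real {x} := fun x => by
    rw [hj, margSnd_real, iidPair_snd]
  have hjY : ∀ x, margFst j x = (iid P.fst n).real {x} := fun x => by
    rw [hj, margFst_real, iidPair_fst]
  have hjw : ∀ w, j w = ∏ i, p (w.1 i, w.2 i) := iidPair_real_singleton P n
  have hjX' : ∀ x, margSnd j x = ∏ i, margSnd p (x i) := fun x => by
    rw [hjX, iid_real_singleton]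
    exact Finset.prod_congr rfl fun i _ => (margSnd_real P _).symm
  have hjY' : ∀ x, margFst j x = ∏ i, margFst p (x i) := fun x => by
    rw [hjY, iid_real_singleton]
    exact Finset.prod_congr rfl fun i _ => (margFst_real P _).symm
  set ψ : (Fin n → 𝒴) → Fin (s n).M → ℝ := fun y m => ((s n).ψ (y, m) 0).toReal with hψ
  have hψ01 : ∀ y m, ψ y m + ((s n).ψ (y, m) 1).toReal = 1 := fun y m => pmf_toReal_add _
  have hj1 := real_mem_stdSimplex (iidPair P n)
  have hacc : γ ≤ ∑ w, j w * ψ w.1 ((s n).φ w.2) := by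
    rw [TestingScheme.typeI, lintegral_observed, ENNReal.ofReal_lt_ofReal_iff_of_nonneg] at h1
    · have : ∑ w, j w * ψ w.1 ((s n).φ w.2)
          + ∑ w, j w * ((s n).ψ (w.1, (s n).φ w.2) 1).toReal = 1 := by
        rw [← Finset.sum_add_distrib]
        simp only [← mul_add, hψ01, mul_one]
        exact hj1.2
      linarith
    · exact Finset.sum_nonneg fun w _ => mul_nonneg measureReal_nonneg ENNReal.toReal_nonneg
  let TY : Finset (Fin n → 𝒴) :=
    Finset.univ.filter fun y => ¬ η * n ≤ |logRatio P.fst QY n y - n * AY|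
  let TX : Finset (Fin n → 𝒳) := Finset.univ.filter fun x => ∀ a, x ∉ bad n a
  set β := ∑ y, ∑ x, (QY n).real {y} * (QX n).real {x} * ψ y ((s n).φ x) with hβ
  have hβle : β ≤ Real.exp (-(n * (E - η))) := by
    have h := (le_log_inv_div_iff hn).1 h2.le
    rw [TestingScheme.typeII, lintegral_observed,
      ENNReal.ofReal_le_ofReal_iff (Real.exp_pos _).le, Fintype.sum_prod_type] at h
    refine le_trans (le_of_eq ?_) h
    refine Finset.sum_congr rfl fun y _ => Finset.sum_congr rfl fun x _ => ?_
    rw [← Set.singleton_prod_singleton, measureReal_prod_prod]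
  obtain ⟨B, S, hST, hG, hGM, hGS, hB⟩ := exists_good_message (j := j) hj1.1 hj1.2
    (qY := fun y => (QY n).real {y}) (qX := fun x => (QX n).real {x}) (fun _ => measureReal_nonneg)
    (fun _ => measureReal_nonneg) (s n).φ (ψ := ψ) (fun _ _ => ENNReal.toReal_nonneg)
    (fun y m => by linarith [hψ01 y m, (ENNReal.toReal_nonneg : 0 ≤ ((s n).ψ (y, m) 1).toReal)])
    TX TY hγ0 hacc
    (by
      refine le_trans ?_ h5.le
      have : ∀ a, (iid P.snd n).real (bad n a)
          = ∑ x, if x ∈ bad n a then (iid P.snd n).real {x} else 0 := fun a =>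
        measureReal_eq_sum _ _
      simp only [this]
      rw [Finset.sum_comm]
      refine Finset.sum_le_sum fun x _ => ?_
      have hnn : ∀ a ∈ Finset.univ, 0 ≤ if x ∈ bad n a then (iid P.snd n).real {x} else 0 :=
        fun a _ => by split_ifs; exacts [measureReal_nonneg, le_rfl]
      split_ifs with hx
      · exact Finset.sum_nonneg hnn
      · simp only [TX, Finset.mem_filter, Finset.mem_univ, true_and, not_forall, not_not] at hx
        obtain ⟨a, ha⟩ := hx
        refine le_trans (le_of_eq ?_) (Finset.single_le_sum hnn (Finset.mem_univ a))
        rw [if_pos ha, hjX])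
    (by
      refine le_trans (le_of_eq ?_) h4.le
      rw [measureReal_eq_sum]
      refine Finset.sum_congr rfl fun y _ => ?_
      simp only [TY, Finset.mem_filter, Finset.mem_univ, true_and, hjY, Set.mem_ofPred_eq, ite_not])
    (Real.exp_pos (n * (AX + η))).le (Real.exp_pos (n * (AY + η))).le
    (fun x hx => by
      rw [hjX]
      refine real_le_of_logRatio_lt (hacX n) ?_
      have := (Finset.mem_filter.1 hx).2 none
      change ¬ (η * n ≤ |logRatio P.snd QX n x - n * AX|) at this
      have := le_abs_self (logRatio P.snd QX n x - n * AX)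
      linarith)
    (fun y hy => by
      rw [hjY]
      refine real_le_of_logRatio_lt (hacY n) ?_
      have := (Finset.mem_filter.1 hy).2
      have := le_abs_self (logRatio P.fst QY n y - n * AY)
      linarith)
  simp only [hjw] at hG hGM hGS
  obtain ⟨k, hk, hsupp, hSpos, hBpos, hXY, hkX, hkY, hmarg⟩ :=
    exists_profile_of_product_set (p := p) (fun _ => measureReal_nonneg) hn B S hG
  rw [← hβ] at hB
  simp only [hjX'] at hGS
  simp only [hjY'] at hB
  set G := ∑ w ∈ B ×ˢ S, ∏ i, p (w.1 i, w.2 i)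
  set gX := ∑ x ∈ S, ∏ i, margSnd p (x i)
  set gY := ∑ y ∈ B, ∏ i, margFst p (y i)
  have hMpos : (0 : ℝ) < (s n).M := by
    obtain ⟨x⟩ : Nonempty (Fin n → 𝒳) := inferInstance
    exact_mod_cast ((s n).φ x).pos
  have l1 := neg_abs_le (Real.log (γ / 8))
  have l2 := le_abs_self (Real.log (32 / γ ^ 2))
  have l3 := abs_nonneg (Real.log (γ / 8))
  have l4 := abs_nonneg (Real.log (32 / γ ^ 2))
  refine ⟨k, hk, hsupp, ?_, ?_, ?_, ?_⟩
  · intro a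
    refine hmarg a δ fun x hx => ?_
    have := (Finset.mem_filter.1 (hST hx)).2 (some a)
    change ¬ (δ * n ≤ |∑ i, (if x i = a then (1 : ℝ) else 0)
      - n * ∫ b, (if b = a then (1 : ℝ) else 0) ∂P.snd|) at this
    have hsnd : ∫ b, (if b = a then (1 : ℝ) else 0) ∂P.snd = margSnd p a := by
      rw [integral_fintype .of_finite, margSnd_real]
      simp
    rw [hsnd, not_le] at this
    linarith
  -- A fixed fraction of the mass of `S` lies in `B ×ˢ S`; hence conditioning costs H(Y|X,U) only
  -- O(1/n), which is the approximate Markov condition.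
  · have h7 : Real.log (γ / 8) + Real.log gX ≤ Real.log G := by
      rw [← Real.log_mul (by positivity) hSpos.ne']
      exact Real.log_le_log (by positivity) hGS
    refine le_of_mul_le_mul_left ?_ hn'
    simp only [mul_sub, Finset.sum_sub_distrib] at hXY hkX ⊢
    have : η * n ≤ n * δ := by rw [hη]; nlinarith
    rw [hXY]
    linarith
  -- The mass of `B ×ˢ S` is at least of order 1/M, which is the rate constraint.
  · have h7 : Real.log (γ / 8) - Real.log (s n).M ≤ Real.log G := by
      rw [← Real.log_div (by positivity) hMpos.ne']
      refine Real.log_le_log (by positivity) (le_trans (le_of_eq ?_) hGM)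
      rw [div_div]
    have h8 : Real.log (s n).M < n * (R + η) := by
      have : Real.log (s n).M / n < R + η := by exact_mod_cast h3
      rw [div_lt_iff₀ hn'] at this
      linarith
    refine le_of_mul_le_mul_left ?_ hn'
    have : 2 * (η * n) ≤ n * δ := by rw [hη]; nlinarith
    rw [hXY]
    linarith
  -- The small mass of `B` yields the exponent. The loss is 4η: one each for the X and Y ratios, for
  -- the exponent and for the constants. Positivity of β comes from that of the mass of `B`.
  · have hβpos : 0 < β := by
      by_contra h
      have : 32 / γ ^ 2 * (Real.exp (n * (AX + η)) * Real.exp (n * (AY + η)) * β) ≤ 0 :=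
        mul_nonpos_of_nonneg_of_nonpos (by positivity)
          (mul_nonpos_of_nonneg_of_nonpos (by positivity) (not_lt.1 h))
      linarith
    have h7 : Real.log gY ≤ Real.log (32 / γ ^ 2) + (n * (AX + η) + n * (AY + η) + -(n * (E - η))) := by
      refine (Real.log_le_log hBpos hB).trans ?_
      rw [Real.log_mul (by positivity) (by positivity), Real.log_mul (by positivity) hβpos.ne',
        Real.log_mul (by positivity) (by positivity), Real.log_exp, Real.log_exp]
      have := Real.log_le_log hβpos hβle
      rw [Real.log_exp] at this
      linarith
    refine le_of_mul_le_mul_left ?_ hn'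
    have : 4 * (η * n) ≤ n * δ := by rw [hη]; nlinarith
    linarith

/-- The strong converse: an achievable exponent is bounded by a feasible profile. -/
lemma exists_feasible_of_isAchievable (hQY : ∀ n, IsProbabilityMeasure (QY n))
    (hQX : ∀ n, IsProbabilityMeasure (QX n)) (hacY : ∀ n, iid P.fst n ≪ QY n)
    (hacX : ∀ n, iid P.snd n ≪ QX n) (hY : Concentrates P.fst QY AY)
    (hX : Concentrates P.snd QX AX) (hε : ε < 1)
    (hE : IsAchievable (iidPair P) (fun n => (QY n).prod (QX n)) R ε E) :
    ∃ k ∈ feasibleSet (fun z => P.real {z}) R,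
      E - (AX + AY) ≤ homEntropy (margFst fun z => P.real {z}) - k.2.2.1 := by
  set p : 𝒴 × 𝒳 → ℝ := fun z => P.real {z} with hp
  have hp1 : p ∈ stdSimplex ℝ (𝒴 × 𝒳) := real_mem_stdSimplex P
  choose K hK hsupp hmarg hmarkov hrate hexp using fun i : ℕ =>
    exists_approx_feasible hQY hQX hacY hacX hY hX hε hE (Nat.one_div_pos_of_nat (α := ℝ) (n := i))
  obtain ⟨k, hk, f, hf, hlim⟩ := isCompact_profileSet.tendsto_subseq hK
  have hδ : Tendsto (fun i => 1 / ((f i : ℝ) + 1)) atTop (𝓝 0) :=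
    tendsto_one_div_add_atTop_nhds_zero_nat.comp hf.tendsto_atTop
  have hz : ∀ z, Tendsto (fun i => (K (f i)).1 z) atTop (𝓝 (k.1 z)) := fun z =>
    (((continuous_apply z).comp continuous_fst).tendsto k).comp hlim
  have hX' : Tendsto (fun i => (K (f i)).2.1) atTop (𝓝 k.2.1) :=
    ((continuous_fst.comp continuous_snd).tendsto k).comp hlim
  have hY' : Tendsto (fun i => (K (f i)).2.2.1) atTop (𝓝 k.2.2.1) :=
    ((continuous_fst.comp (continuous_snd.comp continuous_snd)).tendsto k).comp hlim
  have hXY' : Tendsto (fun i => (K (f i)).2.2.2) atTop (𝓝 k.2.2.2) :=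
    ((continuous_snd.comp (continuous_snd.comp continuous_snd)).tendsto k).comp hlim
  have hlin : ∀ c : 𝒴 × 𝒳 → ℝ, Tendsto (fun i => -∑ z, (K (f i)).1 z * c z) atTop
      (𝓝 (-∑ z, k.1 z * c z)) := fun c =>
    (tendsto_finsetSum _ fun z _ => (hz z).mul_const (c z)).neg
  have hkf : k ∈ feasibleSet p R := by
    refine ⟨hk, fun z h0 => ?_, fun x => ?_, ?_, ?_⟩
    · refine tendsto_nhds_unique (hz z) (tendsto_const_nhds.congr fun i => ?_)
      exact (hsupp (f i) z h0).symm
    · have h1 : Tendsto (fun i => |margSnd (K (f i)).1 x - margSnd p x|) atTop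
          (𝓝 |margSnd k.1 x - margSnd p x|) :=
        ((tendsto_finsetSum _ fun y _ => hz (y, x)).sub_const _).abs
      have h2 := le_of_tendsto_of_tendsto' h1 hδ fun i => hmarg (f i) x
      exact sub_eq_zero.1 (abs_nonpos_iff.1 h2)
    · have := le_of_tendsto_of_tendsto' ((hlin _).sub hδ) (hXY'.sub hX') fun i => hmarkov (f i)
      rwa [sub_zero] at this
    · have := le_of_tendsto_of_tendsto' (((hlin _).sub_const R).sub hδ) hXY' fun i => hrate (f i)
      rwa [sub_zero] at this
  refine ⟨k, hkf, ?_⟩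
  have h := le_of_tendsto_of_tendsto' hY' (((hlin _).sub_const (E - (AX + AY))).add hδ)
    fun i => hexp (f i)
  -- Only the X-marginal of the limit was known; the channel representation identifies its whole law
  -- with that of P, and the cross-entropy becomes H(Y).
  obtain ⟨m, w, hw, rfl⟩ := exists_channel_of_mem_feasibleSet hp1.1 hkf
  rw [channelProfile_fst hw, add_zero] at h
  rw [homEntropy_of_sum_eq_one ((sum_margFst p).trans hp1.2),
    sum_margFst_mul p fun y => Real.log (margFst p y)]
  linarith

end Converse

/-! ### Greedy covering -/

section Covering

variable {𝔛 𝔜 𝔘 : Type*} [Fintype 𝔛] [Fintype 𝔜] [Fintype 𝔘]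

open Classical in
/-- Greedy covering: if `θ V(·|x) ≤ P_U` on the relation `G`, then `N` codewords cover all but
a small part of the source words. -/
lemma exists_cover {PU : 𝔘 → ℝ} (hPU : PU ∈ stdSimplex ℝ 𝔘) {V : 𝔛 → 𝔘 → ℝ}
    (hV : ∀ x, V x ∈ stdSimplex ℝ 𝔘) {b : 𝔛 → ℝ} (hb : b ∈ stdSimplex ℝ 𝔛) {G : 𝔘 → 𝔛 → Prop}
    {θ : ℝ} (hθ0 : 0 ≤ θ) (hθ1 : θ ≤ 1) (hG : ∀ u x, G u x → θ * V x u ≤ PU u) (N : ℕ) :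
    ∃ c : Fin N → 𝔘, ∑ x, (if ∃ m, G (c m) x then 0 else b x) ≤
      ∑ x, ∑ u, (if G u x then 0 else b x * V x u) + (1 - θ) ^ N := by
  set κ := ∑ x, ∑ u, (if G u x then 0 else b x * V x u) with hκ
  have hκ0 : 0 ≤ κ := Finset.sum_nonneg fun x _ => Finset.sum_nonneg fun u _ => by
    split_ifs
    exacts [le_rfl, mul_nonneg (hb.1 x) ((hV x).1 u)]
  induction N with
  | zero =>
    refine ⟨Fin.elim0, ?_⟩
    simp [hb.2, hκ0]
  | succ N ih =>
    obtain ⟨c, hc⟩ := ih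
    let F : 𝔛 → ℝ := fun x => if ∃ m, G (c m) x then 0 else b x
    have hF : ∀ x, 0 ≤ F x := fun x => by dsimp only [F]; split_ifs; exacts [le_rfl, hb.1 x]
    have hFb : ∀ x, F x ≤ b x := fun x => by dsimp only [F]; split_ifs; exacts [hb.1 x, le_rfl]
    -- A codeword drawn from `PU` covers on average at least θ times the excess of the uncovered
    -- mass over κ; some codeword does as well as the average.
    have havg : ∑ u, PU u * (θ * (∑ x, F x - κ)) ≤ ∑ u, PU u * ∑ x, (if G u x then F x else 0) := by
      rw [← Finset.sum_mul, hPU.2, one_mul]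
      have h1 : ∑ x, F x - κ ≤ ∑ x, ∑ u, (if G u x then F x * V x u else 0) := by
        have h2 : ∑ x, F x = ∑ x, ∑ u, F x * V x u := by
          simp only [← Finset.mul_sum, (hV _).2, mul_one]
        rw [h2, hκ, ← Finset.sum_sub_distrib]
        refine Finset.sum_le_sum fun x _ => ?_
        rw [← Finset.sum_sub_distrib]
        refine Finset.sum_le_sum fun u _ => ?_
        split_ifs
        · simp
        · have := mul_le_mul_of_nonneg_right (hFb x) ((hV x).1 u)
          linarith
      refine (mul_le_mul_of_nonneg_left h1 hθ0).trans ?_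
      simp only [Finset.mul_sum]
      rw [Finset.sum_comm]
      refine Finset.sum_le_sum fun u _ => Finset.sum_le_sum fun x _ => ?_
      split_ifs with h
      · have := mul_le_mul_of_nonneg_left (hG u x h) (hF x)
        linarith
      · simp
    obtain ⟨u, hu⟩ : ∃ u, θ * (∑ x, F x - κ) ≤ ∑ x, (if G u x then F x else 0) := by
      by_contra! hcon
      obtain ⟨u, -, hu⟩ := Finset.exists_ne_zero_of_sum_ne_zero
        (by rw [hPU.2]; exact one_ne_zero : ∑ u, PU u ≠ 0)
      refine absurd havg (not_le.2 (Finset.sum_lt_sum (fun u _ =>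
        mul_le_mul_of_nonneg_left (hcon u).le (hPU.1 u)) ⟨u, Finset.mem_univ u, ?_⟩))
      exact mul_lt_mul_of_pos_left (hcon u) ((hPU.1 u).lt_of_ne' hu)
    refine ⟨Fin.cons u c, ?_⟩
    have hnew : ∑ x, (if ∃ m, G ((Fin.cons u c : Fin (N + 1) → 𝔘) m) x then 0 else b x)
        = ∑ x, F x - ∑ x, (if G u x then F x else 0) := by
      rw [← Finset.sum_sub_distrib]
      refine Finset.sum_congr rfl fun x _ => ?_
      simp only [Fin.exists_fin_succ, Fin.cons_zero, Fin.cons_succ, F]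
      by_cases h1 : G u x <;> by_cases h2 : ∃ m, G (c m) x <;> simp [h1, h2]
    rw [hnew, pow_succ]
    -- The excess over κ contracts by the factor 1 - θ with each new codeword.
    have h3 : (1 - θ) * (∑ x, F x - κ) ≤ (1 - θ) * (1 - θ) ^ N :=
      mul_le_mul_of_nonneg_left (by linarith) (by linarith)
    linarith

open Classical in
/-- A covering code whose decision regions are hit with high probability. -/
lemma exists_code {PU : 𝔘 → ℝ} (hPU : PU ∈ stdSimplex ℝ 𝔘) {V : 𝔛 → 𝔘 → ℝ}
    (hV : ∀ x, V x ∈ stdSimplex ℝ 𝔘) {j : 𝔜 × 𝔛 → ℝ} (hj : j ∈ stdSimplex ℝ (𝔜 × 𝔛))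
    (D : 𝔘 → 𝔜 → Prop) {θ ζ : ℝ} (hθ0 : 0 ≤ θ) (hθ1 : θ ≤ 1) (hζ : 0 < ζ) {N : ℕ} (hN : 0 < N) :
    ∃ (c : Fin N → 𝔘) (e : 𝔛 → Fin N),
      ∑ w : 𝔜 × 𝔛, (if D (c (e w.2)) w.1 then 0 else j w) ≤
        ζ + ∑ w : 𝔜 × 𝔛, ∑ u, (if PU u < θ * V w.2 u then j w * V w.2 u else 0)
          + (∑ w : 𝔜 × 𝔛, ∑ u, (if D u w.1 then 0 else j w * V w.2 u)) / ζ
          + Real.exp (-(θ * N)) := by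
  have hb : margSnd j ∈ stdSimplex ℝ 𝔛 :=
    ⟨fun x => Finset.sum_nonneg fun _ _ => hj.1 _, (sum_margSnd j).trans hj.2⟩
  let miss : 𝔘 → 𝔛 → ℝ := fun u x => ∑ y, if D u y then 0 else j (y, x)
  have hmiss : ∀ u x, 0 ≤ miss u x := fun u x => Finset.sum_nonneg fun y _ => by
    split_ifs; exacts [le_rfl, hj.1 _]
  -- A codeword serves x if V(u|x) is at most `PU u` / θ, as the covering needs, and if its region
  -- misses y with conditional probability at most ζ given x, so that covering x already controls
  -- the decision.
  obtain ⟨G, hG⟩ : ∃ G : 𝔘 → 𝔛 → Prop,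
      ∀ u x, G u x ↔ θ * V x u ≤ PU u ∧ miss u x ≤ ζ * margSnd j x := ⟨_, fun _ _ => Iff.rfl⟩
  obtain ⟨c, hc⟩ := exists_cover hPU hV hb (G := G) hθ0 hθ1 (fun u x h => ((hG u x).1 h).1) N
  let e : 𝔛 → Fin N := fun x => if h : ∃ m, G (c m) x then h.choose else ⟨0, hN⟩
  refine ⟨c, e, ?_⟩
  have hpow : (1 - θ) ^ N ≤ Real.exp (-(θ * N)) := by
    have h1 : 1 - θ ≤ Real.exp (-θ) := by linarith [Real.add_one_le_exp (-θ)]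
    refine (pow_le_pow_left₀ (by linarith) h1 N).trans (le_of_eq ?_)
    rw [← Real.exp_nat_mul]
    congr 1; ring
  have herr : ∑ w : 𝔜 × 𝔛, (if D (c (e w.2)) w.1 then 0 else j w)
      ≤ ζ + ∑ x, (if ∃ m, G (c m) x then 0 else margSnd j x) := by
    have hz : ζ = ∑ x, ζ * margSnd j x := by rw [← Finset.mul_sum, hb.2, mul_one]
    rw [hz, ← Finset.sum_add_distrib, Fintype.sum_prod_type_right]
    refine Finset.sum_le_sum fun x _ => ?_
    split_ifs with h
    · have he : e x = h.choose := dif_pos h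
      have := ((hG _ _).1 h.choose_spec).2
      rw [← he] at this
      simpa [miss] using this
    · have h1 : ∑ y, (if D (c (e x)) y then 0 else j (y, x)) ≤ margSnd j x :=
        Finset.sum_le_sum fun y _ => by split_ifs; exacts [hj.1 _, le_rfl]
      have h2 : 0 ≤ ζ * margSnd j x := mul_nonneg hζ.le (hb.1 x)
      linarith
  -- Pairs failing the second requirement are counted by Markov's inequality at level ζ.
  have hκ : ∑ x, ∑ u, (if G u x then 0 else margSnd j x * V x u)
      ≤ ∑ w : 𝔜 × 𝔛, ∑ u, (if PU u < θ * V w.2 u then j w * V w.2 u else 0)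
        + (∑ w : 𝔜 × 𝔛, ∑ u, (if D u w.1 then 0 else j w * V w.2 u)) / ζ := by
    have h1 : ∑ w : 𝔜 × 𝔛, ∑ u, (if PU u < θ * V w.2 u then j w * V w.2 u else 0)
        = ∑ x, ∑ u, (if PU u < θ * V x u then margSnd j x * V x u else 0) := by
      rw [Fintype.sum_prod_type_right]
      refine Finset.sum_congr rfl fun x _ => ?_
      rw [Finset.sum_comm]
      refine Finset.sum_congr rfl fun u _ => ?_
      split_ifs
      · rw [margSnd, Finset.sum_mul]
      · simp
    have h2 : ∑ w : 𝔜 × 𝔛, ∑ u, (if D u w.1 then 0 else j w * V w.2 u)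
        = ∑ x, ∑ u, miss u x * V x u := by
      rw [Fintype.sum_prod_type_right]
      refine Finset.sum_congr rfl fun x _ => ?_
      rw [Finset.sum_comm]
      refine Finset.sum_congr rfl fun u _ => ?_
      simp only [miss, Finset.sum_mul, ite_mul, zero_mul]
    rw [h1, h2, Finset.sum_div, ← Finset.sum_add_distrib]
    refine Finset.sum_le_sum fun x _ => ?_
    rw [Finset.sum_div, ← Finset.sum_add_distrib]
    refine Finset.sum_le_sum fun u _ => ?_
    have hVu := (hV x).1 u
    have hnn : 0 ≤ margSnd j x * V x u := mul_nonneg (hb.1 x) hVu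
    have hnn2 : 0 ≤ miss u x * V x u / ζ := div_nonneg (mul_nonneg (hmiss u x) hVu) hζ.le
    by_cases hg : G u x
    · rw [if_pos hg]
      refine add_nonneg ?_ hnn2
      split_ifs
      exacts [hnn, le_rfl]
    · rw [if_neg hg]
      by_cases h3 : PU u < θ * V x u
      · rw [if_pos h3]; linarith
      · rw [if_neg h3, zero_add, le_div_iff₀ hζ]
        have h4 : ζ * margSnd j x < miss u x := by
          by_contra h4
          exact hg ((hG u x).2 ⟨not_lt.1 h3, not_lt.1 h4⟩)
        have := mul_le_mul_of_nonneg_right h4.le hVu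
        linarith
  linarith

end Covering

/-! ### Codes from a channel -/

section Codes

variable {𝒳 𝒴 : Type*} [Fintype 𝒳] [MeasurableSpace 𝒳] [MeasurableSingletonClass 𝒳]
  [Fintype 𝒴] [MeasurableSpace 𝒴] [MeasurableSingletonClass 𝒴]

/-- The expected information density is a mutual information, here in the form H(A) - H(A|U). -/
lemma sum_mul_log_sub_eq {α : Type*} [Fintype α] {κ : Type*} [Fintype κ] {q : α → ℝ}
    {r : κ → α → ℝ} (hr : ∀ u a, 0 ≤ r u a) (hrq : ∀ a, ∑ u, r u a = q a) (hq : ∑ a, q a = 1) :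
    ∑ u, ∑ a, r u a * (Real.log (r u a / ∑ b, r u b) - Real.log (q a))
      = homEntropy q - ∑ u, homEntropy (r u) := by
  simp only [mul_sub, Finset.sum_sub_distrib, homEntropy_eq_neg_sum_mul_log (hr _),
    homEntropy_of_sum_eq_one hq, Finset.sum_neg_distrib]
  rw [Finset.sum_comm (f := fun u a => r u a * Real.log (q a))]
  simp only [← Finset.sum_mul, hrq]
  ring

-- Turns the sums in the covering bound into probabilities under the memoryless law of (Y,X,U), to
-- which the law of large numbers applies.
open Classical in
lemma sum_words_eq_real (P : Measure (𝒴 × 𝒳)) [IsProbabilityMeasure P] {m : ℕ}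
    (W : Kernel 𝒳 (Fin m)) [IsMarkovKernel W] (n : ℕ)
    (T : (Fin n → 𝒴) × (Fin n → 𝒳) → (Fin n → Fin m) → Prop) :
    ∑ v, ∑ u, (if T v u then (∏ i, P.real {(v.1 i, v.2 i)}) * ∏ i, (W (v.2 i)).real {u i} else 0)
      = (Measure.pi fun _ : Fin n => lawYXU P W).real
        {ω | T (fun i => (ω i).1.1, fun i => (ω i).1.2) fun i => (ω i).2} := by
  have hprob : IsProbabilityMeasure (lawYXU P W) := by unfold lawYXU; infer_instance
  let e : (Fin n → (𝒴 × 𝒳) × Fin m) ≃ ((Fin n → 𝒴) × (Fin n → 𝒳)) × (Fin n → Fin m) :=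
    (Equiv.arrowProdEquivProdArrow _ _ _).trans
      ((Equiv.arrowProdEquivProdArrow _ _ _).prodCongr (Equiv.refl _))
  rw [measureReal_eq_sum, ← Fintype.sum_prod_type', ← e.sum_comp]
  refine Finset.sum_congr rfl fun ω _ => ?_
  have h1 : (Measure.pi fun _ : Fin n => lawYXU P W).real {ω}
      = (∏ i, P.real {((ω i).1.1, (ω i).1.2)}) * ∏ i, (W (ω i).1.2).real {(ω i).2} := by
    rw [← Finset.prod_mul_distrib]
    refine (iid_real_singleton (lawYXU P W) n ω).trans ?_
    exact Finset.prod_congr rfl fun i _ => lawYXU_real P W (ω i)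
  rw [h1]
  rfl

open Classical in
/-- Covering codes of rate `r` for a channel with `I(U;X) < r`. -/
lemma exists_codes (P : Measure (𝒴 × 𝒳)) [IsProbabilityMeasure P] {m : ℕ} {w : 𝒳 → Fin m → ℝ}
    (hw : ∀ x, w x ∈ stdSimplex ℝ (Fin m)) {r J : ℝ}
    (hr : homEntropy (margSnd fun z => P.real {z})
      - (channelProfile (fun z => P.real {z}) w).2.1 < r)
    (hJ : J < homEntropy (margFst fun z => P.real {z})
      - (channelProfile (fun z => P.real {z}) w).2.2.1) :
    ∃ (N : ℕ → ℕ) (e : ∀ n, (Fin n → 𝒳) → Fin (N n)) (D : ∀ n, Fin (N n) → (Fin n → 𝒴) → Prop),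
      Tendsto (fun n => ∑ v : (Fin n → 𝒴) × (Fin n → 𝒳),
        if D n (e n v.2) v.1 then 0 else ∏ i, P.real {(v.1 i, v.2 i)}) atTop (𝓝 0) ∧
      (∀ n a, ∑ y, (if D n a y then ∏ i, margFst (fun z => P.real {z}) (y i) else 0)
        ≤ Real.exp (-(n * J))) ∧
      ∀ n, (N n : ℝ) ≤ Real.exp (n * r) + 1 := by
  set p : 𝒴 × 𝒳 → ℝ := fun z => P.real {z} with hp
  have hp1 : p ∈ stdSimplex ℝ (𝒴 × 𝒳) := real_mem_stdSimplex P
  set I := homEntropy (margSnd p) - (channelProfile p w).2.1 with hI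
  set J₀ := homEntropy (margFst p) - (channelProfile p w).2.2.1 with hJ₀
  obtain ⟨W, hW, hWw⟩ := exists_kernel hw
  have hprob : IsProbabilityMeasure (lawYXU P W) := by unfold lawYXU; infer_instance
  set c : Fin m → 𝒴 × 𝒳 → ℝ := channelWeight p w with hc
  have hc0 : ∀ u z, 0 ≤ c u z := fun u z => mul_nonneg (hp1.1 z) ((hw z.2).1 u)
  set pU : Fin m → ℝ := fun u => ∑ z, c u z with hpU
  have hcsum : ∀ z, ∑ u, c u z = p z := fun z => by
    simp only [hc, channelWeight, ← Finset.mul_sum, (hw z.2).2, mul_one]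
  have hpU1 : pU ∈ stdSimplex ℝ (Fin m) := by
    refine ⟨fun u => Finset.sum_nonneg fun z _ => hc0 u z, ?_⟩
    simp only [hpU]
    rw [Finset.sum_comm]
    simp only [hcsum, hp1.2]
  have hlaw : ∀ z u, (lawYXU P W).real {(z, u)} = c u z := fun z u => by
    rw [lawYXU_real, hWw]; rfl
  have hcX : ∀ u x, margSnd (c u) x = margSnd p x * w x u := fun u x => by
    simp only [margSnd, hc, channelWeight, Finset.sum_mul]
  let fX : (𝒴 × 𝒳) × Fin m → ℝ := fun t =>
    Real.log (margSnd (c t.2) t.1.2 / pU t.2) - Real.log (margSnd p t.1.2)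
  let fY : (𝒴 × 𝒳) × Fin m → ℝ := fun t =>
    Real.log (margFst (c t.2) t.1.1 / pU t.2) - Real.log (margFst p t.1.1)
  have hEX : ∫ t, fX t ∂lawYXU P W = I := by
    rw [integral_fintype .of_finite, Fintype.sum_prod_type_right]
    simp only [hlaw, smul_eq_mul, fX]
    have h1 := sum_mul_log_sub_eq (q := margSnd p) (r := fun u => margSnd (c u))
      (fun u x => Finset.sum_nonneg fun y _ => hc0 u (y, x))
      (fun x => by simp only [margSnd]; rw [Finset.sum_comm]; simp only [hcsum])
      ((sum_margSnd p).trans hp1.2)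
    simp only [sum_margSnd] at h1
    have h2 : I = homEntropy (margSnd p) - ∑ u, homEntropy (margSnd (c u)) := by
      simp only [hI, channelProfile, profile, Prod.snd_sum, Prod.fst_sum, hc]
    rw [h2, ← h1]
    refine Finset.sum_congr rfl fun u _ => ?_
    exact (sum_margSnd_mul (c u) fun x => Real.log (margSnd (c u) x / pU u)
      - Real.log (margSnd p x)).symm
  have hEY : ∫ t, fY t ∂lawYXU P W = J₀ := by
    rw [integral_fintype .of_finite, Fintype.sum_prod_type_right]
    simp only [hlaw, smul_eq_mul, fY]
    have h1 := sum_mul_log_sub_eq (q := margFst p) (r := fun u => margFst (c u))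
      (fun u y => Finset.sum_nonneg fun x _ => hc0 u (y, x))
      (fun x => by simp only [margFst]; rw [Finset.sum_comm]; simp only [hcsum])
      ((sum_margFst p).trans hp1.2)
    simp only [sum_margFst] at h1
    have h2 : J₀ = homEntropy (margFst p) - ∑ u, homEntropy (margFst (c u)) := by
      simp only [hJ₀, channelProfile, profile, Prod.snd_sum, Prod.fst_sum, hc]
    rw [h2, ← h1]
    refine Finset.sum_congr rfl fun u _ => ?_
    exact (sum_margFst_mul (c u) fun x => Real.log (margFst (c u) x / pU u)
      - Real.log (margFst p x)).symm
  have hI0 : 0 ≤ I := by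
    have h1 := sum_homEntropy_le Finset.univ (r := fun u => margSnd (c u))
      fun u x => Finset.sum_nonneg fun y _ => hc0 u (y, x)
    have h2 : ∑ u, margSnd (c u) = margSnd p := by
      ext x
      simp only [Finset.sum_apply, margSnd]
      rw [Finset.sum_comm]
      simp only [hcsum]
    rw [h2] at h1
    simp only [hI, channelProfile, profile, Prod.snd_sum, Prod.fst_sum, sub_nonneg]
    exact h1
  -- One η is spent on the typicality of the density of (X,U), a second one lets θN grow
  -- exponentially; on the Y side a single one suffices.
  obtain ⟨η, hη0, hηr, hηJ⟩ : ∃ η, 0 < η ∧ 2 * η ≤ r - I ∧ η ≤ J₀ - J :=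
    ⟨min ((r - I) / 2) (J₀ - J), lt_min (by linarith) (by linarith),
      by linarith [min_le_left ((r - I) / 2) (J₀ - J)], min_le_right _ _⟩
  obtain ⟨D, hD⟩ : ∃ D : ∀ n, (Fin n → Fin m) → (Fin n → 𝒴) → Prop, ∀ n u y, D n u y ↔
    (∀ i, margFst (c (u i)) (y i) ≠ 0) ∧ n * (J₀ - η) ≤
      ∑ i, (Real.log (margFst (c (u i)) (y i) / pU (u i)) - Real.log (margFst p (y i))) :=
    ⟨_, fun _ _ _ => Iff.rfl⟩
  let PU : ∀ n, (Fin n → Fin m) → ℝ := fun n u => ∏ i, pU (u i)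
  let V : ∀ n, (Fin n → 𝒳) → (Fin n → Fin m) → ℝ := fun n x u => ∏ i, w (x i) (u i)
  let j : ∀ n, (Fin n → 𝒴) × (Fin n → 𝒳) → ℝ := fun n v => ∏ i, p (v.1 i, v.2 i)
  have hsimplex : ∀ {n : ℕ} {f : Fin n → Fin m → ℝ}, (∀ i, f i ∈ stdSimplex ℝ (Fin m)) →
      (fun u : Fin n → Fin m => ∏ i, f i (u i)) ∈ stdSimplex ℝ (Fin n → Fin m) := by
    intro n f hf
    refine ⟨fun u => Finset.prod_nonneg fun i _ => (hf i).1 _, ?_⟩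
    have := Finset.prod_univ_sum (fun _ : Fin n => (Finset.univ : Finset (Fin m))) fun i a => f i a
    rw [Fintype.piFinset_univ] at this
    rw [← this]
    exact Finset.prod_eq_one fun i _ => (hf i).2
  have hj1 : ∀ n, j n ∈ stdSimplex ℝ _ := fun n => by
    have h := real_mem_stdSimplex (iidPair P n)
    simp only [iidPair_real_singleton] at h
    exact h
  let θ : ℕ → ℝ := fun n => Real.exp (-(n * (I + η)))
  let κ₁ : ℕ → ℝ := fun n => ∑ v, ∑ u, if PU n u < θ n * V n v.2 u then j n v * V n v.2 u else 0
  let κ₂ : ℕ → ℝ := fun n => ∑ v, ∑ u, if D n u v.1 then 0 else j n v * V n v.2 u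
  have hsupp : ∀ (n : ℕ), ∀ᵐ ω ∂(Measure.pi fun _ : Fin n => lawYXU P W),
      ∀ i, c (ω i).2 (ω i).1 ≠ 0 := fun n => by
    filter_upwards [ae_real_singleton_ne_zero (Measure.pi fun _ : Fin n => lawYXU P W)] with ω hω i
    have h := iid_real_singleton (lawYXU P W) n ω
    rw [iid] at h
    rw [h, Finset.prod_ne_zero_iff] at hω
    rw [← hlaw]
    exact hω i (Finset.mem_univ i)
  have hκ₁ : Tendsto κ₁ atTop (𝓝 0) := by
    have h := tendsto_letterSum (lawYXU P W) fX hη0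
    rw [hEX] at h
    refine squeeze_zero (fun n => ?_) (fun n => ?_) h
    · exact Finset.sum_nonneg fun v _ => Finset.sum_nonneg fun u _ => by
        split_ifs
        exacts [mul_nonneg ((hj1 n).1 v) (Finset.prod_nonneg fun i _ => (hw _).1 _), le_rfl]
    · have h2 := sum_words_eq_real P W n fun v u => PU n u < θ n * V n v.2 u
      simp only [hWw] at h2
      refine (le_of_eq h2).trans (ENNReal.toReal_mono (measure_ne_top _ _) (measure_mono_ae ?_))
      filter_upwards [hsupp n] with ω hω hlt
      change PU n (fun i => (ω i).2) < θ n * V n (fun i => (ω i).1.2) (fun i => (ω i).2) at hlt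
      change η * n ≤ |∑ i, fX (ω i) - n * I|
      have hw0 : ∀ i, w (ω i).1.2 (ω i).2 ≠ 0 := fun i h0 => hω i (by
        simp only [hc, channelWeight, h0, mul_zero])
      have hpX0 : ∀ i, margSnd p (ω i).1.2 ≠ 0 := fun i => margSnd_ne_zero hp1.1
        (a := (ω i).1.1) fun h0 => hω i (by simp only [hc, channelWeight, h0, zero_mul])
      have hpU0 : ∀ i, pU (ω i).2 ≠ 0 := fun i h0 => hω i
        ((Finset.sum_eq_zero_iff_of_nonneg fun z _ => hc0 _ z).1 h0 _ (Finset.mem_univ _))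
      have hfX : ∀ i, fX (ω i) = Real.log (w (ω i).1.2 (ω i).2) - Real.log (pU (ω i).2) := fun i => by
        simp only [fX, hcX]
        rw [Real.log_div (mul_ne_zero (hpX0 i) (hw0 i)) (hpU0 i), Real.log_mul (hpX0 i) (hw0 i)]
        ring
      have hV0 : V n (fun i => (ω i).1.2) (fun i => (ω i).2) ≠ 0 :=
        Finset.prod_ne_zero_iff.2 fun i _ => hw0 i
      have hPU0 : 0 < PU n (fun i => (ω i).2) :=
        Finset.prod_pos fun i _ => (hpU1.1 _).lt_of_ne' (hpU0 i)
      have hlog := Real.log_lt_log hPU0 hlt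
      rw [Real.log_mul (Real.exp_pos _).ne' hV0, Real.log_exp,
        Real.log_prod fun i _ => hw0 i, Real.log_prod fun i _ => hpU0 i] at hlog
      simp only [hfX, Finset.sum_sub_distrib]
      refine le_trans ?_ (le_abs_self _)
      linarith
  have hκ₂0 : ∀ n, 0 ≤ κ₂ n := fun n =>
    Finset.sum_nonneg fun v _ => Finset.sum_nonneg fun u _ => by
        split_ifs
        exacts [le_rfl, mul_nonneg ((hj1 n).1 v) (Finset.prod_nonneg fun i _ => (hw _).1 _)]
  have hκ₂ : Tendsto κ₂ atTop (𝓝 0) := by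
    have h := tendsto_letterSum (lawYXU P W) fY hη0
    rw [hEY] at h
    refine squeeze_zero hκ₂0 (fun n => ?_) h
    have h2 := sum_words_eq_real P W n fun v u => ¬ D n u v.1
    simp only [hWw, ite_not] at h2
    refine (le_of_eq h2).trans (ENNReal.toReal_mono (measure_ne_top _ _) (measure_mono_ae ?_))
    filter_upwards [hsupp n] with ω hω hlt
    change ¬ D n (fun i => (ω i).2) (fun i => (ω i).1.1) at hlt
    change η * n ≤ |∑ i, fY (ω i) - n * J₀|
    have h3 : ∑ i, fY (ω i) < n * (J₀ - η) := by
      by_contra h4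
      exact hlt ((hD _ _ _).2
        ⟨fun i => margFst_ne_zero (hc0 _) (b := (ω i).1.2) (hω i), not_lt.1 h4⟩)
    refine le_trans ?_ (neg_le_abs _)
    linarith
  -- With the square root, both ζ and κ₂/ζ tend to 0; the summand 1/(n+1) keeps ζ positive when κ₂
  -- vanishes.
  let ζ : ℕ → ℝ := fun n => Real.sqrt (κ₂ n) + 1 / ((n : ℝ) + 1)
  have hζ0 : ∀ n, 0 < ζ n := fun n => add_pos_of_nonneg_of_pos (Real.sqrt_nonneg _) (by positivity)
  let N : ℕ → ℕ := fun n => ⌈Real.exp (n * r)⌉₊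
  have hN : ∀ n, 0 < N n := fun n => Nat.ceil_pos.2 (Real.exp_pos _)
  choose cb e he using fun n => exists_code (hsimplex fun _ : Fin n => hpU1)
    (V := V n) (fun x => hsimplex fun i => hw (x i)) (hj1 n) (D n) (θ := θ n) (Real.exp_pos _).le
    (Real.exp_le_one_iff.2 (neg_nonpos.2 (by positivity))) (hζ0 n) (hN n)
  refine ⟨N, e, fun n a => D n (cb n a), ?_, ?_, ?_⟩
  · have hlim : Tendsto (fun n : ℕ => ζ n + κ₁ n + Real.sqrt (κ₂ n) + Real.exp (-(η * n))) atTop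
        (𝓝 (0 + 0 + 0 + 0)) := by
      have hs : Tendsto (fun n => Real.sqrt (κ₂ n)) atTop (𝓝 0) := by
        have h := (Real.continuous_sqrt.tendsto 0).comp hκ₂
        rwa [Real.sqrt_zero] at h
      have hz : Tendsto ζ atTop (𝓝 0) := by
        have h := hs.add (tendsto_one_div_add_atTop_nhds_zero_nat (𝕜 := ℝ))
        rwa [add_zero] at h
      refine ((hz.add hκ₁).add hs).add (Real.tendsto_exp_neg_atTop_nhds_zero.comp ?_)
      exact tendsto_natCast_atTop_atTop.const_mul_atTop hη0
    simp only [add_zero] at hlim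
    refine squeeze_zero (fun n => ?_) (fun n => ?_) hlim
    · exact Finset.sum_nonneg fun v _ => by split_ifs; exacts [le_rfl, (hj1 n).1 v]
    · refine (he n).trans ?_
      have h1 : κ₂ n / ζ n ≤ Real.sqrt (κ₂ n) := by
        rw [div_le_iff₀ (hζ0 n)]
        have h2 : (0 : ℝ) < 1 / ((n : ℝ) + 1) := by positivity
        have h3 := Real.mul_self_sqrt (hκ₂0 n)
        have h4 := mul_nonneg (Real.sqrt_nonneg (κ₂ n)) h2.le
        simp only [ζ, mul_add]
        linarith
      have h5 : Real.exp (-(θ n * N n)) ≤ Real.exp (-(η * n)) := by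
        rw [Real.exp_le_exp, neg_le_neg_iff]
        have h6 : θ n * Real.exp (n * r) ≤ θ n * N n :=
          mul_le_mul_of_nonneg_left (Nat.le_ceil _) (Real.exp_pos _).le
        refine le_trans ?_ h6
        simp only [θ]
        rw [← Real.exp_add]
        have h7 : η * n ≤ -(n * (I + η)) + n * r := by
          have := mul_le_mul_of_nonneg_left hηr (Nat.cast_nonneg (α := ℝ) n)
          linarith
        linarith [Real.add_one_le_exp (-(n * (I + η)) + n * r)]
      exact add_le_add (add_le_add le_rfl h1) h5
  · intro n a
    set u := cb n a
    have hpY : ∀ y, 0 ≤ margFst p y := fun y => Finset.sum_nonneg fun _ _ => hp1.1 _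
    have hcY : ∀ u y, 0 ≤ margFst (c u) y := fun u y => Finset.sum_nonneg fun _ _ => hc0 _ _
    -- Inside the region P_Y(y) is at most exp(-nJ) times the conditional probability of y given the
    -- codeword, and the latter sums to 1, or to 0 at a codeword of probability zero.
    calc _ ≤ ∑ y : Fin n → 𝒴, Real.exp (-(n * J)) * ∏ i, (margFst (c (u i)) (y i) / pU (u i)) := by
          refine Finset.sum_le_sum fun y _ => ?_
          have hnn : 0 ≤ ∏ i, (margFst (c (u i)) (y i) / pU (u i)) :=
            Finset.prod_nonneg fun i _ => div_nonneg (hcY _ _) (hpU1.1 _)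
          split_ifs with h
          · obtain ⟨h1, h2⟩ := (hD _ _ _).1 h
            have h3 : ∀ i, margFst p (y i) ≠ 0 := fun i h0 => h1 i (by
              refine Finset.sum_eq_zero fun x _ => ?_
              have := (Finset.sum_eq_zero_iff_of_nonneg fun x _ => hp1.1 (y i, x)).1 h0 x
                (Finset.mem_univ x)
              simp only [hc, channelWeight, this, zero_mul])
            have h4 : ∀ i, pU (u i) ≠ 0 := fun i h0 => h1 i (by
              refine Finset.sum_eq_zero fun x _ => ?_
              exact (Finset.sum_eq_zero_iff_of_nonneg fun z _ => hc0 _ z).1 h0 _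
                (Finset.mem_univ _))
            have h5 : ∀ i, margFst (c (u i)) (y i) / pU (u i) ≠ 0 := fun i => div_ne_zero (h1 i) (h4 i)
            rw [← Real.log_le_log_iff
              (Finset.prod_pos fun i _ => (hpY _).lt_of_ne' (h3 i))
              (mul_pos (Real.exp_pos _) (hnn.lt_of_ne' (Finset.prod_ne_zero_iff.2 fun i _ => h5 i))),
              Real.log_mul (Real.exp_pos _).ne' (Finset.prod_ne_zero_iff.2 fun i _ => h5 i),
              Real.log_exp, Real.log_prod fun i _ => h3 i, Real.log_prod fun i _ => h5 i]
            rw [Finset.sum_sub_distrib] at h2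
            have := mul_le_mul_of_nonneg_left hηJ (Nat.cast_nonneg (α := ℝ) n)
            linarith
          · exact mul_nonneg (Real.exp_pos _).le hnn
      _ = Real.exp (-(n * J)) * ∏ i, ∑ y, margFst (c (u i)) y / pU (u i) := by
          rw [← Finset.mul_sum]
          congr 1
          have := Finset.prod_univ_sum (fun _ : Fin n => (Finset.univ : Finset 𝒴))
            fun i a => margFst (c (u i)) a / pU (u i)
          rw [Fintype.piFinset_univ] at this
          exact this.symm
      _ ≤ Real.exp (-(n * J)) := by
          refine mul_le_of_le_one_right (Real.exp_pos _).le (Finset.prod_le_one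
            (fun i _ => Finset.sum_nonneg fun y _ => div_nonneg (hcY _ _) (hpU1.1 _)) fun i _ => ?_)
          rw [← Finset.sum_div, sum_margFst]
          exact div_self_le_one _
  · intro n
    exact (Nat.ceil_lt_add_one (Real.exp_pos _).le).le

end Codes

/-! ### Achievability -/

section Achievability

variable {𝒳 𝒴 : Type*}

open Classical in
/-- The scheme that sends the index of a codeword, or a failure message off the typical set `TX`,
and accepts on the decision regions `D` restricted to the typical set `TY`. -/
noncomputable def codeScheme {n N : ℕ} (e : (Fin n → 𝒳) → Fin N) (D : Fin N → (Fin n → 𝒴) → Prop)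
    (TX : (Fin n → 𝒳) → Prop) (TY : (Fin n → 𝒴) → Prop) : TestingScheme 𝒳 𝒴 n where
  M := N + 1
  φ x := (finSuccEquiv N).symm (if TX x then some (e x) else none)
  ψ z := PMF.pure (if ∃ m, finSuccEquiv N z.2 = some m ∧ D m z.1 ∧ TY z.1 then 0 else 1)

open Classical in
lemma codeScheme_ψ {n N : ℕ} (e : (Fin n → 𝒳) → Fin N) (D : Fin N → (Fin n → 𝒴) → Prop)
    (TX : (Fin n → 𝒳) → Prop) (TY : (Fin n → 𝒴) → Prop) (y : Fin n → 𝒴) (x : Fin n → 𝒳) :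
    ((codeScheme e D TX TY).ψ (y, (codeScheme e D TX TY).φ x) 0).toReal
      = (if TX x ∧ D (e x) y ∧ TY y then 1 else 0) ∧
    ((codeScheme e D TX TY).ψ (y, (codeScheme e D TX TY).φ x) 1).toReal
      = (if TX x ∧ D (e x) y ∧ TY y then 0 else 1) := by
  have h : (∃ m, finSuccEquiv N ((codeScheme e D TX TY).φ x) = some m ∧ D m y ∧ TY y)
      ↔ TX x ∧ D (e x) y ∧ TY y := by
    simp only [codeScheme, Equiv.apply_symm_apply]
    by_cases hx : TX x <;> simp [hx]
  have h' : (codeScheme e D TX TY).ψ (y, (codeScheme e D TX TY).φ x)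
      = PMF.pure (if TX x ∧ D (e x) y ∧ TY y then 0 else 1) := by
    simp only [← h]
    rfl
  rw [h']
  by_cases hc : TX x ∧ D (e x) y ∧ TY y
  · rw [if_pos hc, if_pos hc, if_pos hc]; simp [PMF.pure_apply]
  · rw [if_neg hc, if_neg hc, if_neg hc]; simp [PMF.pure_apply]

variable [Fintype 𝒳] [MeasurableSpace 𝒳] [MeasurableSingletonClass 𝒳]
  [Fintype 𝒴] [MeasurableSpace 𝒴] [MeasurableSingletonClass 𝒴]
  {P : Measure (𝒴 × 𝒳)} [IsProbabilityMeasure P] {R ε E AX AY J : ℝ}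
  {QY : (n : ℕ) → Measure (Fin n → 𝒴)} {QX : (n : ℕ) → Measure (Fin n → 𝒳)}

/-- The words whose log-likelihood ratio per letter is close to its limit. -/
def Typical {𝒳 : Type*} [MeasurableSpace 𝒳] (P : Measure 𝒳) (Q : (n : ℕ) → Measure (Fin n → 𝒳))
    (A η : ℝ) (n : ℕ) (x : Fin n → 𝒳) : Prop :=
  -- On words of probability zero the logarithmic ratio carries no information, and no multiple of
  -- P^{⊗n} would bound Q.
  (iid P n).real {x} ≠ 0 ∧ ¬ η * n ≤ |logRatio P Q n x - n * A|

lemma Typical.real_le {𝒳 : Type*} [MeasurableSpace 𝒳] {P : Measure 𝒳} [IsProbabilityMeasure P]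
    {Q : (n : ℕ) → Measure (Fin n → 𝒳)} {A η : ℝ} {n : ℕ} [IsProbabilityMeasure (Q n)]
    (hac : iid P n ≪ Q n) {x : Fin n → 𝒳} (h : Typical P Q A η n x) :
    (Q n).real {x} ≤ Real.exp (-(n * (A - η))) * (iid P n).real {x} := by
  refine real_le_of_lt_logRatio hac h.1 ?_
  have h1 := h.2
  have := neg_abs_le (logRatio P Q n x - n * A)
  linarith

open Classical in
lemma sum_not_typical_le {𝒳 : Type*} [Fintype 𝒳] [MeasurableSpace 𝒳] [MeasurableSingletonClass 𝒳]
    (P : Measure 𝒳) [IsProbabilityMeasure P] (Q : (n : ℕ) → Measure (Fin n → 𝒳)) (A η : ℝ) (n : ℕ) :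
    ∑ x, (if Typical P Q A η n x then 0 else (iid P n).real {x})
      ≤ (iid P n).real {x | η * n ≤ |logRatio P Q n x - n * A|} := by
  rw [measureReal_eq_sum]
  refine Finset.sum_le_sum fun x _ => ?_
  by_cases h1 : (iid P n).real {x} = 0
  · simp [h1]
  · by_cases h2 : η * n ≤ |logRatio P Q n x - n * A| <;> simp [Typical, h1, h2]

-- On typical words the alternative is replaced by P_Y × P_X, with gains exp(-n(A_X - η)) and
-- exp(-n(A_Y - η)); given the message, the decision region contributes exp(-nJ). The type I error
-- tends to 0, so any ε is met.
open Classical in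
lemma isAchievable_of_codes (hQY : ∀ n, IsProbabilityMeasure (QY n))
    (hQX : ∀ n, IsProbabilityMeasure (QX n)) (hacY : ∀ n, iid P.fst n ≪ QY n)
    (hacX : ∀ n, iid P.snd n ≪ QX n) (hY : Concentrates P.fst QY AY)
    (hX : Concentrates P.snd QX AX) {N : ℕ → ℕ} (e : ∀ n, (Fin n → 𝒳) → Fin (N n))
    (D : ∀ n, Fin (N n) → (Fin n → 𝒴) → Prop)
    (herr : Tendsto (fun n => ∑ v : (Fin n → 𝒴) × (Fin n → 𝒳),
        if D n (e n v.2) v.1 then 0 else ∏ i, P.real {(v.1 i, v.2 i)}) atTop (𝓝 0))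
    (hD : ∀ n a, ∑ y, (if D n a y then ∏ i, margFst (fun z => P.real {z}) (y i) else 0)
        ≤ Real.exp (-(n * J)))
    (hN : ∀ ρ, R < ρ → ∀ᶠ n in atTop, Real.log (N n + 1) / n ≤ ρ)
    (hE : E < J + (AX + AY)) :
    IsAchievable (iidPair P) (fun n => (QY n).prod (QX n)) R ε E := by
  -- Half of the slack in the exponent, spent once on X and once on Y.
  set η := (J + (AX + AY) - E) / 2 with hη
  have hη0 : 0 < η := by linarith
  let s : (n : ℕ) → TestingScheme 𝒳 𝒴 n := fun n =>
    codeScheme (e n) (D n) (Typical P.snd QX AX η n) (Typical P.fst QY AY η n)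
  have hs : ∀ n y x, ((s n).ψ (y, (s n).φ x) 0).toReal
      = (if Typical P.snd QX AX η n x ∧ D n (e n x) y ∧ Typical P.fst QY AY η n y then 1 else 0) ∧
      ((s n).ψ (y, (s n).φ x) 1).toReal
      = (if Typical P.snd QX AX η n x ∧ D n (e n x) y ∧ Typical P.fst QY AY η n y then 0 else 1) :=
    fun n y x => codeScheme_ψ _ _ _ _ y x
  refine ⟨s, ?_, ?_, ?_⟩
  · have hlim : Tendsto (fun n => ∑ v : (Fin n → 𝒴) × (Fin n → 𝒳),
        (iidPair P n).real {v} * ((s n).ψ (v.1, (s n).φ v.2) 1).toReal) atTop (𝓝 0) := by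
      have h := ((hX η hη0).add (hY η hη0)).add herr
      simp only [add_zero] at h
      refine squeeze_zero (fun n => Finset.sum_nonneg fun v _ => mul_nonneg measureReal_nonneg
        ENNReal.toReal_nonneg) (fun n => ?_) h
      refine le_trans ?_ (add_le_add_left (add_le_add (sum_not_typical_le P.snd QX AX η n)
        (sum_not_typical_le P.fst QY AY η n)) _)
      have h1 : ∑ x, (if Typical P.snd QX AX η n x then 0 else (iid P.snd n).real {x})
          = ∑ v : (Fin n → 𝒴) × (Fin n → 𝒳),
            if Typical P.snd QX AX η n v.2 then 0 else (iidPair P n).real {v} := by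
        rw [Fintype.sum_prod_type_right]
        refine Finset.sum_congr rfl fun x _ => ?_
        split_ifs
        · simp
        · rw [← iidPair_snd, ← margSnd_real]; rfl
      have h2 : ∑ y, (if Typical P.fst QY AY η n y then 0 else (iid P.fst n).real {y})
          = ∑ v : (Fin n → 𝒴) × (Fin n → 𝒳),
            if Typical P.fst QY AY η n v.1 then 0 else (iidPair P n).real {v} := by
        rw [Fintype.sum_prod_type]
        refine Finset.sum_congr rfl fun x _ => ?_
        split_ifs
        · simp
        · rw [← iidPair_fst, ← margFst_real]; rfl
      rw [h1, h2, ← Finset.sum_add_distrib, ← Finset.sum_add_distrib]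
      refine Finset.sum_le_sum fun v _ => ?_
      rw [(hs n v.1 v.2).2, ← iidPair_real_singleton]
      have h0 : 0 ≤ (iidPair P n).real {v} := measureReal_nonneg
      by_cases a1 : Typical P.snd QX AX η n v.2 <;> by_cases a2 : D n (e n v.2) v.1 <;>
        by_cases a3 : Typical P.fst QY AY η n v.1 <;> simp [a1, a2, a3, h0]
    have h2 : Tendsto (fun n => (s n).typeI (iidPair P n)) atTop (𝓝 0) := by
      simp only [TestingScheme.typeI, lintegral_observed]
      simpa using ENNReal.tendsto_ofReal hlim
    rw [h2.limsup_eq]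
    exact zero_le
  · refine le_liminf_of_le (by isBoundedDefault) ?_
    filter_upwards [eventually_gt_atTop 0] with n hn
    rw [le_log_inv_div_iff hn, TestingScheme.typeII, lintegral_observed]
    refine ENNReal.ofReal_le_ofReal ?_
    rw [Fintype.sum_prod_type_right]
    calc _ ≤ ∑ x, Real.exp (-(n * (AX - η))) * (iid P.snd n).real {x} *
          (Real.exp (-(n * (AY - η))) *
            ∑ y, (if D n (e n x) y then (iid P.fst n).real {y} else 0)) := by
          refine Finset.sum_le_sum fun x _ => ?_
          rw [Finset.mul_sum, Finset.mul_sum]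
          refine Finset.sum_le_sum fun y _ => ?_
          rw [(hs n y x).1, ← Set.singleton_prod_singleton, measureReal_prod_prod]
          split_ifs with h1 h2 h2
          · rw [mul_one, mul_comm]
            exact mul_le_mul (h1.1.real_le (hacX n)) (h1.2.2.real_le (hacY n)) measureReal_nonneg
              (mul_nonneg (Real.exp_pos _).le measureReal_nonneg)
          · exact absurd h1.2.1 h2
          · rw [mul_zero]
            have h3 : 0 ≤ (iid P.snd n).real {x} := measureReal_nonneg
            have h4 : 0 ≤ (iid P.fst n).real {y} := measureReal_nonneg
            positivity
          · simp
      _ ≤ ∑ x, Real.exp (-(n * (AX - η))) * (iid P.snd n).real {x} *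
          (Real.exp (-(n * (AY - η))) * Real.exp (-(n * J))) := by
          refine Finset.sum_le_sum fun x _ => mul_le_mul_of_nonneg_left
            (mul_le_mul_of_nonneg_left ?_ (Real.exp_pos _).le)
            (mul_nonneg (Real.exp_pos _).le measureReal_nonneg)
          refine le_trans (le_of_eq ?_) (hD n (e n x))
          refine Finset.sum_congr rfl fun y _ => ?_
          rw [iid_real_singleton]
          simp only [margFst_real]
      _ = Real.exp (-(n * E)) := by
          rw [← Finset.sum_mul, ← Finset.mul_sum, (real_mem_stdSimplex (iid P.snd n)).2, mul_one,
            ← Real.exp_add, ← Real.exp_add]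
          congr 1
          rw [hη]; ring
  · refine le_of_forall_gt_imp_ge_of_dense fun ρ hρ => ?_
    induction ρ with
    | bot => exact absurd hρ not_lt_bot
    | top => exact le_top
    | coe ρ =>
      refine limsup_le_of_le (by isBoundedDefault) ?_
      filter_upwards [hN ρ (by exact_mod_cast hρ)] with n hn
      have : ((s n).M : ℝ) = N n + 1 := by simp [s, codeScheme]
      rw [this]
      exact_mod_cast hn

/-- Every exponent below the one given by a channel with `I(U;X) < R` is achievable. -/
lemma isAchievable_of_channel (hQY : ∀ n, IsProbabilityMeasure (QY n))
    (hQX : ∀ n, IsProbabilityMeasure (QX n)) (hacY : ∀ n, iid P.fst n ≪ QY n)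
    (hacX : ∀ n, iid P.snd n ≪ QX n) (hY : Concentrates P.fst QY AY)
    (hX : Concentrates P.snd QX AX) {m : ℕ} {w : 𝒳 → Fin m → ℝ}
    (hw : ∀ x, w x ∈ stdSimplex ℝ (Fin m)) (hR0 : 0 < R)
    (hR : homEntropy (margSnd fun z => P.real {z})
      - (channelProfile (fun z => P.real {z}) w).2.1 < R)
    (hE : E < homEntropy (margFst fun z => P.real {z})
      - (channelProfile (fun z => P.real {z}) w).2.2.1 + (AX + AY)) :
    IsAchievable (iidPair P) (fun n => (QY n).prod (QX n)) R ε E := by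
  -- Taking r > 0 makes exp(nr) ≥ 1, so that the codewords together with the failure message number
  -- at most 3 exp(nr).
  obtain ⟨r, hr, hrR⟩ := exists_between (max_lt hR hR0)
  obtain ⟨J, hJ, hJ'⟩ := exists_between (sub_lt_iff_lt_add.2 hE)
  obtain ⟨N, e, D, herr, hD, hN⟩ := exists_codes P hw (lt_of_le_of_lt (le_max_left _ _) hr) hJ'
  refine isAchievable_of_codes hQY hQX hacY hacX hY hX e D herr hD (fun ρ hρ => ?_) (by linarith)
  have hr0 : 0 < r := lt_of_le_of_lt (le_max_right _ _) hr
  have hlarge : ∀ᶠ n : ℕ in atTop, Real.log 3 ≤ (R - r) * n :=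
    (tendsto_natCast_atTop_atTop.const_mul_atTop (by linarith)).eventually_ge_atTop _
  filter_upwards [eventually_gt_atTop 0, hlarge] with n hn hn2
  have hn' : (0 : ℝ) < n := by exact_mod_cast hn
  rw [div_le_iff₀ hn']
  have h1 : (N n : ℝ) + 1 ≤ 3 * Real.exp (n * r) := by
    have : 1 ≤ Real.exp (n * r) := Real.one_le_exp (by positivity)
    linarith [hN n]
  have h2 := Real.log_le_log (by positivity) h1
  rw [Real.log_mul (by norm_num) (Real.exp_pos _).ne', Real.log_exp] at h2
  have h3 := mul_le_mul_of_nonneg_right hρ.le hn'.le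
  linarith

/-- At any rate the exponent `A_X + A_Y` is achieved up to an arbitrarily small loss. -/
lemma isAchievable_of_lt (hQY : ∀ n, IsProbabilityMeasure (QY n))
    (hQX : ∀ n, IsProbabilityMeasure (QX n)) (hacY : ∀ n, iid P.fst n ≪ QY n)
    (hacX : ∀ n, iid P.snd n ≪ QX n) (hY : Concentrates P.fst QY AY)
    (hX : Concentrates P.snd QX AX) (hR : 0 ≤ R) (hE : E < AX + AY) :
    IsAchievable (iidPair P) (fun n => (QY n).prod (QX n)) R ε E := by
  -- A single codeword whose region is everything: x contributes one bit, its typicality, at zero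
  -- rate.
  refine isAchievable_of_codes (J := 0) hQY hQX hacY hacX hY hX (N := fun _ => 1) (fun _ _ => 0)
    (fun _ _ _ => True) (by simp) (fun n a => ?_) (fun ρ hρ => ?_) (by linarith)
  · have h := (real_mem_stdSimplex (iid P.fst n)).2
    simp only [iid_real_singleton, ← margFst_real] at h
    simp [h]
  · have h := tendsto_const_div_atTop_nhds_zero_nat (Real.log ((1 : ℕ) + 1))
    exact (h.eventually_lt_const (lt_of_le_of_lt hR hρ)).mono fun n hn => hn.le

end Achievability

/-! ### The optimal exponent -/

section Main

variable {𝒳 𝒴 : Type*} [Fintype 𝒳] [MeasurableSpace 𝒳] [MeasurableSingletonClass 𝒳]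
  [Fintype 𝒴] [MeasurableSpace 𝒴] [MeasurableSingletonClass 𝒴]
  {P : Measure (𝒴 × 𝒳)} [IsProbabilityMeasure P] {R ε AX AY : ℝ}
  {QY : (n : ℕ) → Measure (Fin n → 𝒴)} {QX : (n : ℕ) → Measure (Fin n → 𝒳)}

/-- A convex combination with the constant channel has strictly smaller rate. -/
lemma smul_add_smul_profile_mem_feasibleSet {𝒳 𝒴 : Type*} [Fintype 𝒳] [Fintype 𝒴] {p : 𝒴 × 𝒳 → ℝ} (hp : p ∈ stdSimplex ℝ (𝒴 × 𝒳))
    {k : Profile 𝒳 𝒴} (hk : k ∈ feasibleSet p R) {t : ℝ} (ht0 : 0 ≤ t) (ht1 : t ≤ 1) :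
    (1 - t) • k + t • profile p ∈ feasibleSet p ((1 - t) * R) := by
  obtain ⟨m, w, hw, hkw⟩ := exists_channel_of_mem_feasibleSet hp.1 hk
  have hk1 : k.1 = p := by rw [hkw, channelProfile_fst hw]
  obtain ⟨hkS, -, -, hm, hr⟩ := hk
  rw [hk1] at hm hr
  have h1 : ((1 - t) • k + t • profile p).1 = p := by
    simp only [Prod.fst_add, Prod.smul_fst, hk1, profile, ← add_smul, sub_add_cancel, one_smul]
  refine ⟨?_, ?_, ?_, ?_, ?_⟩
  · exact convex_convexHull ℝ _ hkS (subset_convexHull ℝ _ ⟨p, hp, rfl⟩) (by linarith) ht0 (by ring)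
  · rw [h1]; exact fun _ h => h
  · rw [h1]; exact fun _ => rfl
  · rw [h1, neg_sum_mul_log_sub hp] at *
    simp only [Prod.snd_add, Prod.fst_add, Prod.smul_snd, Prod.smul_fst, smul_eq_mul, profile]
    have := mul_le_mul_of_nonneg_left hm (by linarith : 0 ≤ 1 - t)
    linarith
  · rw [h1, ← homEntropy_of_sum_eq_one hp.2] at *
    simp only [Prod.snd_add, Prod.smul_snd, smul_eq_mul, profile]
    have := mul_le_mul_of_nonneg_left hr (by linarith : 0 ≤ 1 - t)
    linarith

/-- Data processing: `I(U;Y) ≤ I(U;X)`. -/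
lemma channelProfile_data_processing {𝒳 𝒴 κ : Type*} [Fintype 𝒳] [Fintype 𝒴] [Fintype κ]
    {p : 𝒴 × 𝒳 → ℝ} (hp : ∀ z, 0 ≤ p z) {w : 𝒳 → κ → ℝ} (hw : ∀ x, w x ∈ stdSimplex ℝ κ) :
    homEntropy (margFst p) - (channelProfile p w).2.2.1
      ≤ homEntropy p - (channelProfile p w).2.2.2 := by
  have h1 : ∀ y, ∑ u, homEntropy (fun x => channelWeight p w u (y, x))
      ≤ homEntropy (fun x => p (y, x)) := fun y => by
    refine (sum_homEntropy_le Finset.univ (r := fun u x => channelWeight p w u (y, x))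
      fun u x => mul_nonneg (hp _) ((hw x).1 u)).trans (le_of_eq ?_)
    congr 1
    ext x
    simp only [Finset.sum_apply, channelWeight, ← Finset.mul_sum, (hw x).2, mul_one]
  have h2 := Finset.sum_le_sum fun y (_ : y ∈ Finset.univ) => h1 y
  rw [Finset.sum_comm] at h2
  have h3 : ∀ r : 𝒴 × 𝒳 → ℝ,
      homEntropy r = homEntropy (margFst r) + ∑ y, homEntropy (fun x => r (y, x)) := homEntropy_prod
  simp only [channelProfile, profile, Prod.snd_sum, Prod.fst_sum]
  rw [h3 p, Finset.sum_congr rfl fun u _ => h3 (channelWeight p w u), Finset.sum_add_distrib]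
  linarith

/-- The optimal exponent, given the concentration of the log-likelihood ratios. -/
lemma maxExponent_eq (hQY : ∀ n, IsProbabilityMeasure (QY n))
    (hQX : ∀ n, IsProbabilityMeasure (QX n)) (hacY : ∀ n, iid P.fst n ≪ QY n)
    (hacX : ∀ n, iid P.snd n ≪ QX n) (hY : Concentrates P.fst QY AY)
    (hX : Concentrates P.snd QX AX) (hR : 0 ≤ R) (hε : ε < 1) {k : Profile 𝒳 𝒴}
    (hk : k ∈ feasibleSet (fun z => P.real {z}) R)
    (hmin : ∀ k' ∈ feasibleSet (fun z => P.real {z}) R, k.2.2.1 ≤ k'.2.2.1) :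
    maxExponent (iidPair P) (fun n => (QY n).prod (QX n)) R ε
      = ((homEntropy (margFst fun z => P.real {z}) - k.2.2.1 + (AX + AY) : ℝ) : EReal) := by
  set p : 𝒴 × 𝒳 → ℝ := fun z => P.real {z} with hpdef
  have hp : p ∈ stdSimplex ℝ (𝒴 × 𝒳) := real_mem_stdSimplex P
  obtain ⟨z₀⟩ : Nonempty (𝒴 × 𝒳) := nonempty_of_isProbabilityMeasure P
  have : Nonempty 𝒴 := ⟨z₀.1⟩
  have : Nonempty 𝒳 := ⟨z₀.2⟩
  apply le_antisymm
  · refine sSup_le ?_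
    rintro _ ⟨E, hE, rfl⟩
    obtain ⟨k', hk', h⟩ := exists_feasible_of_isAchievable hQY hQX hacY hacX hY hX hε hE
    have := hmin k' hk'
    exact EReal.coe_le_coe_iff.2 (by linarith)
  · refine le_of_forall_lt fun E hE => ?_
    obtain ⟨E', hE', hE'2⟩ := EReal.lt_iff_exists_real_btwn.1 hE
    refine lt_of_lt_of_le hE' (le_sSup ⟨E', ?_, rfl⟩)
    have hE2 : E' < homEntropy (margFst p) - k.2.2.1 + (AX + AY) := by exact_mod_cast hE'2
    -- At R = 0 no channel has I(U;X) < R, but feasibility gives I(U;YX) ≤ 0, so the information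
    -- term is at most 0.
    rcases hR.eq_or_lt with hR0 | hR0
    · refine isAchievable_of_lt hQY hQX hacY hacX hY hX hR ?_
      obtain ⟨m, w, hw, rfl⟩ := exists_channel_of_mem_feasibleSet hp.1 hk
      have h1 := channelProfile_data_processing hp.1 hw
      have h2 := hk.2.2.2.2
      rw [channelProfile_fst hw, ← homEntropy_of_sum_eq_one hp.2] at h2
      linarith
    · set g := homEntropy (margFst p) - k.2.2.1 with hg
      -- Mixing in a fraction t of the constant channel makes the rate (1 - t)R < R and lowers the
      -- exponent by at most t|g|, chosen below the gap; the added 1 avoids division by zero.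
      obtain ⟨t, ht0, ht1, ht⟩ : ∃ t : ℝ, 0 < t ∧ t ≤ 1 ∧ t * |g| < g + (AX + AY) - E' := by
        have hΔ : 0 < g + (AX + AY) - E' := by linarith
        refine ⟨min 1 ((g + (AX + AY) - E') / (|g| + 1)), lt_min one_pos (by positivity),
          min_le_left _ _, ?_⟩
        refine lt_of_le_of_lt (mul_le_mul_of_nonneg_right (min_le_right _ _) (abs_nonneg g)) ?_
        rw [div_mul_eq_mul_div, div_lt_iff₀ (by positivity)]
        linarith
      have hkt := smul_add_smul_profile_mem_feasibleSet hp hk ht0.le ht1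
      have hY1 : ((1 - t) • k + t • profile p).2.2.1 = (1 - t) * k.2.2.1 + t * homEntropy (margFst p) :=
        rfl
      obtain ⟨m, w, hw, hkw⟩ := exists_channel_of_mem_feasibleSet hp.1 hkt
      rw [hkw] at hkt hY1
      have hrate := (channelProfile_mem_feasibleSet hp hw).1 hkt
      refine isAchievable_of_channel hQY hQX hacY hacX hY hX hw hR0 ?_ ?_
      · have := mul_pos ht0 hR0
        linarith
      · rw [hY1]
        have := mul_le_mul_of_nonneg_left (le_abs_self g) ht0.le
        have h3 : homEntropy (margFst p) - ((1 - t) * k.2.2.1 + t * homEntropy (margFst p))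
            = g - t * g := by rw [hg]; ring
        rw [h3]
        linarith

end Main

/-! ### Memoryless alternatives -/

section Memoryless

lemma iid_absolutelyContinuous {𝒳 : Type*} [Finite 𝒳] [MeasurableSpace 𝒳] {P Q : Measure 𝒳}
    [IsProbabilityMeasure P] [IsProbabilityMeasure Q] (h : P ≪ Q) (n : ℕ) :
    iid P n ≪ iid Q n := by
  rw [absolutelyContinuous_iff_singleton]
  intro x hx
  rw [iid, Measure.pi_singleton, Finset.prod_eq_zero_iff] at hx ⊢
  obtain ⟨i, hi, h0⟩ := hx
  exact ⟨i, hi, h h0⟩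

variable {𝒳 : Type*} [Fintype 𝒳] [MeasurableSpace 𝒳] [MeasurableSingletonClass 𝒳]
  {P Q : Measure 𝒳} [IsProbabilityMeasure P] [IsProbabilityMeasure Q]

/-- A product law is Markov of order 0, and the mean increment of the log-likelihood ratio is then
the divergence itself. -/
lemma concentrates_iid (h : P ≪ Q) : Concentrates P (iid Q) (klDiv P Q).toReal := by
  have hW : HasTransition (k := 0) (iid Q) (Kernel.const _ Q) := by
    intro n x
    simp only [iid, Measure.pi_singleton, Kernel.const_apply]
    exact Fin.prod_univ_castSucc _
  have hA : ∫ b, logIncrement P (Kernel.const (Fin 0 → 𝒳) Q) b ∂(Measure.pi fun _ : Fin (0 + 1) => P)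
      = (klDiv P Q).toReal := by
    have h1 := integral_pi_eval P (fun a => Real.log (P.real {a}) - Real.log (Q.real {a}))
      (Fin.last 0)
    rw [toReal_klDiv_eq_sum h]
    refine Eq.trans ?_ (h1.trans ?_)
    · rfl
    · rw [integral_fintype .of_finite]
      rfl
  intro δ hδ
  have := tendsto_logRatio_markov hW (iid_absolutelyContinuous h) (fun n => inferInstance) hδ
  rw [hA] at this
  exact this

end Memoryless

end OneSidedTesting

/-! ### The theorem, with one minimizing profile for both categories -/

theorem mainTheorem10 {𝒳 𝒴 : Type*}
    [Finite 𝒳] [MeasurableSpace 𝒳] [MeasurableSingletonClass 𝒳]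
    [Finite 𝒴] [MeasurableSpace 𝒴] [MeasurableSingletonClass 𝒴]
    (P : Measure (𝒴 × 𝒳)) [IsProbabilityMeasure P] (R : ℝ) (hR : 0 ≤ R) :
    ∃ v : ℝ≥0∞, IsGreatest (OneSidedTesting.infoValues P R) v ∧
      -- first category: memoryless alternatives
      (∀ (QY : Measure 𝒴) (QX : Measure 𝒳) [IsProbabilityMeasure QY] [IsProbabilityMeasure QX],
        klDiv P.fst QY < ∞ → klDiv P.snd QX < ∞ →
        ∀ ε : ℝ, 0 ≤ ε → ε < 1 →
          OneSidedTesting.maxExponent (OneSidedTesting.iidPair P)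
              (fun n => (OneSidedTesting.iid QY n).prod (OneSidedTesting.iid QX n)) R ε
            = (v : EReal) + ((klDiv P.snd QX : EReal) + (klDiv P.fst QY : EReal))) ∧
      -- second category: finite-order Markov alternatives
      (∀ (QY : (n : ℕ) → Measure (Fin n → 𝒴)) (QX : (n : ℕ) → Measure (Fin n → 𝒳)),
        OneSidedTesting.IsFiniteOrderMarkov QY → OneSidedTesting.IsFiniteOrderMarkov QX →
        (∀ n, OneSidedTesting.iid P.fst n ≪ QY n) → (∀ n, OneSidedTesting.iid P.snd n ≪ QX n) →
        ∃ AX AY : ℝ,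
          OneSidedTesting.HasDivergenceRate P.snd QX (AX : EReal) ∧
          OneSidedTesting.HasDivergenceRate P.fst QY (AY : EReal) ∧
          ∀ ε : ℝ, 0 ≤ ε → ε < 1 →
            OneSidedTesting.maxExponent (OneSidedTesting.iidPair P)
                (fun n => (QY n).prod (QX n)) R ε
              = (v : EReal) + ((AX : EReal) + (AY : EReal))) := by
  classical
  have := Fintype.ofFinite 𝒳
  have := Fintype.ofFinite 𝒴
  obtain ⟨k, hk, hmin, hnn, hgreatest⟩ := OneSidedTesting.exists_isGreatest_infoValues P hR
  refine ⟨_, hgreatest, ?_, ?_⟩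
  · intro QY QX _ _ hY hX ε _ hε
    have hacY := (klDiv_ne_top_iff.1 hY.ne).1
    have hacX := (klDiv_ne_top_iff.1 hX.ne).1
    rw [OneSidedTesting.maxExponent_eq (fun n => inferInstance) (fun n => inferInstance)
      (OneSidedTesting.iid_absolutelyContinuous hacY)
      (OneSidedTesting.iid_absolutelyContinuous hacX) (OneSidedTesting.concentrates_iid hacY)
      (OneSidedTesting.concentrates_iid hacX) hR hε hk hmin, EReal.coe_add, EReal.coe_add,
      EReal.coe_ennreal_toReal hX.ne, EReal.coe_ennreal_toReal hY.ne, EReal.coe_ennreal_ofReal,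
      max_eq_left hnn]
  · intro QY QX hY hX hacY hacX
    obtain ⟨kY, WY, _, hWY⟩ := hY.transition
    obtain ⟨kX, WX, _, hWX⟩ := hX.transition
    refine ⟨_, _, OneSidedTesting.hasDivergenceRate_markov hWX hacX hX.prob,
      OneSidedTesting.hasDivergenceRate_markov hWY hacY hY.prob, fun ε _ hε => ?_⟩
    rw [OneSidedTesting.maxExponent_eq hY.prob hX.prob hacY hacX
      (fun δ hδ => OneSidedTesting.tendsto_logRatio_markov hWY hacY hY.prob hδ)
      (fun δ hδ => OneSidedTesting.tendsto_logRatio_markov hWX hacX hX.prob hδ) hR hε hk hmin,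
      EReal.coe_add, EReal.coe_add, EReal.coe_ennreal_ofReal, max_eq_left hnn]
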